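/- **Setting.** Let $\mathcal M$ be a finite discounted MDP with states $[S]$, actions $[A]$ ($A\ge1$), row-stochastic transition matrix $P$, expected rewards $r$ and discount factor $\gamma\in[0,1)$. For a stationary stochastic policy $\pi$ put $v_\pi=\sum_{t\ge0}(\gamma P_\pi)^t r_\pi$, and let $v^*$ be the optimal value function. The planner has $\gamma$, $\varepsilon$, a feature map $\varphi:[S]\to\mathbb R^d$, a list of $m$ distinct core states $s_1,\dots,s_m$, and a simulator. The assumptions are: 1. there is $v\in\mathbb R^d$ with $\varphi_s^\top v=1$ for all $s$; 2. every $\varphi_s$ is a non-negative linear combination of $\varphi_{s_1},\dots,\varphi_{s_m}$; 3. a call $\mathrm{Simulate}(s,a)$ returns, independently of everything before, a state $s'\sim P_{sa}$ and a reward $\hat r$ with $\mathbb E\hat r=r_{sa}$ and $|\hat r|\le1$ almost surely. Let $\epsilon_{\rm approx}=\inf_{\theta}\max_s|v^*(s)-\varphi_s^\top\theta|$, let $\Phi_*\in\mathbb R^{m\times d}$ have the rows $\varphi_{s_i}$, and put $$\ell=\log A+\gamma\log m,\quad B=\frac{(9/8)\sqrt m}{1-\gamma},\quad C=\frac{(9/4)\sqrt{m(1+2\ell)}}{(1-\gamma)^2},\quad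 T=\Big\lfloor \frac{m(1+\ell)}{\varepsilon^2}\Big\rfloor,\quad \eta=\frac1C\sqrt{\frac{2}{7T}} .$$ **Algorithm (CoreStoMP) for the planning state $s_0$ and $\varepsilon>0$.** The variables are $\theta\in\mathbb R^d$ and $\lambda\in\mathbb R_+^{(1+m)A}$, indexed by $(s_i,a)$ with $0\le i\le m$, where the block of $s_0$ is kept apart from the blocks of $s_1,\dots,s_m$ even if $s_0$ is a core state. Start with $\theta_0=0$, $\lambda_{0,s_0a}=1/A$ and $\lambda_{0,s_ia}=\gamma/((1-\gamma)mA)$ for $i\ge1$. A *gradient estimate* at $(\theta,\lambda)$ is a pair $(\xi,\rho)$ with $$\xi=\varphi_{s_0}+\|\lambda\|_1(\gamma\varphi_{s'}-\varphi_s),\qquad (s,a)\sim\lambda/\|\lambda\|_1,\ s'\sim\mathrm{Simulate}(s,a),$$ $$\rho_{s_ia}=\hat r+(\gamma\varphi_{s'}-\varphi_{s_i})^\top\theta,\qquad (s',\hat r)\sim\mathrm{Simulate}(s_i,a),$$ with a new simulator call for $\xi$ and for each component of $\rho$. The *proximal update* $\mathrm{Prox}((\theta,\lambda),(\xi,\rho))=(\theta',\lambda')$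 is $$\tilde\theta=\theta-\eta B^2\delta\ \text{ with } \Phi_*^\top\Phi_*\delta=\xi,\qquad \theta'=\tilde\theta/\max\{1,\|\Phi_*\tilde\theta\|_2/B\},$$ $$\tilde\lambda_{s_ia}=\lambda_{s_ia}\exp\!\Big(\frac{2\ell}{1-\gamma}\,\eta\rho_{s_ia}\Big),\qquad \lambda'_{s_0}=\tilde\lambda_{s_0}/\|\tilde\lambda_{s_0}\|_1,\qquad \lambda'_*=\frac{\gamma}{1-\gamma}\,\tilde\lambda_*/\|\tilde\lambda_*\|_1\quad(\lambda'_*=0\text{ if }\gamma=0),$$ where $\lambda_{s_0}$ is the block of $s_0$ and $\lambda_*$ consists of all the other blocks. (A solution $\delta$ exists; its choice does not influence $\lambda$.) For $\tau=1,\dots,T$ let $(\theta'_\tau,\lambda'_\tau)=\mathrm{Prox}((\theta_{\tau-1},\lambda_{\tau-1}),\cdot)$ with a gradient estimate at $(\theta_{\tau-1},\lambda_{\tau-1})$, and then $(\theta_\tau,\lambda_\tau)=\mathrm{Prox}((\theta_{\tau-1},\lambda_{\tau-1}),\cdot)$ with a new gradient estimate at $(\theta'_\tau,\lambda'_\tau)$.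 Let $\hat\lambda=\frac1T\sum_{\tau=1}^T\lambda_\tau$ ($\hat\lambda=\lambda_0$ if $T=0$), and return an action $a$ drawn with the probabilities $\hat\lambda_{s_0a}$. **Statement.** There are absolute constants $K,k$ and one fixed program of a randomized real random access machine (unit cost for real arithmetic, comparison, $\exp$, $\log$, square root, addition and comparison of natural numbers, array access, reading a core state or a coordinate of a feature vector, a simulator call, and drawing a uniform number in $[0,1]$) such that the following holds for all $S,A,d,m$, all $\mathcal M$, $\varphi$, core states and simulators that satisfy the three assumptions, and all $\varepsilon>0$. * On the input $d,A,m,\gamma,\varepsilon,s_0$, for every planning state $s_0$ and every outcome of the randomness, the program halts and outputs the action returned by the algorithm above. It makes at most $$K\,\frac{m^2A\,(1+\log A+\gamma\log m)}{\varepsilon^2}$$ simulator calls and at most $K\,(d+A+m+1/\varepsilon)^k$ steps in total. * Let $\pi(a\mid s)$ be the probability that the action $a$ is returned for the planning state $s$. Then $\pi$ is a stochastic policy, and for every state $s$ $$v^*(s)-v_\pi(s)\le K\Big(\frac{\epsilon_{\rm approx}}{(1-\gamma)^2}+\frac{\varepsilon}{(1-\gamma)^3}\Big).$$ -/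

import Mathlib

open MeasureTheory
open scoped Matrix

namespace CorePlanning

noncomputable section

/-! ## Markov decision processes -/

/-- A finite discounted MDP with states `Fin S` and actions `Fin A`: a row-stochastic transition
matrix, expected rewards and a discount factor in `[0, 1)`. -/
structure MDP (S A : ℕ) where
  P : Fin S → Fin A → Fin S → ℝ
  P_nonneg : ∀ s a t, 0 ≤ P s a t
  P_sum : ∀ s a, ∑ t, P s a t = 1
  r : Fin S → Fin A → ℝ
  γ : ℝ
  γ_nonneg : 0 ≤ γ
  γ_lt_one : γ < 1

/-- A stationary stochastic policy: `pol s a` is the probability of action `a` in state `s`. -/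
def IsPolicy {S A : ℕ} (pol : Fin S → Fin A → ℝ) : Prop :=
  (∀ s a, 0 ≤ pol s a) ∧ ∀ s, ∑ a, pol s a = 1

namespace MDP

variable {S A : ℕ} (M : MDP S A)

/-- Expected reward vector of a policy. -/
def rPol (pol : Fin S → Fin A → ℝ) : Fin S → ℝ := fun s => ∑ a, pol s a * M.r s a

/-- State transition matrix of a policy. -/
def PPol (pol : Fin S → Fin A → ℝ) : Matrix (Fin S) (Fin S) ℝ :=
  Matrix.of fun s t => ∑ a, pol s a * M.P s a t

/-- The value of a policy, `∑ₜ (γ P_π)ᵗ r_π`. -/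
def value (pol : Fin S → Fin A → ℝ) (s : Fin S) : ℝ :=
  ∑' t : ℕ, (((M.γ • M.PPol pol) ^ t) *ᵥ M.rPol pol) s

/-- The optimal value function: the pointwise supremum of the values of all policies. -/
def optValue (s : Fin S) : ℝ :=
  ⨆ pol : {pol : Fin S → Fin A → ℝ // IsPolicy pol}, M.value pol.1 s

end MDP

/-! ## Planning problems: features, core states, simulator -/

/-- An MDP with a feature map into `ℝ^d`, an enumeration of `m` distinct core states, and
a simulator: `sim s a` is the joint law of the pair (next state, random reward). -/
structure Problem (S A d m : ℕ) where
  mdp : MDP S A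
  φ : Fin S → Fin d → ℝ
  core : Fin m ↪ Fin S
  sim : Fin S → Fin A → ProbabilityMeasure (Fin S × ℝ)

/-- The standing assumptions on features, core states and simulator. -/
structure Problem.Assumptions {S A d m : ℕ} (Q : Problem S A d m) : Prop where
  /-- The constant function `1` is a linear combination of the features. -/
  features : ∃ v : Fin d → ℝ, ∀ s, Q.φ s ⬝ᵥ v = 1
  /-- Every feature vector is a non-negative combination of those of the core states. -/
  coreStates : ∃ Z : Matrix (Fin S) (Fin m) ℝ, (∀ s i, 0 ≤ Z s i) ∧
    ∀ s, Q.φ s = ∑ i, Z s i • Q.φ (Q.core i)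
  /-- The simulated next state has law `P s a`. -/
  simNext : ∀ s a t, (Q.sim s a : Measure (Fin S × ℝ)) {x | x.1 = t} = ENNReal.ofReal (Q.mdp.P s a t)
  /-- The simulated reward has mean `r s a`. -/
  simMean : ∀ s a, ∫ x, x.2 ∂(Q.sim s a : Measure (Fin S × ℝ)) = Q.mdp.r s a
  /-- The simulated reward lies in `[-1, 1]`. -/
  simBound : ∀ s a, ∀ᵐ x ∂(Q.sim s a : Measure (Fin S × ℝ)), |x.2| ≤ 1

/-- The best uniform error in approximating the optimal value function by the features. -/
def Problem.epsApprox {S A d m : ℕ} (Q : Problem S A d m) : ℝ :=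
  ⨅ θ : Fin d → ℝ, ⨆ s : Fin S, |Q.mdp.optValue s - Q.φ s ⬝ᵥ θ|

/-! ## Randomness -/

/-- A random tape. `ω.1 n s a` is the answer of the simulator if its call number `n` is the query
`(s, a)`; `ω.2 n` is the `n`-th number drawn uniformly from `[0, 1]` by the planner. -/
abbrev Tape (S A : ℕ) := (ℕ → Fin S → Fin A → Fin S × ℝ) × (ℕ → unitInterval)

/-- The law of the tape: all its entries are independent, `ω.1 n s a` has the law `sim s a` and
`ω.2 n` is uniform. -/
def Problem.tapeLaw {S A d m : ℕ} (Q : Problem S A d m) : Measure (Tape S A) :=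
  (Measure.infinitePi fun _ : ℕ => Measure.pi fun s : Fin S => Measure.pi fun a : Fin A =>
    (Q.sim s a : Measure (Fin S × ℝ))).prod
  (Measure.infinitePi fun _ : ℕ => (volume : Measure unitInterval))

open Classical in
/-- Sampling an index with probabilities proportional to the non-negative weights `w`, from
a uniform number `u` in `[0, 1]`, by inversion of the cumulative distribution function: the first
`k` with `u * ∑ⱼ w j ≤ ∑_{j ≤ k} w j`. -/
def pick {ι : Type} [Fintype ι] [LinearOrder ι] [Nonempty ι] (w : ι → ℝ) (u : ℝ) : ι :=
  if h : (Finset.univ.filter fun k => u * ∑ j, w j ≤ ∑ j with j ≤ k, w j).Nonempty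
  then Finset.min' _ h else Classical.arbitrary ι

/-! ## The algorithm CoreStoMP -/

section Algorithm

variable {S A d m : ℕ}

/-- `ℓ = log A + γ log m`. -/
def ell (A m : ℕ) (γ : ℝ) : ℝ := Real.log A + γ * Real.log m

/-- The radius `B` of the primal domain. -/
def radius (m : ℕ) (γ : ℝ) : ℝ := 9 / 8 * √m / (1 - γ)

/-- The constant `C`. -/
def bigC (A m : ℕ) (γ : ℝ) : ℝ := 9 / 4 * √(m * (1 + 2 * ell A m γ)) / (1 - γ) ^ 2

/-- The step size `η = C⁻¹ √(2 / (7 T))`. -/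
def stepSize (A m : ℕ) (γ : ℝ) (T : ℕ) : ℝ := (bigC A m γ)⁻¹ * √(2 / (7 * T))

/-- The number of iterations used for the accuracy `ε`. -/
def iterations (A m : ℕ) (γ ε : ℝ) : ℕ := ⌊m * (1 + ell A m γ) / ε ^ 2⌋₊

/-- The sequence `(s₀, s₁, …, s_m)`: the planning state followed by the core states. -/
def plus (core : Fin m ↪ Fin S) (s0 : Fin S) : Fin (m + 1) → Fin S := Fin.cons s0 core

/-- The feature matrix of the core states, with rows `φ (core i)`. -/
def corePhi (φ : Fin S → Fin d → ℝ) (core : Fin m ↪ Fin S) : Matrix (Fin m) (Fin d) ℝ :=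
  Matrix.of fun i => φ (core i)

/-- The norm `‖Φ_* θ‖₂` of the primal variables. -/
def coreNorm (φ : Fin S → Fin d → ℝ) (core : Fin m ↪ Fin S) (θ : Fin d → ℝ) : ℝ :=
  √(∑ i, ((corePhi φ core *ᵥ θ) i) ^ 2)

/-- The vector that represents the linear functional `ξ` in the inner product
`⟪x, y⟫ = (Φ_* x) ⬝ (Φ_* y)`, that is, a solution `δ` of `Φ_*ᵀ Φ_* δ = ξ`. It exists if `ξ` is in the
row space of `Φ_*`, and then it is unique up to the kernel of `Φ_*`. -/
def riesz (φ : Fin S → Fin d → ℝ) (core : Fin m ↪ Fin S) (ξ : Fin d → ℝ) : Fin d → ℝ :=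
  Classical.epsilon fun δ => (corePhi φ core)ᵀ *ᵥ (corePhi φ core *ᵥ δ) = ξ

/-- The primal part of the proximal update: for the regularizer `‖Φ_* θ‖₂² / (2 B²)`, a step
against the gradient `ξ` and the projection to `{‖Φ_* θ‖₂ ≤ B}`. -/
def proxTheta (φ : Fin S → Fin d → ℝ) (core : Fin m ↪ Fin S) (B η : ℝ)
    (θ ξ : Fin d → ℝ) : Fin d → ℝ :=
  let θt := θ - (η * B ^ 2) • riesz φ core ξ
  (max 1 (coreNorm φ core θt / B))⁻¹ • θt

/-- The dual part of the proximal update: for the regularizer `h ((1 - γ) λ) / (2 ℓ)`, with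
`h` the negentropy, a multiplicative step along the gradient `ρ`, and the normalization of the
block of `s₀` to total mass `1` and of the block of the core states to total mass `γ / (1 - γ)`. -/
def proxLam (γ η : ℝ) (lam ρ : Fin (m + 1) → Fin A → ℝ) : Fin (m + 1) → Fin A → ℝ :=
  let lt : Fin (m + 1) → Fin A → ℝ := fun i a =>
    lam i a * Real.exp (2 * ell A m γ / (1 - γ) * (η * ρ i a))
  fun i a =>
    if i = 0 then lt i a / ∑ b, lt 0 b
    else γ / (1 - γ) * lt i a / ∑ j : Fin m, ∑ b, lt j.succ b

/-- The number `1 + (1 + m) A` of simulator calls for one pair of gradient estimates. -/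
def callsPerGradient (A m : ℕ) : ℕ := 1 + (1 + m) * A

/-- The estimate of the gradient in `θ` in the pair number `h` of gradient estimates:
`φ s₀ + ‖λ‖₁ (γ φ s' - φ s)`, where `(s, a)` is drawn from `λ / ‖λ‖₁` and `s'` from the simulator
at `(s, a)`. -/
def estTheta [NeZero A] (γ : ℝ) (φ : Fin S → Fin d → ℝ) (core : Fin m ↪ Fin S) (s0 : Fin S)
    (ω : Tape S A) (h : ℕ) (lam : Fin (m + 1) → Fin A → ℝ) : Fin d → ℝ :=
  let p := ofLex (pick (fun q : Fin (m + 1) ×ₗ Fin A => lam (ofLex q).1 (ofLex q).2) (ω.2 h))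
  let s := plus core s0 p.1
  let t := (ω.1 (h * callsPerGradient A m) s p.2).1
  φ s0 + (∑ i, ∑ a, |lam i a|) • (γ • φ t - φ s)

/-- The estimate of the gradient in `λ` in the pair number `h` of gradient estimates:
the component at `(s, a)` is `r + (γ φ s' - φ s) ⬝ θ`, with `(s', r)` drawn from the simulator at
`(s, a)`, by a new call for each component. -/
def estLam (γ : ℝ) (φ : Fin S → Fin d → ℝ) (core : Fin m ↪ Fin S) (s0 : Fin S)
    (ω : Tape S A) (h : ℕ) (θ : Fin d → ℝ) : Fin (m + 1) → Fin A → ℝ := fun i a =>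
  let s := plus core s0 i
  let x := ω.1 (h * callsPerGradient A m + 1 + i * A + a) s a
  x.2 + (γ • φ x.1 - φ s) ⬝ᵥ θ

/-- The starting point: `θ = 0` and `λ` uniform on each of its two blocks. -/
def start (A d m : ℕ) (γ : ℝ) : (Fin d → ℝ) × (Fin (m + 1) → Fin A → ℝ) :=
  (0, fun i _ => if i = 0 then 1 / A else γ / ((1 - γ) * m * A))

/-- One proximal update of the point `z`, with the gradient estimates number `h` at `y`. -/
def proxStep [NeZero A] (γ : ℝ) (φ : Fin S → Fin d → ℝ) (core : Fin m ↪ Fin S) (B η : ℝ)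
    (s0 : Fin S) (ω : Tape S A) (h : ℕ) (z y : (Fin d → ℝ) × (Fin (m + 1) → Fin A → ℝ)) :
    (Fin d → ℝ) × (Fin (m + 1) → Fin A → ℝ) :=
  (proxTheta φ core B η z.1 (estTheta γ φ core s0 ω h y.2),
    proxLam γ η z.2 (estLam γ φ core s0 ω h y.1))

/-- The iterates `(θ_τ, λ_τ)`: each iteration makes an extrapolation step from the last iterate, and
then a step from the last iterate with the gradient estimates at the extrapolated point. -/
def iterate [NeZero A] (γ : ℝ) (φ : Fin S → Fin d → ℝ) (core : Fin m ↪ Fin S) (B η : ℝ)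
    (s0 : Fin S) (ω : Tape S A) : ℕ → (Fin d → ℝ) × (Fin (m + 1) → Fin A → ℝ)
  | 0 => start A d m γ
  | τ + 1 =>
    let z := iterate γ φ core B η s0 ω τ
    let y := proxStep γ φ core B η s0 ω (2 * τ) z z
    proxStep γ φ core B η s0 ω (2 * τ + 1) z y

/-- The result of `T` iterations: the average of `λ_1, …, λ_T` (the starting point if `T = 0`). -/
def result [NeZero A] (γ : ℝ) (φ : Fin S → Fin d → ℝ) (core : Fin m ↪ Fin S) (T : ℕ) (B η : ℝ)
    (s0 : Fin S) (ω : Tape S A) : Fin (m + 1) → Fin A → ℝ :=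
  if T = 0 then (start A d m γ).2
  else (1 / T : ℝ) • ∑ τ ∈ Finset.range T, (iterate γ φ core B η s0 ω (τ + 1)).2

/-- The action returned in the planning state `s0` for the accuracy `ε`: it is drawn from the
`s0`-block of the result, which is a probability distribution on the actions. -/
def action [NeZero A] (γ : ℝ) (φ : Fin S → Fin d → ℝ) (core : Fin m ↪ Fin S) (ε : ℝ)
    (s0 : Fin S) (ω : Tape S A) : Fin A :=
  let T := iterations A m γ ε
  pick (result γ φ core T (radius m γ) (stepSize A m γ T) s0 ω 0) (ω.2 (2 * T))

/-- The stochastic policy of the planner: `π(a | s)` is the probability that `a` is returned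
for the planning state `s`. -/
def Problem.plannerPolicy [NeZero A] (Q : Problem S A d m) (ε : ℝ) (s : Fin S) (a : Fin A) : ℝ :=
  (Q.tapeLaw {ω | action Q.mdp.γ Q.φ Q.core ε s ω = a}).toReal

end Algorithm

/-! ## The model of computation

A real random access machine, programmed in a small imperative language. It has natural number
registers, finitely many named two-dimensional arrays of reals, and registers that hold states of
the MDP. States are opaque: they can only be passed to the feature map and to the simulator. -/

/-- Natural number expressions; `reg x` is the content of the register `x`. -/
inductive NExp where
  | lit (n : ℕ)
  | reg (x : ℕ)
  | add (e f : NExp)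

/-- Real expressions; `cell b i j` is the entry `(i, j)` of the array `b`. -/
inductive RExp where
  | nat (e : NExp)
  | cell (b : ℕ) (i j : NExp)
  | add (e f : RExp)
  | sub (e f : RExp)
  | mul (e f : RExp)
  | div (e f : RExp)
  | exp (e : RExp)
  | log (e : RExp)
  | sqrt (e : RExp)

/-- Tests. -/
inductive BExp where
  | natLt (e f : NExp)
  | realLt (e f : RExp)
  | not (c : BExp)

/-- Programs. -/
inductive Cmd where
  /-- do nothing -/
  | skip
  /-- `x := e` for a natural number register -/
  | setNat (x : ℕ) (e : NExp)
  /-- `b[i, j] := e` -/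
  | setReal (b : ℕ) (i j : NExp) (e : RExp)
  /-- the state register `x` receives the core state number `i` -/
  | getCore (x : ℕ) (i : NExp)
  /-- `b[i, j]` receives the coordinate `k` of the feature vector of the state in register `x` -/
  | getFeature (b : ℕ) (i j : NExp) (x : ℕ) (k : NExp)
  /-- the simulator is called for the state in register `x` and action `a`; the state register `y`
  receives the next state and `b[i, j]` receives the reward -/
  | simulate (y : ℕ) (b : ℕ) (i j : NExp) (x : ℕ) (a : NExp)
  /-- `b[i, j]` receives a fresh uniform random number from `[0, 1]` -/
  | draw (b : ℕ) (i j : NExp)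
  | seq (p q : Cmd)
  | ite (c : BExp) (p q : Cmd)
  | loop (c : BExp) (p : Cmd)

/-- The memory of the machine, with the numbers of simulator calls and of random draws so far. -/
structure Config (S : ℕ) where
  nat : ℕ → ℕ
  real : ℕ → ℕ → ℕ → ℝ
  state : ℕ → Fin S
  calls : ℕ
  draws : ℕ

def NExp.eval {S : ℕ} (c : Config S) : NExp → ℕ
  | lit n => n
  | reg x => c.nat x
  | add e f => e.eval c + f.eval c

def RExp.eval {S : ℕ} (c : Config S) : RExp → ℝ
  | nat e => (e.eval c : ℝ)
  | cell b i j => c.real b (i.eval c) (j.eval c)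
  | add e f => e.eval c + f.eval c
  | sub e f => e.eval c - f.eval c
  | mul e f => e.eval c * f.eval c
  | div e f => e.eval c / f.eval c
  | exp e => Real.exp (e.eval c)
  | log e => Real.log (e.eval c)
  | sqrt e => √(e.eval c)

def BExp.Holds {S : ℕ} (c : Config S) : BExp → Prop
  | natLt e f => e.eval c < f.eval c
  | realLt e f => e.eval c < f.eval c
  | not b => ¬ b.Holds c

/-- Write the real `v` into the entry `(i, j)` of the array `b`. -/
def Config.writeReal {S : ℕ} (c : Config S) (b i j : ℕ) (v : ℝ) : Config S :=
  { c with
    real := fun b' i' j' => if b' = b ∧ i' = i ∧ j' = j then v else c.real b' i' j' }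

/-- Write a natural number into a register. -/
def Config.writeNat {S : ℕ} (c : Config S) (x n : ℕ) : Config S :=
  { c with nat := Function.update c.nat x n }

/-- Write a state into a register. -/
def Config.writeState {S : ℕ} (c : Config S) (x : ℕ) (s : Fin S) : Config S :=
  { c with state := Function.update c.state x s }

/-- Count one simulator call. -/
def Config.countCall {S : ℕ} (c : Config S) : Config S := { c with calls := c.calls + 1 }

/-- Count one random draw. -/
def Config.countDraw {S : ℕ} (c : Config S) : Config S := { c with draws := c.draws + 1 }

/-- `Exec φ core ω p c c₁ n`: with the random tape `ω`, the program `p` started in `c` halts in `c₁`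
after `n` elementary steps (an assignment, a test, an access to the features or the core states,
a simulator call or a random draw is one step). Out-of-range arguments make the program fail. -/
inductive Exec {S A d m : ℕ} (φ : Fin S → Fin d → ℝ) (core : Fin m ↪ Fin S) (ω : Tape S A) :
    Cmd → Config S → Config S → ℕ → Prop where
  | skip (c) : Exec φ core ω .skip c c 1
  | setNat (c x e) : Exec φ core ω (.setNat x e) c (c.writeNat x (e.eval c)) 1
  | setReal (c b i j e) :
      Exec φ core ω (.setReal b i j e) c (c.writeReal b (i.eval c) (j.eval c) (e.eval c)) 1
  | getCore (c x i) (h : NExp.eval c i < m) :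
      Exec φ core ω (.getCore x i) c (c.writeState x (core ⟨i.eval c, h⟩)) 1
  | getFeature (c b i j x k) (h : NExp.eval c k < d) :
      Exec φ core ω (.getFeature b i j x k) c
        (c.writeReal b (i.eval c) (j.eval c) (φ (c.state x) ⟨k.eval c, h⟩)) 1
  | simulate (c y b i j x a) (h : NExp.eval c a < A) :
      Exec φ core ω (.simulate y b i j x a) c
        (((c.writeReal b (i.eval c) (j.eval c)
            (ω.1 c.calls (c.state x) ⟨a.eval c, h⟩).2).writeState
            y (ω.1 c.calls (c.state x) ⟨a.eval c, h⟩).1).countCall) 1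
  | draw (c b i j) :
      Exec φ core ω (.draw b i j) c
        ((c.writeReal b (i.eval c) (j.eval c) (ω.2 c.draws : ℝ)).countDraw) 1
  | seq {p q c c₁ c₂ n k} (hp : Exec φ core ω p c c₁ n) (hq : Exec φ core ω q c₁ c₂ k) :
      Exec φ core ω (.seq p q) c c₂ (n + k)
  | iteTrue {b p q c c₁ n} (hb : BExp.Holds c b) (hp : Exec φ core ω p c c₁ n) :
      Exec φ core ω (.ite b p q) c c₁ (n + 1)
  | iteFalse {b p q c c₁ n} (hb : ¬ BExp.Holds c b) (hq : Exec φ core ω q c c₁ n) :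
      Exec φ core ω (.ite b p q) c c₁ (n + 1)
  | loopTrue {b p c c₁ c₂ n k} (hb : BExp.Holds c b) (hp : Exec φ core ω p c c₁ n)
      (hl : Exec φ core ω (.loop b p) c₁ c₂ k) : Exec φ core ω (.loop b p) c c₂ (n + k + 1)
  | loopFalse {b p c} (hb : ¬ BExp.Holds c b) : Exec φ core ω (.loop b p) c c 1

/-- The input of the planner: the numbers `d`, `A`, `m` in the registers `0`, `1`, `2`, the numbers
`γ` and `ε` in the entries `(0, 0)` and `(0, 1)` of the array `0`, and the planning state; the other
numbers in the memory are `0`. The number `S` of states is not an input. -/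
def inputConfig {S : ℕ} (d A m : ℕ) (γ ε : ℝ) (s0 : Fin S) : Config S where
  nat x := if x = 0 then d else if x = 1 then A else if x = 2 then m else 0
  real b i j := if b = 0 ∧ i = 0 ∧ j = 0 then γ else if b = 0 ∧ i = 0 ∧ j = 1 then ε else 0
  state _ := s0
  calls := 0
  draws := 0

end

end CorePlanning

open CorePlanning

namespace CorePlanning

noncomputable section

/-! ## Discounted MDPs -/

/-! Planning at one state s₀ is a bilinear saddle-point problem. For x = Φθ in the span of the
features and weights λ ≥ 0 put L(x, λ) = x(s₀) + Σ λ(sᵢ, a) adv_x(sᵢ, a), where the block of s₀ has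
mass 1 and the core block has mass γ/(1-γ). Let Φu approximate v* uniformly up to e. Two facts carry
the approximation part. For every x in the span some vertex λ has L(x, λ) ≥ v*(s₀) - 2γe/(1-γ)
(`exists_optValue_le_lagrangeVertex`): features are convex combinations of core features, so the
largest advantage over the core states already controls v* - x at all states. For every λ, L(Φu, λ)
≤ Σ λ(s₀, a) look_{v*}(s₀, a) + 3e/(1-γ) (`lagrange_le`), because v* has no positive advantage. So a
small gap makes the s₀-block of λ nearly optimal for one step followed by v*. If this holds at every
state, `MDP.sub_value_le` bounds the loss of the whole policy, at the price of one more factor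
1/(1-γ).

The gap is bounded by regret. In `sampledGap_le` a projected step in the seminorm ‖Φ_* θ‖ and a
multiplicative step in λ each have a telescoping regret bound. The extrapolated point and the new
point lie within O(η) of the old one, so exchanging them costs only terms of order η; no smoothness
is exploited. Since the algorithm averages the new λ and not the extrapolated one, a correction with
the exact gradient at Φu is added. In total the average gap is at most 1/(ηT) + O(ηC²), and the
choice of η and T makes this O(ε/(1-γ)²) (`gap_bound`).

The gradient estimates used in the second half of an iteration read tape entries that the
extrapolated point has not read. Replacing these entries by fresh samples preserves the law of the
tape (`integral_resample`), which gives unbiasedness (`eqInt_sampledGap`). As L is affine in each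
argument, the argument can be run with expected averages. These are deterministic: the best vertex
against the expected x is a fixed comparator, and the s₀-block of the expected λ is exactly the
planner's policy (`plannerPolicy_eq_average`).

For the machine, the solution of the normal equations is made explicit by a generalized inverse
(`gram_ginv`). Two solutions differ by a kernel vector of Φ_*, which no feature vector sees, so λ is
unchanged (`sameFeatures_iterate`). Correctness is proved in a Hoare logic `Runs` with frame
conditions read off from the sets of written registers and arrays. If every loop makes at most N
rounds, the time is at most size times N to the nesting depth (`Cmd.cost_le`), and N is polynomially
bounded. -/

/-- A discounted maximum principle. -/
theorem le_div_of_discounted {ι : Type*} [Finite ι] {γ c : ℝ} (hγ : γ < 1) {x : ι → ℝ}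
    (h : ∀ b, (∀ t, x t ≤ b) → ∀ s, x s ≤ γ * b + c) (s : ι) : x s ≤ c / (1 - γ) := by
  have : Nonempty ι := ⟨s⟩
  obtain ⟨t, ht⟩ := Finite.exists_max x
  -- The bound is the maximum itself, so x t ≤ γ x t + c at the maximizer.
  have h1 := h (x t) ht t
  rw [le_div_iff₀ (by linarith)]
  have h2 := ht s
  nlinarith

theorem sum_weight_le {ι : Type*} [Fintype ι] {w f : ι → ℝ} {b : ℝ} (hw : ∀ i, 0 ≤ w i)
    (hs : ∑ i, w i = 1) (hf : ∀ i, f i ≤ b) : ∑ i, w i * f i ≤ b := by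
  calc ∑ i, w i * f i ≤ ∑ i, w i * b :=
        Finset.sum_le_sum fun i _ => mul_le_mul_of_nonneg_left (hf i) (hw i)
    _ = b := by rw [← Finset.sum_mul, hs, one_mul]

theorem abs_sum_weight_le {ι : Type*} [Fintype ι] {w f : ι → ℝ} {b : ℝ} (hw : ∀ i, 0 ≤ w i)
    (hs : ∑ i, w i = 1) (hf : ∀ i, |f i| ≤ b) : |∑ i, w i * f i| ≤ b := by
  rw [abs_le]
  constructor
  · have := sum_weight_le (f := fun i => - f i) hw hs (fun i => (neg_le_abs _).trans (hf i))
    simp only [mul_neg, Finset.sum_neg_distrib] at this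
    linarith
  · exact sum_weight_le hw hs fun i => (le_abs_self _).trans (hf i)

namespace MDP

variable {S A : ℕ} (M : MDP S A)

/-- The one-step lookahead of the value function `v`. -/
def look (v : Fin S → ℝ) (s : Fin S) (a : Fin A) : ℝ := M.r s a + M.γ * ∑ t, M.P s a t * v t

/-- The advantage of the action `a` in the state `s` over the value function `v`. -/
def adv (v : Fin S → ℝ) (s : Fin S) (a : Fin A) : ℝ := M.look v s a - v s

theorem one_sub_pos : 0 < 1 - M.γ := sub_pos.2 M.γ_lt_one

/-- The one-sided form of the γ-contraction, valid for `b` of either sign because `P s a` only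
averages. This is the form that feeds `le_div_of_discounted`. -/
theorem look_sub_le {v w : Fin S → ℝ} {b : ℝ} (h : ∀ t, v t - w t ≤ b) (s : Fin S) (a : Fin A) :
    M.look v s a - M.look w s a ≤ M.γ * b := by
  have := sum_weight_le (M.P_nonneg s a) (M.P_sum s a) h
  have h2 : M.look v s a - M.look w s a = M.γ * ∑ t, M.P s a t * (v t - w t) := by
    simp only [look, mul_sub, Finset.sum_sub_distrib]; ring
  rw [h2]
  exact mul_le_mul_of_nonneg_left this M.γ_nonneg

theorem abs_look_sub_le {v w : Fin S → ℝ} {b : ℝ} (h : ∀ t, |v t - w t| ≤ b) (s : Fin S)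
    (a : Fin A) : |M.look v s a - M.look w s a| ≤ M.γ * b := by
  rw [abs_le]
  have h1 := M.look_sub_le (fun t => (le_abs_self _).trans (h t)) s a
  have h2 := M.look_sub_le (v := w) (w := v)
    (fun t => (le_abs_self _).trans ((abs_sub_comm _ _).le.trans (h t))) s a
  constructor <;> linarith

theorem norm_PPol_mulVec_le {pol : Fin S → Fin A → ℝ} (hp : IsPolicy pol) (x : Fin S → ℝ) :
    ‖M.PPol pol *ᵥ x‖ ≤ ‖x‖ := by
  refine (pi_norm_le_iff_of_nonneg (norm_nonneg _)).2 fun s => ?_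
  have h1 : (M.PPol pol *ᵥ x) s = ∑ a, pol s a * ∑ t, M.P s a t * x t := by
    simp only [Matrix.mulVec, dotProduct, PPol, Matrix.of_apply, Finset.sum_mul, Finset.mul_sum]
    rw [Finset.sum_comm]
    simp only [mul_assoc]
  rw [h1, Real.norm_eq_abs]
  exact abs_sum_weight_le (hp.1 s) (hp.2 s) fun a =>
    abs_sum_weight_le (M.P_nonneg s a) (M.P_sum s a) fun t => norm_le_pi_norm x t

theorem norm_pow_mulVec_le {pol : Fin S → Fin A → ℝ} (hp : IsPolicy pol) (x : Fin S → ℝ) (t : ℕ) :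
    ‖((M.γ • M.PPol pol) ^ t) *ᵥ x‖ ≤ M.γ ^ t * ‖x‖ := by
  induction t with
  | zero => simp
  | succ t ih =>
    rw [pow_succ', ← Matrix.mulVec_mulVec, Matrix.smul_mulVec, norm_smul, Real.norm_eq_abs,
      abs_of_nonneg M.γ_nonneg, pow_succ', mul_assoc]
    exact mul_le_mul_of_nonneg_left ((M.norm_PPol_mulVec_le hp _).trans ih) M.γ_nonneg

theorem summable_value {pol : Fin S → Fin A → ℝ} (hp : IsPolicy pol) (s : Fin S) :
    Summable fun t : ℕ => (((M.γ • M.PPol pol) ^ t) *ᵥ M.rPol pol) s := by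
  refine Summable.of_norm_bounded
    ((summable_geometric_of_lt_one M.γ_nonneg M.γ_lt_one).mul_right ‖M.rPol pol‖) fun t => ?_
  exact (norm_le_pi_norm _ s).trans (M.norm_pow_mulVec_le hp _ t)

/-- The Bellman equation of a policy. -/
theorem value_eq {pol : Fin S → Fin A → ℝ} (hp : IsPolicy pol) (s : Fin S) :
    M.value pol s = ∑ a, pol s a * M.look (M.value pol) s a := by
  have h0 : M.value pol s = M.rPol pol s +
      ∑' t : ℕ, (((M.γ • M.PPol pol) ^ (t + 1)) *ᵥ M.rPol pol) s := by
    rw [value, (M.summable_value hp s).tsum_eq_zero_add]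
    simp
  have h1 : ∀ t : ℕ, (((M.γ • M.PPol pol) ^ (t + 1)) *ᵥ M.rPol pol) s =
      ∑ u, M.γ * M.PPol pol s u * (((M.γ • M.PPol pol) ^ t) *ᵥ M.rPol pol) u := by
    intro t
    rw [pow_succ', ← Matrix.mulVec_mulVec]
    simp [Matrix.mulVec, dotProduct]
  rw [h0]
  simp only [h1]
  rw [Summable.tsum_finsetSum fun u _ => (M.summable_value hp u).mul_left _]
  simp only [tsum_mul_left]
  have h2 : ∀ u, M.PPol pol s u = ∑ a, pol s a * M.P s a u := fun u => rfl
  simp only [look, rPol, h2, mul_add, Finset.sum_add_distrib, Finset.mul_sum, Finset.sum_mul]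
  congr 1
  rw [Finset.sum_comm]
  refine Finset.sum_congr rfl fun a _ => Finset.sum_congr rfl fun t _ => ?_
  simp only [value]
  ring

/-- The Bellman optimality operator. -/
def bellman [NeZero A] (v : Fin S → ℝ) : Fin S → ℝ := fun s =>
  Finset.univ.sup' Finset.univ_nonempty (M.look v s)

theorem contracting_bellman [NeZero A] : ContractingWith M.γ.toNNReal M.bellman := by
  refine ⟨by simpa using M.γ_lt_one, LipschitzWith.of_dist_le_mul fun v w => ?_⟩
  rw [Real.coe_toNNReal _ M.γ_nonneg, dist_pi_le_iff (mul_nonneg M.γ_nonneg dist_nonneg)]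
  intro s
  have key : ∀ v w : Fin S → ℝ, M.bellman v s - M.bellman w s ≤ M.γ * dist v w := by
    intro v w
    rw [sub_le_iff_le_add]
    refine Finset.sup'_le _ _ fun a _ => ?_
    have h1 := M.look_sub_le (fun t => (le_abs_self _).trans (dist_le_pi_dist v w t)) s a
    have h2 : M.look w s a ≤ M.bellman w s := Finset.le_sup' (M.look w s) (Finset.mem_univ a)
    linarith
  rw [Real.dist_eq, abs_le]
  have h1 := key v w
  have h2 := key w v
  rw [dist_comm w v] at h2
  constructor <;> linarith

/-- The fixed point of the Bellman contraction, with the maximum over actions split into an upper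
bound and its attainment. -/
theorem exists_bellman [NeZero A] : ∃ V : Fin S → ℝ, (∀ s a, M.look V s a ≤ V s) ∧ ∀ s, ∃ a, V s = M.look V s a := by
  have hV := M.contracting_bellman.fixedPoint_isFixedPt
  refine ⟨M.contracting_bellman.fixedPoint, fun s a => ?_, fun s => ?_⟩
  · conv_rhs => rw [← hV.eq]
    exact Finset.le_sup' (M.look _ s) (Finset.mem_univ a)
  · obtain ⟨a, _, ha⟩ := Finset.exists_mem_eq_sup' Finset.univ_nonempty
      (M.look M.contracting_bellman.fixedPoint s)
    refine ⟨a, ?_⟩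
    conv_lhs => rw [← hV.eq]
    exact ha

/-- The excess of the policy value over a supersolution is at most γ times its own maximum, hence
nonpositive. -/
theorem value_le_of_look_le {pol : Fin S → Fin A → ℝ} (hp : IsPolicy pol) {V : Fin S → ℝ}
    (hV : ∀ s a, M.look V s a ≤ V s) (s : Fin S) : M.value pol s ≤ V s := by
  have := le_div_of_discounted (c := 0) M.γ_lt_one (x := fun s => M.value pol s - V s)
    (fun b hb s => by
      have h1 : ∑ a, pol s a * (M.look (M.value pol) s a - V s) ≤ M.γ * b := by
        refine sum_weight_le (hp.1 s) (hp.2 s) fun a => ?_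
        have h2 := M.look_sub_le hb s a
        have h3 := hV s a
        linarith
      simp only [mul_sub, Finset.sum_sub_distrib, ← Finset.sum_mul, hp.2 s] at h1
      rw [M.value_eq hp s]
      linarith) s
  simp only [zero_div] at this
  linarith

/-- A loss of `c` in each step accumulates geometrically. Applied with `V` the optimal value, it
converts the guarantee at single planning states into a bound for the policy. -/
theorem sub_value_le {pol : Fin S → Fin A → ℝ} (hp : IsPolicy pol) {V : Fin S → ℝ} {c : ℝ}
    (hV : ∀ s, V s ≤ ∑ a, pol s a * M.look V s a + c) (s : Fin S) :
    V s - M.value pol s ≤ c / (1 - M.γ) := by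
  refine le_div_of_discounted (c := c) M.γ_lt_one (x := fun s => V s - M.value pol s)
    (fun b hb s => ?_) s
  have h1 : ∑ a, pol s a * (M.look V s a - M.look (M.value pol) s a) ≤ M.γ * b :=
    sum_weight_le (hp.1 s) (hp.2 s) fun a => M.look_sub_le hb s a
  simp only [mul_sub, Finset.sum_sub_distrib] at h1
  have h2 := hV s
  have h3 := M.value_eq hp s
  linarith

theorem isPolicy_single (g : Fin S → Fin A) : IsPolicy (fun s => (Pi.single (g s) 1 : Fin A → ℝ)) := by
  refine ⟨fun s a => ?_, fun s => by simp⟩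
  by_cases h : a = g s
  · subst h; simp
  · simp [h]

/-- The Bellman optimality equation for the optimal value function. -/
theorem optValue_bellman [NeZero A] :
    (∀ s a, M.look M.optValue s a ≤ M.optValue s) ∧ ∀ s, ∃ a, M.optValue s = M.look M.optValue s a := by
  obtain ⟨V, h1, h2⟩ := M.exists_bellman
  suffices h : M.optValue = V by rw [h]; exact ⟨h1, h2⟩
  choose g hg using h2
  have : Nonempty {pol : Fin S → Fin A → ℝ // IsPolicy pol} := ⟨⟨_, isPolicy_single g⟩⟩
  funext s
  refine le_antisymm (ciSup_le fun pol => M.value_le_of_look_le pol.2 h1 s) ?_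
  -- The greedy policy loses nothing in one step, so it attains `V`.
  have h3 := M.sub_value_le (isPolicy_single g) (V := V) (c := 0) (fun s => by
    simp [Pi.single_apply, ← hg s]) s
  have h4 : M.value (fun s => (Pi.single (g s) 1 : Fin A → ℝ)) s ≤ M.optValue s :=
    le_ciSup (f := fun pol : {pol : Fin S → Fin A → ℝ // IsPolicy pol} => M.value pol.1 s)
      ⟨V s, by rintro _ ⟨pol, rfl⟩; exact M.value_le_of_look_le pol.2 h1 s⟩ ⟨_, isPolicy_single g⟩
  simp only [zero_div] at h3
  linarith

theorem abs_value_le {pol : Fin S → Fin A → ℝ} (hp : IsPolicy pol) (hr : ∀ s a, |M.r s a| ≤ 1)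
    (s : Fin S) : |M.value pol s| ≤ 1 / (1 - M.γ) := by
  refine le_div_of_discounted (c := 1) M.γ_lt_one (x := fun s => |M.value pol s|)
    (fun b hb s => ?_) s
  rw [M.value_eq hp s]
  refine abs_sum_weight_le (hp.1 s) (hp.2 s) fun a => ?_
  have h1 := abs_sum_weight_le (M.P_nonneg s a) (M.P_sum s a) hb
  calc |M.look (M.value pol) s a| ≤ |M.r s a| + |M.γ * ∑ t, M.P s a t * M.value pol t| := abs_add_le _ _
    _ ≤ 1 + M.γ * b := by
        rw [abs_mul, abs_of_nonneg M.γ_nonneg]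
        exact add_le_add (hr s a) (mul_le_mul_of_nonneg_left h1 M.γ_nonneg)
    _ = _ := by ring

theorem abs_optValue_le [NeZero A] (hr : ∀ s a, |M.r s a| ≤ 1) (s : Fin S) :
    |M.optValue s| ≤ 1 / (1 - M.γ) := by
  obtain ⟨h1, h2⟩ := M.optValue_bellman
  refine le_div_of_discounted (c := 1) M.γ_lt_one (x := fun s => |M.optValue s|)
    (fun b hb s => ?_) s
  obtain ⟨a, ha⟩ := h2 s
  rw [ha]
  have h1 := abs_sum_weight_le (M.P_nonneg s a) (M.P_sum s a) hb
  calc |M.look M.optValue s a| ≤ |M.r s a| + |M.γ * ∑ t, M.P s a t * M.optValue t| := abs_add_le _ _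
    _ ≤ 1 + M.γ * b := by
        rw [abs_mul, abs_of_nonneg M.γ_nonneg]
        exact add_le_add (hr s a) (mul_le_mul_of_nonneg_left h1 M.γ_nonneg)
    _ = _ := by ring

end MDP

/-! ## A generalized inverse by conjugate directions -/

section GeneralizedInverse

variable {d m : ℕ}

/-- The part of the `k`-th unit vector that is conjugate to the directions collected in `H`. -/
def conjDir (G H : Matrix (Fin d) (Fin d) ℝ) (k : Fin d) : Fin d → ℝ :=
  fun j => (if j = k then 1 else 0) - ∑ l, H j l * G l k

/-- One step of the conjugate direction method: the direction `conjDir G H k` is added to `H`. -/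
def ginvStep (G H : Matrix (Fin d) (Fin d) ℝ) (k : Fin d) : Matrix (Fin d) (Fin d) ℝ :=
  fun i j => H i j + conjDir G H k i * conjDir G H k j / ∑ l, conjDir G H k l * G l k

/-- The matrix collected from the first `k` unit vectors. -/
def ginvAux (G : Matrix (Fin d) (Fin d) ℝ) : ℕ → Matrix (Fin d) (Fin d) ℝ
  | 0 => 0
  | k + 1 => if h : k < d then ginvStep G (ginvAux G k) ⟨k, h⟩ else ginvAux G k

/-- A generalized inverse of `Φᵀ Φ`. -/
def ginv (Φ : Matrix (Fin m) (Fin d) ℝ) : Matrix (Fin d) (Fin d) ℝ := ginvAux (Φᵀ * Φ) d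

theorem conjDir_eq (G H : Matrix (Fin d) (Fin d) ℝ) (k : Fin d) :
    conjDir G H k = Pi.single k 1 - H *ᵥ (G *ᵥ Pi.single k 1) := by
  ext j
  simp [conjDir, Matrix.mulVec, dotProduct, Pi.single_apply]

theorem ginvStep_eq (G H : Matrix (Fin d) (Fin d) ℝ) (k : Fin d) :
    ginvStep G H k = H + (conjDir G H k ⬝ᵥ (G *ᵥ Pi.single k 1))⁻¹ •
      Matrix.vecMulVec (conjDir G H k) (conjDir G H k) := by
  ext i j
  simp only [ginvStep, Matrix.add_apply, Matrix.smul_apply, Matrix.vecMulVec_apply, smul_eq_mul]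
  have : conjDir G H k ⬝ᵥ (G *ᵥ Pi.single k 1) = ∑ l, conjDir G H k l * G l k := by
    simp [dotProduct]
  rw [this, div_eq_inv_mul]

/-- The invariants of the conjugate direction method. -/
structure IsConj (G H : Matrix (Fin d) (Fin d) ℝ) (k : ℕ) : Prop where
  symm : Hᵀ = H
  idem : H * G * H = H
  inv : ∀ j : Fin d, (j : ℕ) < k →
    G *ᵥ (H *ᵥ (G *ᵥ Pi.single j 1)) = G *ᵥ Pi.single j 1

theorem dotProduct_mulVec_symm {G : Matrix (Fin d) (Fin d) ℝ} (hG : Gᵀ = G) (x y : Fin d → ℝ) :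
    x ⬝ᵥ (G *ᵥ y) = (G *ᵥ x) ⬝ᵥ y := by
  rw [Matrix.dotProduct_mulVec, ← Matrix.mulVec_transpose, hG]

/-- The matrix `H G` is the G-orthogonal projection onto the directions found so far, and `p` is
what it leaves of the `k`-th unit vector. Being G-orthogonal to the old directions, `p` can be added
by a rank-one term without disturbing the invariants. -/
theorem IsConj.step {G H : Matrix (Fin d) (Fin d) ℝ} (hG : Gᵀ = G)
    (hpos : ∀ x, x ⬝ᵥ (G *ᵥ x) = 0 → G *ᵥ x = 0) (k : Fin d) (h : IsConj G H k) :
    IsConj G (ginvStep G H k) (k + 1) := by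
  set p := conjDir G H k with hp
  set g := G *ᵥ Pi.single k (1 : ℝ) with hg
  have hpe : p = Pi.single k 1 - H *ᵥ g := conjDir_eq G H k
  have idem : ∀ x, H *ᵥ (G *ᵥ (H *ᵥ x)) = H *ᵥ x := fun x => by
    rw [Matrix.mulVec_mulVec, Matrix.mulVec_mulVec, h.idem]
  have ha : H *ᵥ (G *ᵥ p) = 0 := by
    rw [hpe, Matrix.mulVec_sub, Matrix.mulVec_sub, idem, sub_self]
  -- The divisor used by the algorithm is the squared G-norm of `p`, since the part `H *ᵥ g` is
  -- G-orthogonal to `p`.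
  have hq : p ⬝ᵥ (G *ᵥ p) = p ⬝ᵥ g := by
    conv_lhs => rw [hpe, Matrix.mulVec_sub, dotProduct_sub]
    rw [← hpe, dotProduct_mulVec_symm hG p (H *ᵥ g), dotProduct_mulVec_symm h.symm, ha,
      zero_dotProduct, sub_zero]
  have hstep : ginvStep G H k = H + (p ⬝ᵥ g)⁻¹ • Matrix.vecMulVec p p := ginvStep_eq G H k
  have happ : ∀ x, ginvStep G H k *ᵥ x = H *ᵥ x + ((p ⬝ᵥ g)⁻¹ * (p ⬝ᵥ x)) • p := fun x => by
    rw [hstep, Matrix.add_mulVec, Matrix.smul_mulVec, Matrix.vecMulVec_mulVec]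
    simp [smul_smul]
  have hpH : ∀ x, p ⬝ᵥ (G *ᵥ (H *ᵥ x)) = 0 := fun x => by
    rw [dotProduct_mulVec_symm hG, dotProduct_mulVec_symm h.symm, ha, zero_dotProduct]
  refine ⟨?_, ?_, ?_⟩
  · rw [hstep, Matrix.transpose_add, Matrix.transpose_smul, h.symm, Matrix.transpose_vecMulVec]
  · refine Matrix.ext_iff_mulVec.2 fun x => ?_
    rw [← Matrix.mulVec_mulVec, ← Matrix.mulVec_mulVec, happ (_), happ x]
    simp only [Matrix.mulVec_add, Matrix.mulVec_smul, dotProduct_add, dotProduct_smul, idem, ha, hpH,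
      hq, smul_zero, add_zero, zero_add, smul_eq_mul]
    congr 2
    by_cases h0 : p ⬝ᵥ g = 0
    · simp [h0]
    · field_simp
  · intro j hj
    rw [happ, Matrix.mulVec_add, Matrix.mulVec_smul]
    rcases Nat.lt_succ_iff_lt_or_eq.1 hj with hj | hj
    · rw [h.inv j hj, ← h.inv j hj, hpH]
      simp
    · have : j = k := Fin.ext hj
      subst this
      have hGp : G *ᵥ p = g - G *ᵥ (H *ᵥ g) := by rw [hpe, Matrix.mulVec_sub]
      -- A vanishing divisor means G p = 0 by semidefiniteness: the unit vector is already covered,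
      -- and the rank-one term is 0 because x / 0 = 0. Hence no pivoting is needed.
      by_cases h0 : p ⬝ᵥ g = 0
      · have := hpos p (hq.trans h0)
        rw [this] at hGp
        rw [this, smul_zero, add_zero]
        exact (sub_eq_zero.1 hGp.symm).symm
      · rw [inv_mul_cancel₀ h0, one_smul, hGp]
        abel

theorem isConj_ginvAux {G : Matrix (Fin d) (Fin d) ℝ} (hG : Gᵀ = G)
    (hpos : ∀ x, x ⬝ᵥ (G *ᵥ x) = 0 → G *ᵥ x = 0) {k : ℕ} (hk : k ≤ d) :
    IsConj G (ginvAux G k) k := by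
  induction k with
  | zero => exact ⟨by simp [ginvAux], by simp [ginvAux], fun j hj => absurd hj (by simp)⟩
  | succ k ih =>
    rw [ginvAux, dif_pos (Nat.lt_of_succ_le hk)]
    exact IsConj.step hG hpos ⟨k, Nat.lt_of_succ_le hk⟩ (ih (Nat.le_of_succ_le hk))

theorem dotProduct_gram (Φ : Matrix (Fin m) (Fin d) ℝ) (x y : Fin d → ℝ) :
    x ⬝ᵥ ((Φᵀ * Φ) *ᵥ y) = (Φ *ᵥ x) ⬝ᵥ (Φ *ᵥ y) := by
  rw [← Matrix.mulVec_mulVec, Matrix.dotProduct_mulVec, Matrix.vecMul_transpose]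

theorem mulVec_eq_zero_of_gram {Φ : Matrix (Fin m) (Fin d) ℝ} {x : Fin d → ℝ}
    (h : (Φᵀ * Φ) *ᵥ x = 0) : Φ *ᵥ x = 0 := by
  have := dotProduct_gram Φ x x
  rw [h, dotProduct_zero] at this
  exact dotProduct_self_eq_zero.1 this.symm

/-- `ginv Φ` solves the normal equations. -/
theorem gram_ginv (Φ : Matrix (Fin m) (Fin d) ℝ) (z : Fin m → ℝ) :
    Φᵀ *ᵥ (Φ *ᵥ (ginv Φ *ᵥ (Φᵀ *ᵥ z))) = Φᵀ *ᵥ z := by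
  set G := Φᵀ * Φ with hGd
  have hG : Gᵀ = G := by rw [hGd, Matrix.transpose_mul, Matrix.transpose_transpose]
  have hpos : ∀ x, x ⬝ᵥ (G *ᵥ x) = 0 → G *ᵥ x = 0 := fun x hx => by
    rw [hGd, dotProduct_gram] at hx
    rw [hGd, ← Matrix.mulVec_mulVec, dotProduct_self_eq_zero.1 hx, Matrix.mulVec_zero]
  have hc := isConj_ginvAux hG hpos le_rfl
  set H := ginvAux G d with hH
  have h1 : G * H * G = G := by
    refine Matrix.ext_of_mulVec_single fun j => ?_
    rw [← Matrix.mulVec_mulVec, ← Matrix.mulVec_mulVec]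
    exact hc.inv j j.2
  -- A factor Φᵀ is cancelled from G H G = G: the Gram matrix of Φ H G - Φ vanishes.
  have h2 : Φ * H * G = Φ := by
    have : (Φ * H * G - Φ)ᵀ * (Φ * H * G - Φ) = 0 := by
      have e1 : (Φ * H * G - Φ)ᵀ = G * H * Φᵀ - Φᵀ := by
        simp only [Matrix.transpose_sub, Matrix.transpose_mul, hG, hc.symm, Matrix.mul_assoc]
      rw [e1, Matrix.mul_sub, Matrix.sub_mul, Matrix.sub_mul]
      have e2 : G * H * Φᵀ * (Φ * H * G) = G := by
        rw [show G * H * Φᵀ * (Φ * H * G) = G * H * (Φᵀ * Φ) * H * G by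
          simp only [Matrix.mul_assoc], ← hGd, h1, h1]
      have e3 : Φᵀ * (Φ * H * G) = G := by
        rw [show Φᵀ * (Φ * H * G) = (Φᵀ * Φ) * H * G by simp only [Matrix.mul_assoc], ← hGd, h1]
      have e4 : G * H * Φᵀ * Φ = G := by rw [Matrix.mul_assoc, ← hGd, h1]
      simp only [e2, e3, e4, ← hGd, sub_self]
    rw [← Matrix.conjTranspose_eq_transpose_of_trivial, Matrix.conjTranspose_mul_self_eq_zero] at this
    exact sub_eq_zero.1 this
  have h3 : G * H * Φᵀ = Φᵀ := by
    have := congrArg Matrix.transpose h2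
    simpa only [Matrix.transpose_mul, hG, hc.symm, Matrix.mul_assoc] using this
  have h4 : ginv Φ = H := rfl
  rw [h4, Matrix.mulVec_mulVec, Matrix.mulVec_mulVec, Matrix.mulVec_mulVec, ← hGd, h3]

end GeneralizedInverse

/-! ## The algorithm with an explicit solution of the normal equations -/

section Algorithm

variable {S A d m : ℕ}

/-- The primal proximal update, with the solution of the normal equations given by the matrix
`ginv`. -/
def linTheta (φ : Fin S → Fin d → ℝ) (core : Fin m ↪ Fin S) (B η : ℝ)
    (θ ξ : Fin d → ℝ) : Fin d → ℝ :=
  let θt := θ - (η * B ^ 2) • (ginv (corePhi φ core) *ᵥ ξ)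
  (max 1 (coreNorm φ core θt / B))⁻¹ • θt

/-- One proximal update, with the primal part given by `linTheta`. -/
def linStep [NeZero A] (γ : ℝ) (φ : Fin S → Fin d → ℝ) (core : Fin m ↪ Fin S) (B η : ℝ)
    (s0 : Fin S) (ω : Tape S A) (h : ℕ) (z y : (Fin d → ℝ) × (Fin (m + 1) → Fin A → ℝ)) :
    (Fin d → ℝ) × (Fin (m + 1) → Fin A → ℝ) :=
  (linTheta φ core B η z.1 (estTheta γ φ core s0 ω h y.2),
    proxLam γ η z.2 (estLam γ φ core s0 ω h y.1))

/-- The iterates, with the primal updates given by `linTheta`. -/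
def linIter [NeZero A] (γ : ℝ) (φ : Fin S → Fin d → ℝ) (core : Fin m ↪ Fin S) (B η : ℝ)
    (s0 : Fin S) (ω : Tape S A) : ℕ → (Fin d → ℝ) × (Fin (m + 1) → Fin A → ℝ)
  | 0 => start A d m γ
  | τ + 1 =>
    let z := linIter γ φ core B η s0 ω τ
    let y := linStep γ φ core B η s0 ω (2 * τ) z z
    linStep γ φ core B η s0 ω (2 * τ + 1) z y

theorem corePhi_transpose_mulVec (φ : Fin S → Fin d → ℝ) (core : Fin m ↪ Fin S) (z : Fin m → ℝ) :
    (corePhi φ core)ᵀ *ᵥ z = ∑ i, z i • φ (core i) := by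
  ext k
  simp [Matrix.mulVec, dotProduct, corePhi, mul_comm]

theorem corePhi_mulVec (φ : Fin S → Fin d → ℝ) (core : Fin m ↪ Fin S) (x : Fin d → ℝ) (i : Fin m) :
    (corePhi φ core *ᵥ x) i = φ (core i) ⬝ᵥ x := rfl

variable {φ : Fin S → Fin d → ℝ} {core : Fin m ↪ Fin S} {Z : Matrix (Fin S) (Fin m) ℝ}

theorem feature_eq (hZ : ∀ s, φ s = ∑ i, Z s i • φ (core i)) (s : Fin S) :
    φ s = (corePhi φ core)ᵀ *ᵥ Z s := by
  rw [corePhi_transpose_mulVec]; exact hZ s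

theorem feature_dotProduct (hZ : ∀ s, φ s = ∑ i, Z s i • φ (core i)) (s : Fin S) (x : Fin d → ℝ) :
    φ s ⬝ᵥ x = Z s ⬝ᵥ (corePhi φ core *ᵥ x) := by
  rw [feature_eq hZ s, Matrix.mulVec_transpose, Matrix.dotProduct_mulVec]

/-- The gradient estimates lie in the row space of `Φ_*`. -/
theorem exists_estTheta_eq (hZ : ∀ s, φ s = ∑ i, Z s i • φ (core i)) [NeZero A] (γ : ℝ) (s0 : Fin S)
    (ω : Tape S A) (h : ℕ) (lam : Fin (m + 1) → Fin A → ℝ) :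
    ∃ z, estTheta γ φ core s0 ω h lam = (corePhi φ core)ᵀ *ᵥ z := by
  unfold estTheta
  extract_lets p s t
  refine ⟨Z s0 + (∑ i, ∑ a, |lam i a|) • (γ • Z t - Z s), ?_⟩
  rw [Matrix.mulVec_add, Matrix.mulVec_smul, Matrix.mulVec_sub, Matrix.mulVec_smul, ← feature_eq hZ,
    ← feature_eq hZ, ← feature_eq hZ]

/-- Solutions of the normal equations differ by an element of the kernel of Φ_*, and every feature
vector lies in the row space of Φ_*. The choice made by `Classical.epsilon` is therefore invisible
to the features. -/
theorem feature_riesz (hZ : ∀ s, φ s = ∑ i, Z s i • φ (core i)) {ξ : Fin d → ℝ}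
    (hξ : ∃ z, ξ = (corePhi φ core)ᵀ *ᵥ z) (s : Fin S) :
    φ s ⬝ᵥ riesz φ core ξ = φ s ⬝ᵥ (ginv (corePhi φ core) *ᵥ ξ) := by
  obtain ⟨z, rfl⟩ := hξ
  have h1 := gram_ginv (corePhi φ core) z
  have h2 : (corePhi φ core)ᵀ *ᵥ (corePhi φ core *ᵥ riesz φ core ((corePhi φ core)ᵀ *ᵥ z)) =
      (corePhi φ core)ᵀ *ᵥ z :=
    Classical.epsilon_spec (p := fun δ => (corePhi φ core)ᵀ *ᵥ (corePhi φ core *ᵥ δ) =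
      (corePhi φ core)ᵀ *ᵥ z) ⟨_, h1⟩
  have h3 := mulVec_eq_zero_of_gram (Φ := corePhi φ core) (x := riesz φ core ((corePhi φ core)ᵀ *ᵥ z) -
    ginv (corePhi φ core) *ᵥ ((corePhi φ core)ᵀ *ᵥ z)) (by
      rw [← Matrix.mulVec_mulVec, Matrix.mulVec_sub, Matrix.mulVec_sub, h1, h2, sub_self])
  rw [Matrix.mulVec_sub, sub_eq_zero] at h3
  rw [feature_dotProduct hZ, feature_dotProduct hZ, h3]

/-- Two points with the same dual part and primal parts that give the same features. -/
def SameFeatures (φ : Fin S → Fin d → ℝ) (z z' : (Fin d → ℝ) × (Fin (m + 1) → Fin A → ℝ)) : Prop :=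
  (∀ s, φ s ⬝ᵥ z.1 = φ s ⬝ᵥ z'.1) ∧ z.2 = z'.2

/-- The primal variable acts on the norm ‖Φ_* θ‖ and on the dual gradient only through the numbers φ
s · θ, and the primal gradient depends on λ alone. So the agreement is inherited, although the
vectors θ themselves may differ. -/
theorem SameFeatures.step (hZ : ∀ s, φ s = ∑ i, Z s i • φ (core i)) [NeZero A] (γ B η : ℝ)
    (s0 : Fin S) (ω : Tape S A) (h : ℕ) {z z' y y' : (Fin d → ℝ) × (Fin (m + 1) → Fin A → ℝ)}
    (hz : SameFeatures φ z z') (hy : SameFeatures φ y y') :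
    SameFeatures φ (proxStep γ φ core B η s0 ω h z y) (linStep γ φ core B η s0 ω h z' y') := by
  refine ⟨fun s => ?_, ?_⟩
  · obtain ⟨hz1, hz2⟩ := hz
    obtain ⟨hy1, hy2⟩ := hy
    simp only [proxStep, linStep, proxTheta, linTheta, hy2]
    have hξ := exists_estTheta_eq hZ γ s0 ω h y'.2
    set ξ := estTheta γ φ core s0 ω h y'.2
    have h1 : ∀ s, φ s ⬝ᵥ (z.1 - (η * B ^ 2) • riesz φ core ξ) =
        φ s ⬝ᵥ (z'.1 - (η * B ^ 2) • (ginv (corePhi φ core) *ᵥ ξ)) := fun s => by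
      rw [dotProduct_sub, dotProduct_sub, dotProduct_smul, dotProduct_smul, hz1, feature_riesz hZ hξ]
    have h2 : coreNorm φ core (z.1 - (η * B ^ 2) • riesz φ core ξ) =
        coreNorm φ core (z'.1 - (η * B ^ 2) • (ginv (corePhi φ core) *ᵥ ξ)) := by
      simp only [coreNorm, corePhi_mulVec, h1]
    rw [h2, dotProduct_smul, dotProduct_smul, h1]
  · simp only [proxStep, linStep]
    rw [hz.2]
    congr 1
    funext i a
    simp only [estLam, sub_dotProduct, smul_dotProduct, hy.1]

theorem sameFeatures_iterate (hZ : ∀ s, φ s = ∑ i, Z s i • φ (core i)) [NeZero A] (γ B η : ℝ)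
    (s0 : Fin S) (ω : Tape S A) (τ : ℕ) :
    SameFeatures φ (iterate γ φ core B η s0 ω τ) (linIter γ φ core B η s0 ω τ) := by
  induction τ with
  | zero => exact ⟨fun _ => rfl, rfl⟩
  | succ τ ih => exact SameFeatures.step hZ γ B η s0 ω _ ih (SameFeatures.step hZ γ B η s0 ω _ ih ih)

/-- The average of the dual iterates. -/
theorem result_eq (hZ : ∀ s, φ s = ∑ i, Z s i • φ (core i)) [NeZero A] (γ B η : ℝ) (T : ℕ)
    (s0 : Fin S) (ω : Tape S A) :
    result γ φ core T B η s0 ω = if T = 0 then (start A d m γ).2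
      else (1 / T : ℝ) • ∑ τ ∈ Finset.range T, (linIter γ φ core B η s0 ω (τ + 1)).2 := by
  unfold result
  simp only [(sameFeatures_iterate hZ γ B η s0 ω _).2]

end Algorithm

/-! ## Proximal steps -/

/-! ### Multiplicative updates of weights with fixed total mass. -/

section Softmax

variable {ι : Type*} [Fintype ι] {M : ℝ} {lam x : ι → ℝ}

/-- The multiplicative update of the weights `lam` with exponents `x`, normalized to the mass `M`. -/
def softmax (M : ℝ) (lam x : ι → ℝ) (i : ι) : ℝ :=
  M * (lam i * Real.exp (x i)) / ∑ j, lam j * Real.exp (x j)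

/-- Weights of total mass `M`, positive unless `M = 0`. -/
structure IsWeight (M : ℝ) (lam : ι → ℝ) : Prop where
  mass_nonneg : 0 ≤ M
  nonneg : ∀ i, 0 ≤ lam i
  sum : ∑ i, lam i = M
  pos : M ≠ 0 → ∀ i, 0 < lam i

theorem IsWeight.sum_exp_pos (h : IsWeight M lam) (hM : M ≠ 0) (x : ι → ℝ) :
    0 < ∑ j, lam j * Real.exp (x j) := by
  have : Nonempty ι := by
    by_contra hn
    rw [not_nonempty_iff] at hn
    exact hM (by rw [← h.sum]; simp)
  exact Finset.sum_pos (fun i _ => mul_pos (h.pos hM i) (Real.exp_pos _)) Finset.univ_nonempty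

theorem IsWeight.softmax (h : IsWeight M lam) (x : ι → ℝ) : IsWeight M (softmax M lam x) := by
  refine ⟨h.mass_nonneg, fun i => ?_, ?_, fun hM i => ?_⟩
  · exact div_nonneg (mul_nonneg h.mass_nonneg (mul_nonneg (h.nonneg i) (Real.exp_pos _).le))
      (Finset.sum_nonneg fun j _ => mul_nonneg (h.nonneg j) (Real.exp_pos _).le)
  · by_cases hM : M = 0
    · simp [CorePlanning.softmax, hM]
    · simp only [CorePlanning.softmax, ← Finset.sum_div, ← Finset.mul_sum]
      exact mul_div_cancel_right₀ _ (h.sum_exp_pos hM x).ne'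
  · exact div_pos (mul_pos (h.mass_nonneg.lt_of_ne' hM) (mul_pos (h.pos hM i) (Real.exp_pos _)))
      (h.sum_exp_pos hM x)

theorem IsWeight.eq_zero (h : IsWeight (0 : ℝ) lam) (i : ι) : lam i = 0 :=
  (Finset.sum_eq_zero_iff_of_nonneg fun i _ => h.nonneg i).1 h.sum i (Finset.mem_univ i)

theorem IsWeight.le (h : IsWeight M lam) (i : ι) : lam i ≤ M := by
  rw [← h.sum]
  exact Finset.single_le_sum (fun j _ => h.nonneg j) (Finset.mem_univ i)

/-- The regret of a multiplicative step against the vertex `i` of the simplex. -/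
theorem IsWeight.softmax_regret (h : IsWeight M lam) (x : ι → ℝ) (i : ι) :
    M * x i - ∑ j, x j * CorePlanning.softmax M lam x j ≤
      M * (Real.log (CorePlanning.softmax M lam x i) - Real.log (lam i)) := by
  by_cases hM : M = 0
  · subst hM
    simp [CorePlanning.softmax]
  have hMp : 0 < M := h.mass_nonneg.lt_of_ne' hM
  set W := ∑ j, lam j * Real.exp (x j) with hW
  have hWp : 0 < W := h.sum_exp_pos hM x
  have hs := h.softmax x
  set l' := CorePlanning.softmax M lam x with hl'
  have hlog : ∀ j, Real.log (l' j) = Real.log M + Real.log (lam j) + x j - Real.log W := fun j => by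
    rw [hl', CorePlanning.softmax, Real.log_div (mul_ne_zero hM (mul_ne_zero (h.pos hM j).ne'
      (Real.exp_ne_zero _))) hWp.ne', Real.log_mul hM (mul_ne_zero (h.pos hM j).ne'
      (Real.exp_ne_zero _)), Real.log_mul (h.pos hM j).ne' (Real.exp_ne_zero _), Real.log_exp]
    ring
  -- From log t ≤ t - 1. Summed over `j`, the right side vanishes because both weights have mass
  -- `M`: the relative entropy of the new weights to the old ones is nonnegative.
  have hkl : ∀ j, l' j * (Real.log (lam j) - Real.log (l' j)) ≤ lam j - l' j := fun j => by
    rw [← Real.log_div (h.pos hM j).ne' (hs.pos hM j).ne']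
    have h1 := Real.log_le_sub_one_of_pos (div_pos (h.pos hM j) (hs.pos hM j))
    calc l' j * Real.log (lam j / l' j) ≤ l' j * (lam j / l' j - 1) :=
          mul_le_mul_of_nonneg_left h1 (hs.nonneg j)
      _ = _ := by
          have := (hs.pos hM j).ne'
          field_simp
  have hsum := Finset.sum_le_sum fun j (_ : j ∈ Finset.univ) => hkl j
  rw [Finset.sum_sub_distrib, h.sum, hs.sum, sub_self] at hsum
  have h2 : ∀ j, l' j * (Real.log (lam j) - Real.log (l' j)) =
      (Real.log W - Real.log M) * l' j - x j * l' j := fun j => by rw [hlog]; ring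
  simp only [h2, Finset.sum_sub_distrib, ← Finset.mul_sum, hs.sum] at hsum
  rw [hlog i]
  linarith

theorem exp_sub_one_le {t : ℝ} (h0 : 0 ≤ t) (h1 : t ≤ 1) : Real.exp t - 1 ≤ 2 * t := by
  have := Real.abs_exp_sub_one_le (x := t) (by rwa [abs_of_nonneg h0])
  rw [abs_of_nonneg h0] at this
  exact (le_abs_self _).trans this

/-- A multiplicative step moves the weights by an amount proportional to the step. -/
theorem IsWeight.softmax_dist (h : IsWeight M lam) {x : ι → ℝ} {R : ℝ} (hx : ∀ i, |x i| ≤ R)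
    (hR : 0 ≤ R) : ∑ i, |CorePlanning.softmax M lam x i - lam i| ≤ 4 * R * M := by
  by_cases hM : M = 0
  · subst hM
    simp [CorePlanning.softmax, h.eq_zero]
  have hMp : 0 < M := h.mass_nonneg.lt_of_ne' hM
  have hs := h.softmax x
  -- For 2R ≤ 1 every weight changes by a factor between exp(-2R) and exp(2R), and exp t - 1 ≤ 2t on
  -- [0, 1]. Otherwise 4R > 2 and the trivial distance 2M is enough.
  rcases le_or_gt (2 * R) 1 with h2 | h2
  · set W := ∑ j, lam j * Real.exp (x j) with hW
    have hWp : 0 < W := h.sum_exp_pos hM x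
    have hWu : W ≤ M * Real.exp R := by
      rw [hW, ← h.sum, Finset.sum_mul]
      exact Finset.sum_le_sum fun j _ => mul_le_mul_of_nonneg_left
        (Real.exp_le_exp.2 ((le_abs_self _).trans (hx j))) (h.nonneg j)
    have hWl : M * Real.exp (-R) ≤ W := by
      rw [hW, ← h.sum, Finset.sum_mul]
      exact Finset.sum_le_sum fun j _ => mul_le_mul_of_nonneg_left
        (Real.exp_le_exp.2 (abs_le.1 (hx j)).1) (h.nonneg j)
    have hb : ∀ i, |CorePlanning.softmax M lam x i - lam i| ≤ lam i * (4 * R) := fun i => by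
      have e1 : CorePlanning.softmax M lam x i - lam i = lam i * (M * Real.exp (x i) / W - 1) := by
        rw [CorePlanning.softmax, ← hW]; ring
      rw [e1, abs_mul, abs_of_nonneg (h.nonneg i)]
      refine mul_le_mul_of_nonneg_left ?_ (h.nonneg i)
      have u1 : M * Real.exp (x i) / W ≤ Real.exp (2 * R) := by
        rw [div_le_iff₀ hWp]
        calc M * Real.exp (x i) ≤ M * Real.exp R := mul_le_mul_of_nonneg_left
              (Real.exp_le_exp.2 ((le_abs_self _).trans (hx i))) hMp.le
          _ = Real.exp (2 * R) * (M * Real.exp (-R)) := by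
              rw [mul_left_comm, ← Real.exp_add]; ring_nf
          _ ≤ _ := mul_le_mul_of_nonneg_left hWl (Real.exp_pos _).le
      have u2 : Real.exp (-(2 * R)) ≤ M * Real.exp (x i) / W := by
        rw [le_div_iff₀ hWp]
        calc Real.exp (-(2 * R)) * W ≤ Real.exp (-(2 * R)) * (M * Real.exp R) :=
              mul_le_mul_of_nonneg_left hWu (Real.exp_pos _).le
          _ = M * Real.exp (-R) := by rw [mul_left_comm, ← Real.exp_add]; ring_nf
          _ ≤ _ := mul_le_mul_of_nonneg_left (Real.exp_le_exp.2 (abs_le.1 (hx i)).1) hMp.le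
      have u3 := exp_sub_one_le (t := 2 * R) (by linarith) h2
      have u4 := Real.add_one_le_exp (-(2 * R))
      rw [abs_le]
      constructor <;> linarith
    calc ∑ i, |CorePlanning.softmax M lam x i - lam i| ≤ ∑ i, lam i * (4 * R) :=
          Finset.sum_le_sum fun i _ => hb i
      _ = 4 * R * M := by rw [← Finset.sum_mul, h.sum]; ring
  · calc ∑ i, |CorePlanning.softmax M lam x i - lam i|
        ≤ ∑ i, (CorePlanning.softmax M lam x i + lam i) := Finset.sum_le_sum fun i _ => by
          have a1 := hs.nonneg i
          have a2 := h.nonneg i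
          rw [abs_le]; constructor <;> linarith
      _ = 2 * M := by rw [Finset.sum_add_distrib, hs.sum, h.sum]; ring
      _ ≤ _ := by nlinarith

end Softmax

/-! ### Projection to a ball -/

section Projection

variable {E : Type*} [NormedAddCommGroup E] [InnerProductSpace ℝ E]

theorem norm_ballProj_le {B : ℝ} (hB : 0 < B) (x : E) : ‖(max 1 (‖x‖ / B))⁻¹ • x‖ ≤ B := by
  have h1 : 0 < max 1 (‖x‖ / B) := lt_max_of_lt_left one_pos
  rw [norm_smul, norm_inv, Real.norm_eq_abs, abs_of_pos h1, inv_mul_le_iff₀ h1]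
  have := le_max_right 1 (‖x‖ / B)
  rwa [div_le_iff₀ hB] at this

/-- If x lies outside the ball, write x = t x' with ‖x'‖ = B and t > 1. Then ‖tx' - y‖² - ‖x' - y‖²
= (t-1)²B² + 2(t-1)(B² - ⟪x', y⟫), and ⟪x', y⟫ ≤ B² by Cauchy–Schwarz. -/
theorem norm_ballProj_sub_le {B : ℝ} (hB : 0 < B) (x : E) {y : E} (hy : ‖y‖ ≤ B) :
    ‖(max 1 (‖x‖ / B))⁻¹ • x - y‖ ≤ ‖x - y‖ := by
  set t := max 1 (‖x‖ / B) with ht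
  have h1 : 1 ≤ t := le_max_left _ _
  have h0 : 0 < t := by linarith
  set x' := t⁻¹ • x with hx'
  have hx : x = t • x' := by rw [hx', smul_smul, mul_inv_cancel₀ h0.ne', one_smul]
  have hxB : ‖x'‖ ≤ B := norm_ballProj_le hB x
  rcases eq_or_lt_of_le h1 with h | h
  · rw [hx, ← h, one_smul]
  have hxe : ‖x'‖ = B := by
    have : t = ‖x‖ / B := by
      rcases max_choice 1 (‖x‖ / B) with h' | h' <;> rw [← ht] at h'
      · rw [h'] at h; exact absurd h (lt_irrefl _)
      · exact h'
    rw [hx', norm_smul, norm_inv, Real.norm_eq_abs, abs_of_pos h0, inv_mul_eq_iff_eq_mul₀ h0.ne', this]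
    field_simp
  have hin : inner ℝ x' y ≤ B * B := (real_inner_le_norm x' y).trans (by
    rw [hxe]; exact mul_le_mul_of_nonneg_left hy hB.le)
  have key : ‖x' - y‖ ≤ ‖t • x' - y‖ := by
    clear_value x'
    rw [← sq_le_sq₀ (norm_nonneg _) (norm_nonneg _), norm_sub_sq_real, norm_sub_sq_real, norm_smul,
      real_inner_smul_left, Real.norm_eq_abs, abs_of_pos h0, hxe]
    nlinarith [mul_nonneg (sub_nonneg.2 h1) (sub_nonneg.2 hin),
      mul_nonneg (mul_self_nonneg (t - 1)) (mul_self_nonneg B)]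
  rwa [← hx] at key

end Projection


/-! ### The primal update -/

section Primal

variable {S A d m : ℕ}

/-- The values of the linear function `θ` at the core states, in Euclidean space. -/
def coreVec (φ : Fin S → Fin d → ℝ) (core : Fin m ↪ Fin S) (θ : Fin d → ℝ) :
    EuclideanSpace ℝ (Fin m) := WithLp.toLp 2 (corePhi φ core *ᵥ θ)

variable (φ : Fin S → Fin d → ℝ) (core : Fin m ↪ Fin S)

theorem coreNorm_eq (θ : Fin d → ℝ) : coreNorm φ core θ = ‖coreVec φ core θ‖ := by
  simp [coreNorm, coreVec, EuclideanSpace.norm_eq]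

theorem coreVec_sub (x y : Fin d → ℝ) :
    coreVec φ core (x - y) = coreVec φ core x - coreVec φ core y := by
  simp [coreVec, Matrix.mulVec_sub]

theorem coreVec_smul (c : ℝ) (x : Fin d → ℝ) : coreVec φ core (c • x) = c • coreVec φ core x := by
  simp [coreVec, Matrix.mulVec_smul]

theorem coreVec_linTheta (B η : ℝ) (θ ξ : Fin d → ℝ) :
    coreVec φ core (linTheta φ core B η θ ξ) =
      (max 1 (‖coreVec φ core θ - (η * B ^ 2) • coreVec φ core (ginv (corePhi φ core) *ᵥ ξ)‖ / B))⁻¹ •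
        (coreVec φ core θ - (η * B ^ 2) • coreVec φ core (ginv (corePhi φ core) *ᵥ ξ)) := by
  simp only [linTheta, coreVec_smul, coreVec_sub, coreNorm_eq]

theorem norm_coreVec_linTheta_le {B : ℝ} (hB : 0 < B) (η : ℝ) (θ ξ : Fin d → ℝ) :
    ‖coreVec φ core (linTheta φ core B η θ ξ)‖ ≤ B := by
  rw [coreVec_linTheta]
  exact norm_ballProj_le hB _

variable {φ core} {Z : Matrix (Fin S) (Fin m) ℝ}

/-- The vector `ginv ξ` is a Riesz representative of ξ. Working with images under Φ_* gives genuine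
Euclidean geometry even when Φ_* has a kernel. -/
theorem inner_coreVec_ginv {ξ : Fin d → ℝ} (hξ : ∃ z, ξ = (corePhi φ core)ᵀ *ᵥ z) (x : Fin d → ℝ) :
    inner ℝ (coreVec φ core (ginv (corePhi φ core) *ᵥ ξ)) (coreVec φ core x) = ξ ⬝ᵥ x := by
  obtain ⟨z, rfl⟩ := hξ
  have h1 : inner ℝ (coreVec φ core (ginv (corePhi φ core) *ᵥ ((corePhi φ core)ᵀ *ᵥ z)))
      (coreVec φ core x) = (corePhi φ core *ᵥ (ginv (corePhi φ core) *ᵥ ((corePhi φ core)ᵀ *ᵥ z))) ⬝ᵥ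
        (corePhi φ core *ᵥ x) := by
    rw [coreVec, coreVec, EuclideanSpace.inner_toLp_toLp, star_trivial, dotProduct_comm]
  rw [h1, Matrix.dotProduct_mulVec, ← Matrix.mulVec_transpose, gram_ginv]

/-- The dual-norm bound is tested on the representative itself. -/
theorem norm_coreVec_ginv_le {ξ : Fin d → ℝ} (hξ : ∃ z, ξ = (corePhi φ core)ᵀ *ᵥ z) {L : ℝ}
    (hL0 : 0 ≤ L) (hL : ∀ x, |ξ ⬝ᵥ x| ≤ L * ‖coreVec φ core x‖) :
    ‖coreVec φ core (ginv (corePhi φ core) *ᵥ ξ)‖ ≤ L := by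
  set w := coreVec φ core (ginv (corePhi φ core) *ᵥ ξ) with hw
  have h1 : ‖w‖ ^ 2 ≤ L * ‖w‖ := by
    rw [← real_inner_self_eq_norm_sq]
    conv_lhs => rw [hw, inner_coreVec_ginv hξ]
    exact (le_abs_self _).trans (hL _)
  by_contra! hlt
  nlinarith [hL0.trans_lt hlt]

/-- The regret of a primal step. -/
theorem linTheta_regret {B η L : ℝ} (hB : 0 < B) {ξ : Fin d → ℝ}
    (hξ : ∃ z, ξ = (corePhi φ core)ᵀ *ᵥ z) (hL0 : 0 ≤ L)
    (hL : ∀ x, |ξ ⬝ᵥ x| ≤ L * ‖coreVec φ core x‖) (θ : Fin d → ℝ) {u : Fin d → ℝ}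
    (hu : ‖coreVec φ core u‖ ≤ B) :
    2 * (η * B ^ 2) * (ξ ⬝ᵥ (θ - u)) ≤ ‖coreVec φ core (θ - u)‖ ^ 2 -
      ‖coreVec φ core (linTheta φ core B η θ ξ - u)‖ ^ 2 + (η * B ^ 2) ^ 2 * L ^ 2 := by
  have h1 := norm_ballProj_sub_le hB
    (coreVec φ core θ - (η * B ^ 2) • coreVec φ core (ginv (corePhi φ core) *ᵥ ξ)) hu
  rw [← coreVec_linTheta, ← coreVec_sub] at h1
  have h2 := (sq_le_sq₀ (norm_nonneg _) (norm_nonneg _)).2 h1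
  -- Expanding the square of (θ - u) - ηB² · (representative of ξ) produces the linear term ξ · (θ -
  -- u).
  rw [sub_right_comm, ← coreVec_sub, norm_sub_sq_real, real_inner_smul_right, real_inner_comm,
    inner_coreVec_ginv hξ, norm_smul, mul_pow, Real.norm_eq_abs, sq_abs] at h2
  have h3 := norm_coreVec_ginv_le hξ hL0 hL
  have h4 : ‖coreVec φ core (ginv (corePhi φ core) *ᵥ ξ)‖ ^ 2 ≤ L ^ 2 :=
    pow_le_pow_left₀ (norm_nonneg _) h3 2
  have h5 := mul_le_mul_of_nonneg_left h4 (sq_nonneg (η * B ^ 2))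
  linarith

/-- The length of a primal step. -/
theorem linTheta_dist {B η L : ℝ} (hB : 0 < B) (hη : 0 ≤ η) {ξ : Fin d → ℝ}
    (hξ : ∃ z, ξ = (corePhi φ core)ᵀ *ᵥ z) (hL0 : 0 ≤ L)
    (hL : ∀ x, |ξ ⬝ᵥ x| ≤ L * ‖coreVec φ core x‖) {θ : Fin d → ℝ} (hθ : ‖coreVec φ core θ‖ ≤ B) :
    ‖coreVec φ core (linTheta φ core B η θ ξ - θ)‖ ≤ η * B ^ 2 * L := by
  have h1 := norm_ballProj_sub_le hB
    (coreVec φ core θ - (η * B ^ 2) • coreVec φ core (ginv (corePhi φ core) *ᵥ ξ)) hθ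
  rw [← coreVec_linTheta, ← coreVec_sub, sub_sub_cancel_left, norm_neg, norm_smul, Real.norm_eq_abs,
    abs_of_nonneg (mul_nonneg hη (sq_nonneg B))] at h1
  exact h1.trans (mul_le_mul_of_nonneg_left (norm_coreVec_ginv_le hξ hL0 hL)
    (mul_nonneg hη (sq_nonneg B)))

/-- The value at any state is a convex combination of the values at the core states, each of which
is bounded by the Euclidean norm. Through this bound the core states keep all gradients under
control. -/
theorem abs_feature_le (hZ : ∀ s, φ s = ∑ i, Z s i • φ (core i)) (hZ0 : ∀ s i, 0 ≤ Z s i)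
    (hZ1 : ∀ s, ∑ i, Z s i = 1) (s : Fin S) (x : Fin d → ℝ) :
    |φ s ⬝ᵥ x| ≤ ‖coreVec φ core x‖ := by
  rw [feature_dotProduct hZ]
  exact abs_sum_weight_le (hZ0 s) (hZ1 s) fun i => PiLp.norm_apply_le (coreVec φ core x) i

end Primal

/-! ### The dual update -/

section Dual

variable {A m : ℕ} {γ : ℝ}

/-- The dual domain: the block of the planning state has mass `1` and the block of the core states
has mass `γ / (1 - γ)`. -/
def InDom (γ : ℝ) (lam : Fin (m + 1) → Fin A → ℝ) : Prop :=
  IsWeight 1 (lam 0) ∧ IsWeight (γ / (1 - γ)) fun p : Fin m × Fin A => lam p.1.succ p.2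

theorem proxLam_zero (η : ℝ) (lam ρ : Fin (m + 1) → Fin A → ℝ) :
    proxLam γ η lam ρ 0 =
      softmax 1 (lam 0) fun a => 2 * ell A m γ / (1 - γ) * (η * ρ 0 a) := by
  funext a
  simp [proxLam, softmax]

theorem proxLam_succ (η : ℝ) (lam ρ : Fin (m + 1) → Fin A → ℝ) (j : Fin m) (a : Fin A) :
    proxLam γ η lam ρ j.succ a =
      softmax (γ / (1 - γ)) (fun p : Fin m × Fin A => lam p.1.succ p.2)
        (fun p => 2 * ell A m γ / (1 - γ) * (η * ρ p.1.succ p.2)) (j, a) := by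
  simp [proxLam, softmax, Fintype.sum_prod_type]

theorem InDom.proxLam {lam : Fin (m + 1) → Fin A → ℝ} (h : InDom γ lam) (η : ℝ)
    (ρ : Fin (m + 1) → Fin A → ℝ) : InDom γ (proxLam γ η lam ρ) := by
  refine ⟨?_, ?_⟩
  · rw [proxLam_zero]; exact h.1.softmax _
  · simp only [proxLam_succ]; exact h.2.softmax _

theorem inDom_start [NeZero A] (d : ℕ) (hm : 0 < m) (h0 : 0 ≤ γ) (h1 : γ < 1) :
    InDom γ (start A d m γ).2 := by
  have hA : (0 : ℝ) < A := Nat.cast_pos.2 (NeZero.pos A)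
  have hm' : (0 : ℝ) < m := Nat.cast_pos.2 hm
  have h1' : 0 < 1 - γ := sub_pos.2 h1
  refine ⟨⟨zero_le_one, fun a => ?_, ?_, fun _ a => ?_⟩, ⟨div_nonneg h0 h1'.le, fun p => ?_, ?_,
    fun hne p => ?_⟩⟩
  · simp [start]
  · simp [start, hA.ne']
  · simp [start, hA]
  · simp only [start, Fin.succ_ne_zero, if_false]; positivity
  · simp only [start, Fin.succ_ne_zero, if_false, Finset.sum_const, Finset.card_univ,
      Fintype.card_prod, Fintype.card_fin, nsmul_eq_mul, Nat.cast_mul]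
    field_simp
  · simp only [start, Fin.succ_ne_zero, if_false]
    have : 0 < γ := h0.lt_of_ne (by rintro rfl; simp at hne)
    positivity

theorem sum_rows (f : Fin (m + 1) → Fin A → ℝ) :
    ∑ i, ∑ a, f i a = ∑ a, f 0 a + ∑ p : Fin m × Fin A, f p.1.succ p.2 := by
  rw [Fin.sum_univ_succ, Fintype.sum_prod_type]

theorem InDom.nonneg {lam : Fin (m + 1) → Fin A → ℝ} (h : InDom γ lam) (i : Fin (m + 1)) (a : Fin A) :
    0 ≤ lam i a := by
  refine Fin.cases ?_ (fun j => ?_) i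
  · exact h.1.nonneg a
  · exact h.2.nonneg (j, a)

theorem InDom.sum {lam : Fin (m + 1) → Fin A → ℝ} (h : InDom γ lam) (h1 : γ < 1) :
    ∑ i, ∑ a, lam i a = 1 / (1 - γ) := by
  have : 1 - γ ≠ 0 := (sub_pos.2 h1).ne'
  rw [sum_rows, h.1.sum, h.2.sum]
  field_simp
  ring

theorem InDom.sum_abs {lam : Fin (m + 1) → Fin A → ℝ} (h : InDom γ lam) (h1 : γ < 1) :
    ∑ i, ∑ a, |lam i a| = 1 / (1 - γ) := by
  simp only [abs_of_nonneg (h.nonneg _ _), h.sum h1]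

/-- `IsWeight.softmax_dist` applies to both blocks, whose masses 1 and γ/(1-γ) add up to 1/(1-γ). -/
theorem proxLam_dist {lam : Fin (m + 1) → Fin A → ℝ} (h : InDom γ lam) (h1 : γ < 1) {η R : ℝ}
    {ρ : Fin (m + 1) → Fin A → ℝ} (hρ : ∀ i a, |ρ i a| ≤ R) (hR : 0 ≤ R)
    (hc : 0 ≤ 2 * ell A m γ / (1 - γ) * η) :
    ∑ i, ∑ a, |proxLam γ η lam ρ i a - lam i a| ≤
      4 * (2 * ell A m γ / (1 - γ) * η * R) * (1 / (1 - γ)) := by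
  have hb : ∀ i a, |2 * ell A m γ / (1 - γ) * (η * ρ i a)| ≤ 2 * ell A m γ / (1 - γ) * η * R :=
    fun i a => by
      rw [← mul_assoc, abs_mul, abs_of_nonneg hc]
      exact mul_le_mul_of_nonneg_left (hρ i a) hc
  rw [sum_rows, proxLam_zero]
  simp only [proxLam_succ]
  have e1 := h.1.softmax_dist (fun a => hb 0 a) (mul_nonneg hc hR)
  have e2 := h.2.softmax_dist (fun p => hb p.1.succ p.2) (mul_nonneg hc hR)
  have e3 : 1 / (1 - γ) = 1 + γ / (1 - γ) := by
    have : 1 - γ ≠ 0 := (sub_pos.2 h1).ne'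
    field_simp
    ring
  rw [e3, mul_add]
  exact add_le_add e1 e2

/-- The potential of the dual steps for the vertex given by the actions `a₀` and `(j, a)`. -/
def dualPot (γ : ℝ) (a0 : Fin A) (j : Fin m) (a : Fin A) (lam : Fin (m + 1) → Fin A → ℝ) : ℝ :=
  Real.log (lam 0 a0) + γ / (1 - γ) * Real.log (lam j.succ a)

/-- The regret of a dual step. -/
theorem proxLam_regret {lam : Fin (m + 1) → Fin A → ℝ} (h : InDom γ lam) (η : ℝ)
    (ρ : Fin (m + 1) → Fin A → ℝ) (a0 : Fin A) (j : Fin m) (a : Fin A) :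
    2 * ell A m γ / (1 - γ) * η * (ρ 0 a0 + γ / (1 - γ) * ρ j.succ a -
        ∑ i, ∑ b, ρ i b * proxLam γ η lam ρ i b) ≤
      dualPot γ a0 j a (proxLam γ η lam ρ) - dualPot γ a0 j a lam := by
  have e1 := h.1.softmax_regret (fun a => 2 * ell A m γ / (1 - γ) * (η * ρ 0 a)) a0
  have e2 := h.2.softmax_regret
    (fun p : Fin m × Fin A => 2 * ell A m γ / (1 - γ) * (η * ρ p.1.succ p.2)) (j, a)
  rw [← proxLam_zero] at e1
  rw [sum_rows, dualPot, dualPot]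
  simp only [proxLam_succ]
  simp only [mul_assoc] at e1 e2 ⊢
  simp only [← Finset.mul_sum] at e1 e2 ⊢
  linarith

/-- Each logarithm is at most that of the mass of its block, and the start is uniform on the blocks.
The ranges log A and γ/(1-γ) (log m + log A) add up to ℓ/(1-γ), which explains the form of ℓ. -/
theorem dualPot_le {lam : Fin (m + 1) → Fin A → ℝ} [NeZero A] (h : InDom γ lam) (h0 : 0 ≤ γ)
    (h1 : γ < 1) (d : ℕ) (a0 : Fin A) (j : Fin m) (a : Fin A) :
    dualPot γ a0 j a lam - dualPot γ a0 j a (start A d m γ).2 ≤ ell A m γ / (1 - γ) := by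
  have h1' : 0 < 1 - γ := sub_pos.2 h1
  have hA : (0 : ℝ) < A := Nat.cast_pos.2 (NeZero.pos A)
  have hm' : (0 : ℝ) < m := Nat.cast_pos.2 (Fin.pos j)
  have e1 : Real.log (lam 0 a0) ≤ 0 := Real.log_nonpos (h.1.nonneg a0) (h.1.le a0)
  have e2 : Real.log ((start A d m γ).2 0 a0) = - Real.log A := by simp [start]
  have e3 : γ / (1 - γ) * (Real.log (lam j.succ a) - Real.log ((start A d m γ).2 j.succ a)) ≤
      γ / (1 - γ) * (Real.log m + Real.log A) := by
    -- For γ = 0 the core block is zero and its logarithms are junk, but their coefficient vanishes.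
    rcases h0.eq_or_lt with rfl | hp
    · simp
    · refine mul_le_mul_of_nonneg_left ?_ (div_nonneg h0 h1'.le)
      have hg : 0 < γ / (1 - γ) := div_pos hp h1'
      have e4 : (start A d m γ).2 j.succ a = γ / (1 - γ) / (m * A) := by
        simp only [start, Fin.succ_ne_zero, if_false]
        field_simp
      rw [e4, Real.log_div hg.ne' (by positivity), Real.log_mul hm'.ne' hA.ne']
      have := Real.log_le_log (h.2.pos hg.ne' (j, a)) (h.2.le (j, a))
      simp only at this
      linarith
  have e5 : ell A m γ / (1 - γ) = Real.log A + γ / (1 - γ) * (Real.log m + Real.log A) := by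
    rw [ell]
    field_simp
    ring
  rw [e5, dualPot, dualPot, e2]
  linarith

end Dual


/-! ### One iteration -/

section Iteration

variable {S A d m : ℕ} {φ : Fin S → Fin d → ℝ} {core : Fin m ↪ Fin S}
  {Z : Matrix (Fin S) (Fin m) ℝ}

/-- The term of s₀ contributes 1 and the sampled difference of two features, scaled by ‖λ‖₁,
contributes 2/(1-γ); both fit into 3/(1-γ). -/
theorem abs_estTheta_le [NeZero A] (hZ : ∀ s, φ s = ∑ i, Z s i • φ (core i)) (hZ0 : ∀ s i, 0 ≤ Z s i)
    (hZ1 : ∀ s, ∑ i, Z s i = 1) {γ : ℝ} (h0 : 0 ≤ γ) (h1 : γ < 1) (s0 : Fin S) (ω : Tape S A) (h : ℕ)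
    {lam : Fin (m + 1) → Fin A → ℝ} (hl : InDom γ lam) (x : Fin d → ℝ) :
    |estTheta γ φ core s0 ω h lam ⬝ᵥ x| ≤ 3 / (1 - γ) * ‖coreVec φ core x‖ := by
  unfold estTheta
  extract_lets p s t
  have h1' : 0 < 1 - γ := sub_pos.2 h1
  rw [hl.sum_abs h1, add_dotProduct, smul_dotProduct, sub_dotProduct, smul_dotProduct]
  have a1 := abs_le.1 (abs_feature_le hZ hZ0 hZ1 s0 x)
  have a2 := abs_le.1 (abs_feature_le hZ hZ0 hZ1 s x)
  have a3 := abs_le.1 (abs_feature_le hZ hZ0 hZ1 t x)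
  set n := ‖coreVec φ core x‖
  have hn : 0 ≤ n := norm_nonneg _
  simp only [smul_eq_mul]
  have a4 : |γ * (φ t ⬝ᵥ x) - φ s ⬝ᵥ x| ≤ 2 * n := by
    rw [abs_le]; constructor <;> nlinarith
  calc |φ s0 ⬝ᵥ x + 1 / (1 - γ) * (γ * (φ t ⬝ᵥ x) - φ s ⬝ᵥ x)|
      ≤ n + 1 / (1 - γ) * (2 * n) := by
        refine (abs_add_le _ _).trans (add_le_add (abs_le.2 a1) ?_)
        rw [abs_mul, abs_of_pos (one_div_pos.2 h1')]
        exact mul_le_mul_of_nonneg_left a4 (one_div_pos.2 h1').le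
    _ ≤ 1 / (1 - γ) * n + 1 / (1 - γ) * (2 * n) := by
        refine add_le_add_left (le_mul_of_one_le_left hn ?_) _
        rw [one_le_div h1']; linarith
    _ = _ := by ring

theorem abs_estLam_le (hZ : ∀ s, φ s = ∑ i, Z s i • φ (core i)) (hZ0 : ∀ s i, 0 ≤ Z s i)
    (hZ1 : ∀ s, ∑ i, Z s i = 1) {γ : ℝ} (h0 : 0 ≤ γ) (h1 : γ < 1) (s0 : Fin S) {ω : Tape S A}
    (hω : ∀ n s a, |(ω.1 n s a).2| ≤ 1) (h : ℕ) {θ : Fin d → ℝ} {B : ℝ}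
    (hθ : ‖coreVec φ core θ‖ ≤ B) (i : Fin (m + 1)) (a : Fin A) :
    |estLam γ φ core s0 ω h θ i a| ≤ 1 + 2 * B := by
  unfold estLam
  extract_lets s t
  have a0 := abs_le.1 (hω (h * callsPerGradient A m + 1 + i * A + a) s a)
  rw [sub_dotProduct, smul_dotProduct]
  have a2 := abs_le.1 ((abs_feature_le hZ hZ0 hZ1 s θ).trans hθ)
  have a3 := abs_le.1 ((abs_feature_le hZ hZ0 hZ1 t.1 θ).trans hθ)
  simp only [smul_eq_mul]
  rw [abs_le]
  constructor <;> nlinarith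

/-- The sampled gap of one iteration from `z` over the extrapolated point `y` to `z'`: the regret of
`y` against the comparator, corrected for the use of `z'` in place of `y` in the dual average. -/
def sampledGap [NeZero A] (γ : ℝ) (φ : Fin S → Fin d → ℝ) (core : Fin m ↪ Fin S) (s0 : Fin S) (ω : Tape S A)
    (h : ℕ) (u : Fin d → ℝ) (a0 : Fin A) (j : Fin m) (a : Fin A) (g : Fin (m + 1) → Fin A → ℝ)
    (y z' : (Fin d → ℝ) × (Fin (m + 1) → Fin A → ℝ)) : ℝ :=
  estTheta γ φ core s0 ω h y.2 ⬝ᵥ (y.1 - u) +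
    (estLam γ φ core s0 ω h y.1 0 a0 + γ / (1 - γ) * estLam γ φ core s0 ω h y.1 j.succ a -
      ∑ i, ∑ b, estLam γ φ core s0 ω h y.1 i b * y.2 i b) +
    ∑ i, ∑ b, g i b * (y.2 i b - z'.2 i b)

theorem sum_sum_mul_le {f g : Fin (m + 1) → Fin A → ℝ} {R D : ℝ} (hf : ∀ i a, |f i a| ≤ R)
    (hR : 0 ≤ R) (hg : ∑ i, ∑ a, |g i a| ≤ D) : ∑ i, ∑ a, f i a * g i a ≤ R * D := by
  calc ∑ i, ∑ a, f i a * g i a ≤ ∑ i, ∑ a, R * |g i a| := by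
        refine Finset.sum_le_sum fun i _ => Finset.sum_le_sum fun a _ => (le_abs_self _).trans ?_
        rw [abs_mul]
        exact mul_le_mul_of_nonneg_right (hf i a) (abs_nonneg _)
    _ = R * ∑ i, ∑ a, |g i a| := by simp only [Finset.mul_sum]
    _ ≤ _ := mul_le_mul_of_nonneg_left hg hR

/-- The bound for the sampled gap of one iteration. -/
theorem sampledGap_le [NeZero A] (hZ : ∀ s, φ s = ∑ i, Z s i • φ (core i)) (hZ0 : ∀ s i, 0 ≤ Z s i)
    (hZ1 : ∀ s, ∑ i, Z s i = 1) {γ : ℝ} (h0 : 0 ≤ γ) (h1 : γ < 1) (s0 : Fin S) {ω : Tape S A}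
    (hω : ∀ n s a, |(ω.1 n s a).2| ≤ 1) {B η : ℝ} (hB : 0 < B) (hη : 0 < η) (hl : 0 < ell A m γ)
    (h h' : ℕ) {u : Fin d → ℝ} (hu : ‖coreVec φ core u‖ ≤ B) (a0 : Fin A) (j : Fin m) (a : Fin A)
    {g : Fin (m + 1) → Fin A → ℝ} (hg : ∀ i a, |g i a| ≤ 1 + 2 * B)
    {z : (Fin d → ℝ) × (Fin (m + 1) → Fin A → ℝ)} (hz1 : ‖coreVec φ core z.1‖ ≤ B)
    (hz2 : InDom γ z.2) :
    sampledGap γ φ core s0 ω h' u a0 j a g (linStep γ φ core B η s0 ω h z z)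
        (linStep γ φ core B η s0 ω h' z (linStep γ φ core B η s0 ω h z z)) ≤
      (‖coreVec φ core (z.1 - u)‖ ^ 2 - ‖coreVec φ core
        ((linStep γ φ core B η s0 ω h' z (linStep γ φ core B η s0 ω h z z)).1 - u)‖ ^ 2) /
          (2 * (η * B ^ 2)) +
      (dualPot γ a0 j a (linStep γ φ core B η s0 ω h' z (linStep γ φ core B η s0 ω h z z)).2 -
        dualPot γ a0 j a z.2) / (2 * ell A m γ / (1 - γ) * η) +
      η * (3 / 2 * (B * (3 / (1 - γ))) ^ 2 + 32 * ell A m γ * ((1 + 2 * B) / (1 - γ)) ^ 2) := by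
  have h1' : 0 < 1 - γ := sub_pos.2 h1
  set y := linStep γ φ core B η s0 ω h z z with hy
  set z' := linStep γ φ core B η s0 ω h' z y with hz'
  have hy1 : ‖coreVec φ core y.1‖ ≤ B := norm_coreVec_linTheta_le φ core hB _ _ _
  have hy2 : InDom γ y.2 := hz2.proxLam _ _
  set c := 2 * ell A m γ / (1 - γ) * η with hc
  have hcp : 0 < c := by positivity
  set R := 1 + 2 * B with hR
  have hRp : 0 ≤ R := by positivity
  set Lc := 3 / (1 - γ) with hLc
  have hL0 : 0 ≤ Lc := by positivity
  set ξ := estTheta γ φ core s0 ω h' y.2 with hξ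
  set ρ := estLam γ φ core s0 ω h' y.1 with hρ
  have hξr : ∃ w, ξ = (corePhi φ core)ᵀ *ᵥ w := exists_estTheta_eq hZ γ s0 ω h' y.2
  have hξL : ∀ x, |ξ ⬝ᵥ x| ≤ Lc * ‖coreVec φ core x‖ :=
    abs_estTheta_le hZ hZ0 hZ1 h0 h1 s0 ω h' hy2
  have hρR : ∀ i a, |ρ i a| ≤ R := abs_estLam_le hZ hZ0 hZ1 h0 h1 s0 hω h' hy1
  have hρR' : ∀ i a, |estLam γ φ core s0 ω h z.1 i a| ≤ R :=
    abs_estLam_le hZ hZ0 hZ1 h0 h1 s0 hω h hz1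
  have p1 : ξ ⬝ᵥ (z.1 - u) ≤ (‖coreVec φ core (z.1 - u)‖ ^ 2 - ‖coreVec φ core (z'.1 - u)‖ ^ 2) /
      (2 * (η * B ^ 2)) + η * B ^ 2 * Lc ^ 2 / 2 := by
    have := linTheta_regret (η := η) hB hξr hL0 hξL z.1 hu
    rw [← sub_le_iff_le_add, le_div_iff₀ (by positivity)]
    change _ ≤ ‖coreVec φ core (z.1 - u)‖ ^ 2 - ‖coreVec φ core (z'.1 - u)‖ ^ 2 + _ at this
    linarith
  -- The gradient is taken at `y`, but the regret bound compares from `z`. The distance is one step,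
  -- so the exchange is of the same order η as the quadratic regret term.
  have p2 : ξ ⬝ᵥ (y.1 - z.1) ≤ Lc * (η * B ^ 2 * Lc) := by
    refine (le_abs_self _).trans ((hξL _).trans (mul_le_mul_of_nonneg_left ?_ hL0))
    exact linTheta_dist hB hη.le (exists_estTheta_eq hZ γ s0 ω h z.2) hL0
      (abs_estTheta_le hZ hZ0 hZ1 h0 h1 s0 ω h hz2) hz1
  -- The regret of the updated point `z'` has no quadratic term; the price is paid when `z'` is
  -- exchanged for `y`.
  have q1 : ρ 0 a0 + γ / (1 - γ) * ρ j.succ a - ∑ i, ∑ b, ρ i b * z'.2 i b ≤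
      (dualPot γ a0 j a z'.2 - dualPot γ a0 j a z.2) / c := by
    rw [le_div_iff₀ hcp, mul_comm]
    exact proxLam_regret hz2 η ρ a0 j a
  have d1 : ∑ i, ∑ b, |z'.2 i b - z.2 i b| ≤ 4 * (c * R) * (1 / (1 - γ)) :=
    proxLam_dist hz2 h1 hρR hRp hcp.le
  have d2 : ∑ i, ∑ b, |y.2 i b - z.2 i b| ≤ 4 * (c * R) * (1 / (1 - γ)) :=
    proxLam_dist hz2 h1 hρR' hRp hcp.le
  have d3 : ∑ i, ∑ b, |z'.2 i b - y.2 i b| ≤ 8 * (c * R) * (1 / (1 - γ)) := by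
    calc ∑ i, ∑ b, |z'.2 i b - y.2 i b|
        ≤ ∑ i, ∑ b, (|z'.2 i b - z.2 i b| + |y.2 i b - z.2 i b|) := by
          refine Finset.sum_le_sum fun i _ => Finset.sum_le_sum fun b _ => ?_
          rw [abs_sub_comm (y.2 i b)]
          exact abs_sub_le _ _ _
      _ ≤ _ := by simp only [Finset.sum_add_distrib]; linarith
  have d4 : ∑ i, ∑ b, |y.2 i b - z'.2 i b| ≤ 8 * (c * R) * (1 / (1 - γ)) := by
    simpa only [abs_sub_comm (z'.2 _ _)] using d3
  have q2 := sum_sum_mul_le hρR hRp d3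
  have q3 := sum_sum_mul_le hg hRp d4
  have e1 : ξ ⬝ᵥ (y.1 - u) = ξ ⬝ᵥ (z.1 - u) + ξ ⬝ᵥ (y.1 - z.1) := by
    rw [← dotProduct_add]; congr 1; abel
  have e2 : ∑ i, ∑ b, ρ i b * (z'.2 i b - y.2 i b) =
      ∑ i, ∑ b, ρ i b * z'.2 i b - ∑ i, ∑ b, ρ i b * y.2 i b := by
    simp only [mul_sub, Finset.sum_sub_distrib]
  -- The factor 3/2 is 1/2 from the expanded square plus 1 from moving `z` to `y`. The factor 32 is
  -- 2 · 8 · 2: both ρ and `g` are paired with a displacement of size 8cR/(1-γ), and c = 2ℓη/(1-γ).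
  have e3 : η * (3 / 2 * (B * Lc) ^ 2 + 32 * ell A m γ * (R / (1 - γ)) ^ 2) =
      η * B ^ 2 * Lc ^ 2 / 2 + Lc * (η * B ^ 2 * Lc) + 2 * (R * (8 * (c * R) * (1 / (1 - γ)))) := by
    rw [hc]; field_simp; ring
  rw [e3, sampledGap, ← hξ, ← hρ, e1]
  linarith

end Iteration

/-! ## Probability -/

section EqInt

variable {Ω : Type*} [MeasurableSpace Ω] {μ : Measure Ω} {F F' G G' : Ω → ℝ}

/-- Two integrable functions with the same integral. -/
structure EqInt (μ : Measure Ω) (F G : Ω → ℝ) : Prop where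
  left : Integrable F μ
  right : Integrable G μ
  eq : ∫ ω, F ω ∂μ = ∫ ω, G ω ∂μ

theorem EqInt.refl (h : Integrable F μ) : EqInt μ F F := ⟨h, h, rfl⟩

theorem EqInt.trans {H : Ω → ℝ} (h : EqInt μ F G) (h' : EqInt μ G H) : EqInt μ F H :=
  ⟨h.left, h'.right, h.eq.trans h'.eq⟩

theorem EqInt.add (h : EqInt μ F G) (h' : EqInt μ F' G') :
    EqInt μ (fun ω => F ω + F' ω) (fun ω => G ω + G' ω) :=
  ⟨h.left.add h'.left, h.right.add h'.right, by
    rw [integral_add h.left h'.left, integral_add h.right h'.right, h.eq, h'.eq]⟩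

theorem EqInt.sub (h : EqInt μ F G) (h' : EqInt μ F' G') :
    EqInt μ (fun ω => F ω - F' ω) (fun ω => G ω - G' ω) :=
  ⟨h.left.sub h'.left, h.right.sub h'.right, by
    rw [integral_sub h.left h'.left, integral_sub h.right h'.right, h.eq, h'.eq]⟩

theorem EqInt.const_mul (h : EqInt μ F G) (c : ℝ) :
    EqInt μ (fun ω => c * F ω) (fun ω => c * G ω) :=
  ⟨h.left.const_mul c, h.right.const_mul c, by
    rw [integral_const_mul, integral_const_mul, h.eq]⟩

theorem EqInt.sum {ι : Type*} {s : Finset ι} {F G : ι → Ω → ℝ} (h : ∀ i ∈ s, EqInt μ (F i) (G i)) :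
    EqInt μ (fun ω => ∑ i ∈ s, F i ω) (fun ω => ∑ i ∈ s, G i ω) :=
  ⟨integrable_finsetSum _ fun i hi => (h i hi).left, integrable_finsetSum _ fun i hi => (h i hi).right,
    by rw [integral_finsetSum _ fun i hi => (h i hi).left,
      integral_finsetSum _ fun i hi => (h i hi).right, Finset.sum_congr rfl fun i hi => (h i hi).eq]⟩

end EqInt

/-! ### Replacing one entry of an i.i.d. sequence. -/

section Resampling

variable {X : Type*} [MeasurableSpace X]

theorem measurable_update_pair (n : ℕ) :
    Measurable fun p : (ℕ → X) × X => Function.update p.1 n p.2 := by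
  refine measurable_pi_lambda _ fun k => ?_
  by_cases h : k = n
  · subst h; simpa using measurable_snd
  · simp only [Function.update_of_ne h]
    exact (measurable_pi_apply k).comp measurable_fst

/-- Replacing one entry of an i.i.d. sequence by a fresh sample does not change its law. -/
theorem measurePreserving_update (ν : Measure X) [IsProbabilityMeasure ν] (n : ℕ) :
    MeasurePreserving (fun p : (ℕ → X) × X => Function.update p.1 n p.2)
      ((Measure.infinitePi fun _ : ℕ => ν).prod ν) (Measure.infinitePi fun _ : ℕ => ν) := by
  refine ⟨measurable_update_pair n, Measure.eq_infinitePi _ fun s t ht => ?_⟩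
  rw [Measure.map_apply (measurable_update_pair n)
    (MeasurableSet.pi s.countable_toSet fun i _ => ht i)]
  by_cases hn : n ∈ s
  · have : (fun p : (ℕ → X) × X => Function.update p.1 n p.2) ⁻¹' ((s : Set ℕ).pi t) =
        ((s.erase n : Finset ℕ) : Set ℕ).pi t ×ˢ t n := by
      ext p
      simp only [Set.mem_preimage, Set.mem_pi, Set.mem_prod, Finset.mem_coe, Finset.mem_erase]
      constructor
      · intro h
        refine ⟨fun i hi => ?_, by simpa using h n hn⟩
        simpa [Function.update_of_ne hi.1] using h i hi.2
      · rintro ⟨h1, h2⟩ i hi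
        by_cases hin : i = n
        · subst hin; simpa using h2
        · simpa [Function.update_of_ne hin] using h1 i ⟨hin, hi⟩
    rw [this, Measure.prod_prod, Measure.infinitePi_pi _ fun i _ => ht i, mul_comm,
      Finset.mul_prod_erase s (fun i => ν (t i)) hn]
  · have : (fun p : (ℕ → X) × X => Function.update p.1 n p.2) ⁻¹' ((s : Set ℕ).pi t) =
        (s : Set ℕ).pi t ×ˢ Set.univ := by
      ext p
      simp only [Set.mem_preimage, Set.mem_pi, Set.mem_prod, Finset.mem_coe, Set.mem_univ, and_true]
      refine forall₂_congr fun i hi => ?_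
      rw [Function.update_of_ne (by rintro rfl; exact hn hi)]
    rw [this, Measure.prod_prod, Measure.infinitePi_pi _ fun i _ => ht i, measure_univ, mul_one]

theorem measurePreserving_update_fst {Y : Type*} [MeasurableSpace Y] (ν : Measure X)
    [IsProbabilityMeasure ν] (κ : Measure Y) [IsProbabilityMeasure κ] (n : ℕ) :
    MeasurePreserving (fun p : ((ℕ → X) × Y) × X => (Function.update p.1.1 n p.2, p.1.2))
      (((Measure.infinitePi fun _ : ℕ => ν).prod κ).prod ν)
      ((Measure.infinitePi fun _ : ℕ => ν).prod κ) := by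
  set P := Measure.infinitePi fun _ : ℕ => ν
  have h1 := measurePreserving_prodAssoc P κ ν
  have h2 : MeasurePreserving (Prod.map id Prod.swap : (ℕ → X) × (Y × X) → (ℕ → X) × (X × Y))
      (P.prod (κ.prod ν)) (P.prod (ν.prod κ)) :=
    (MeasurePreserving.id P).prod Measure.measurePreserving_swap
  have h3 := (measurePreserving_prodAssoc P ν κ).symm MeasurableEquiv.prodAssoc
  have h4 : MeasurePreserving (Prod.map (fun p : (ℕ → X) × X => Function.update p.1 n p.2) id :
      ((ℕ → X) × X) × Y → (ℕ → X) × Y) ((P.prod ν).prod κ) (P.prod κ) :=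
    (measurePreserving_update ν n).prod (MeasurePreserving.id κ)
  exact h4.comp (h3.comp (h2.comp h1))

theorem measurePreserving_update_snd {Y : Type*} [MeasurableSpace Y] (ν : Measure X)
    [IsProbabilityMeasure ν] (κ : Measure Y) [IsProbabilityMeasure κ] (n : ℕ) :
    MeasurePreserving (fun p : (Y × (ℕ → X)) × X => (p.1.1, Function.update p.1.2 n p.2))
      ((κ.prod (Measure.infinitePi fun _ : ℕ => ν)).prod ν)
      (κ.prod (Measure.infinitePi fun _ : ℕ => ν)) := by
  set P := Measure.infinitePi fun _ : ℕ => ν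
  have h1 := measurePreserving_prodAssoc κ P ν
  have h2 : MeasurePreserving (Prod.map id (fun p : (ℕ → X) × X => Function.update p.1 n p.2) :
      Y × ((ℕ → X) × X) → Y × (ℕ → X)) (κ.prod (P.prod ν)) (κ.prod P) :=
    (MeasurePreserving.id κ).prod (measurePreserving_update ν n)
  exact h2.comp h1

/-- Integration after resampling. -/
theorem integral_resample {Ω : Type*} [MeasurableSpace Ω] {μ : Measure Ω} [IsProbabilityMeasure μ]
    {ν : Measure X} [IsProbabilityMeasure ν] {Φ : Ω × X → Ω} (hΦ : MeasurePreserving Φ (μ.prod ν) μ)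
    {F : Ω → ℝ} (hF : Integrable F μ) : EqInt μ F (fun ω => ∫ x, F (Φ (ω, x)) ∂ν) := by
  have h1 : ∫ ω, F ω ∂μ = ∫ p, F (Φ p) ∂(μ.prod ν) := by
    conv_lhs => rw [← hΦ.map_eq]
    exact integral_map hΦ.measurable.aemeasurable (by rw [hΦ.map_eq]; exact hF.aestronglyMeasurable)
  have h2 : Integrable (fun p => F (Φ p)) (μ.prod ν) := hΦ.integrable_comp_of_integrable hF
  exact ⟨hF, h2.integral_prod_left, h1.trans (integral_prod _ h2)⟩

end Resampling

/-! ### The law and the measurability of sampling by inversion. -/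

section Pick

variable {ι : Type} [Fintype ι] [LinearOrder ι] [Nonempty ι]

theorem pick_eq_iff {w : ι → ℝ} (hw : ∀ i, 0 ≤ w i) {u : ℝ} (hu : u ≤ 1) (k : ι) :
    pick w u = k ↔ u * ∑ j, w j ≤ ∑ j with j ≤ k, w j ∧
      ∀ i < k, ∑ j with j ≤ i, w j < u * ∑ j, w j := by
  classical
  -- The largest index qualifies because u ≤ 1, so the arbitrary default of `pick` is never used.
  have hne : (Finset.univ.filter fun k => u * ∑ j, w j ≤ ∑ j with j ≤ k, w j).Nonempty := by
    obtain ⟨k, hk⟩ := Finite.exists_max (id : ι → ι)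
    simp only [id] at hk
    refine ⟨k, Finset.mem_filter.2 ⟨Finset.mem_univ _, ?_⟩⟩
    rw [Finset.filter_true_of_mem fun j _ => hk j]
    exact mul_le_of_le_one_left (Finset.sum_nonneg fun j _ => hw j) hu
  have hp : pick w u = Finset.min' _ hne := by
    unfold pick
    rw [dif_pos hne]
  have hmem := Finset.min'_mem _ hne
  rw [hp]
  constructor
  · rintro rfl
    refine ⟨(Finset.mem_filter.1 hmem).2, fun i hi => ?_⟩
    by_contra! h
    exact absurd (Finset.min'_le _ i (Finset.mem_filter.2 ⟨Finset.mem_univ _, h⟩)) (not_le.2 hi)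
  · rintro ⟨h1, h2⟩
    refine le_antisymm (Finset.min'_le _ k (Finset.mem_filter.2 ⟨Finset.mem_univ _, h1⟩)) ?_
    by_contra! h
    exact absurd (Finset.mem_filter.1 hmem).2 (not_le.2 (h2 _ h))

/-- Cumulative sums are monotone in the index, so being past the first admissible index is the same
as being admissible. Both the law of `pick` and the search on the machine rest on this form. -/
theorem pick_le_iff {w : ι → ℝ} (hw : ∀ i, 0 ≤ w i) {u : ℝ} (hu : u ≤ 1) (k : ι) :
    pick w u ≤ k ↔ u * ∑ j, w j ≤ ∑ j with j ≤ k, w j := by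
  obtain ⟨h1, h2⟩ := (pick_eq_iff hw hu (pick w u)).1 rfl
  constructor
  · intro h
    refine h1.trans (Finset.sum_le_sum_of_subset_of_nonneg ?_ fun j _ _ => hw j)
    exact fun j hj => Finset.mem_filter.2 ⟨Finset.mem_univ _, (Finset.mem_filter.1 hj).2.trans h⟩
  · intro h
    by_contra! hlt
    exact absurd h (not_le.2 (h2 k hlt))

/-- Joint measurability in weights and threshold is needed because the weights are random iterates.
`pick` depends only on the finite set of admissible indices, and each membership is a closed
condition. -/
theorem measurableSet_pick_eq (k : ι) :
    MeasurableSet {p : (ι → ℝ) × ℝ | pick p.1 p.2 = k} := by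
  classical
  set Q : (ι → ℝ) × ℝ → Finset ι := fun p =>
    Finset.univ.filter fun k => p.2 * ∑ j, p.1 j ≤ ∑ j with j ≤ k, p.1 j with hQ
  set F : Finset ι → ι := fun s => if h : s.Nonempty then s.min' h else Classical.arbitrary ι with hF
  have hp : ∀ p : (ι → ℝ) × ℝ, pick p.1 p.2 = F (Q p) := fun p => by
    simp only [pick, hF, hQ]
  have h1 : ∀ s : Finset ι, MeasurableSet {p | Q p = s} := fun s => by
    have : {p | Q p = s} = ⋂ i : ι, {p | i ∈ Q p ↔ i ∈ s} := by
      ext p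
      simp [Finset.ext_iff]
    rw [this]
    refine MeasurableSet.iInter fun i => ?_
    have h2 : MeasurableSet {p | i ∈ Q p} := by
      simp only [hQ, Finset.mem_filter, Finset.mem_univ, true_and]
      exact measurableSet_le (by fun_prop) (by fun_prop)
    by_cases hi : i ∈ s
    · simpa only [hi, iff_true] using h2
    · simp only [hi, iff_false]
      exact h2.compl
  have : {p : (ι → ℝ) × ℝ | pick p.1 p.2 = k} = ⋃ s : {s : Finset ι // F s = k}, {p | Q p = s} := by
    ext p
    simp [hp]
  rw [this]
  exact MeasurableSet.iUnion fun s => h1 s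

theorem measurable_pick {Ω Y : Type*} [MeasurableSpace Ω] [MeasurableSpace Y] {w : Ω → ι → ℝ}
    {u : Ω → ℝ} {f : Ω → ι → Y} (hw : ∀ i, Measurable fun ω => w ω i) (hu : Measurable u)
    (hf : ∀ k, Measurable fun ω => f ω k) : Measurable fun ω => f ω (pick (w ω) (u ω)) := by
  intro t ht
  have h1 : Measurable fun ω => (w ω, u ω) := (measurable_pi_iff.2 hw).prodMk hu
  have : (fun ω => f ω (pick (w ω) (u ω))) ⁻¹' t =
      ⋃ k : ι, {ω | pick (w ω) (u ω) = k} ∩ (fun ω => f ω k) ⁻¹' t := by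
    ext ω
    simp
  rw [this]
  exact MeasurableSet.iUnion fun k => (h1 (measurableSet_pick_eq k)).inter (hf k ht)

/-- The law of `pick`. -/
theorem volume_pick_eq {w : ι → ℝ} (hw : ∀ i, 0 ≤ w i) (hW : 0 < ∑ i, w i) (k : ι) :
    (volume : Measure unitInterval).real {u | pick w u = k} = w k / ∑ i, w i := by
  classical
  have hcum : ∀ k, (volume : Measure unitInterval).real {u | pick w u ≤ k} =
      (∑ j with j ≤ k, w j) / ∑ i, w i := fun k => by
    have h0 : 0 ≤ (∑ j with j ≤ k, w j) / ∑ i, w i :=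
      div_nonneg (Finset.sum_nonneg fun j _ => hw j) hW.le
    have h1 : (∑ j with j ≤ k, w j) / ∑ i, w i ≤ 1 := by
      rw [div_le_one hW]
      exact Finset.sum_le_sum_of_subset_of_nonneg (Finset.filter_subset _ _) fun j _ _ => hw j
    have : {u : unitInterval | pick w u ≤ k} =
        Set.Iic ⟨(∑ j with j ≤ k, w j) / ∑ i, w i, h0, h1⟩ := by
      ext u
      rw [Set.mem_ofPred_eq, pick_le_iff hw u.2.2, Set.mem_Iic, ← Subtype.coe_le_coe, le_div_iff₀ hW]
    rw [this, measureReal_def, unitInterval.volume_Iic, ENNReal.toReal_ofReal h0]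
  have hmeas : ∀ k, MeasurableSet {u : unitInterval | pick w u = k} := fun k => by
    have : Measurable fun u : unitInterval => (w, (u : ℝ)) := by fun_prop
    exact this (measurableSet_pick_eq k)
  have hsum : ∀ k, (volume : Measure unitInterval).real {u | pick w u ≤ k} =
      ∑ j with j ≤ k, (volume : Measure unitInterval).real {u | pick w u = j} := fun k => by
    rw [← measureReal_biUnion_finset]
    · congr 1
      ext u
      simp
    · intro i _ j _ hij
      exact Set.disjoint_left.2 fun u (hu : _ = _) (hu' : _ = _) => hij (hu.symm.trans hu')
    · exact fun j _ => hmeas j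
  -- The cumulative law is known; subtracting the laws of all smaller indices leaves the law of `k`.
  induction k using WellFoundedLT.induction with
  | ind k ih =>
    have h1 := (hsum k).symm.trans (hcum k)
    have hsplit : (Finset.univ.filter fun j => j ≤ k) = insert k (Finset.univ.filter fun j => j < k) := by
      ext j
      simp [le_iff_eq_or_lt]
    rw [hsplit, Finset.sum_insert (by simp), Finset.sum_insert (by simp), add_div, Finset.sum_div,
      Finset.sum_congr rfl fun j hj => ih j (Finset.mem_filter.1 hj).2] at h1
    linarith

theorem integral_pick {w : ι → ℝ} (hw : ∀ i, 0 ≤ w i) (hW : 0 < ∑ i, w i) (f : ι → ℝ) :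
    ∫ u : unitInterval, f (pick w u) = ∑ k, w k / (∑ i, w i) * f k := by
  have hmeas : ∀ k, MeasurableSet {u : unitInterval | pick w u = k} := fun k => by
    have : Measurable fun u : unitInterval => (w, (u : ℝ)) := by fun_prop
    exact this (measurableSet_pick_eq k)
  have h1 : ∀ u : unitInterval, f (pick w u) =
      ∑ k, Set.indicator {u : unitInterval | pick w u = k} (fun _ => f k) u := fun u => by
    simp [Set.indicator_apply]
  simp only [h1]
  rw [integral_finsetSum _ fun k _ => (integrable_const _).indicator (hmeas k)]
  refine Finset.sum_congr rfl fun k _ => ?_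
  rw [integral_indicator_const _ (hmeas k), volume_pick_eq hw hW, smul_eq_mul]

end Pick

/-! ## Expectations over the tape -/

section Tape

variable {S A d m : ℕ}

/-- The joint law of the answers of the simulator to all queries in one call. -/
def Problem.answerLaw (Q : Problem S A d m) : Measure (Fin S → Fin A → Fin S × ℝ) :=
  Measure.pi fun s => Measure.pi fun a => (Q.sim s a : Measure (Fin S × ℝ))

instance (Q : Problem S A d m) : IsProbabilityMeasure Q.answerLaw := by
  unfold Problem.answerLaw; infer_instance

theorem Problem.tapeLaw_eq (Q : Problem S A d m) : Q.tapeLaw =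
    (Measure.infinitePi fun _ : ℕ => Q.answerLaw).prod
      (Measure.infinitePi fun _ : ℕ => (volume : Measure unitInterval)) := rfl

instance (Q : Problem S A d m) : IsProbabilityMeasure Q.tapeLaw := by
  rw [Problem.tapeLaw_eq]; infer_instance

/-- The tape with the answers in the simulator call `n` replaced by `x`. -/
def setCall (n : ℕ) (p : Tape S A × (Fin S → Fin A → Fin S × ℝ)) : Tape S A :=
  (Function.update p.1.1 n p.2, p.1.2)

/-- The tape with the random number `n` replaced by `x`. -/
def setDraw (n : ℕ) (p : Tape S A × unitInterval) : Tape S A :=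
  (p.1.1, Function.update p.1.2 n p.2)

variable (Q : Problem S A d m)

theorem measurePreserving_setCall (n : ℕ) :
    MeasurePreserving (setCall n) (Q.tapeLaw.prod Q.answerLaw) Q.tapeLaw :=
  measurePreserving_update_fst Q.answerLaw _ n

theorem measurePreserving_setDraw (n : ℕ) :
    MeasurePreserving (setDraw (S := S) (A := A) n)
      (Q.tapeLaw.prod (volume : Measure unitInterval)) Q.tapeLaw :=
  measurePreserving_update_snd (volume : Measure unitInterval)
    (Measure.infinitePi fun _ : ℕ => Q.answerLaw) n

theorem measurePreserving_answer (s : Fin S) (a : Fin A) :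
    MeasurePreserving (fun x : Fin S → Fin A → Fin S × ℝ => x s a) Q.answerLaw
      (Q.sim s a : Measure (Fin S × ℝ)) :=
  (measurePreserving_eval (fun a => (Q.sim s a : Measure (Fin S × ℝ))) a).comp
    (measurePreserving_eval (fun s => Measure.pi fun a => (Q.sim s a : Measure (Fin S × ℝ))) s)

theorem measurePreserving_call (n : ℕ) (s : Fin S) (a : Fin A) :
    MeasurePreserving (fun ω : Tape S A => ω.1 n s a) Q.tapeLaw
      (Q.sim s a : Measure (Fin S × ℝ)) :=
  (measurePreserving_answer Q s a).comp
    ((measurePreserving_eval_infinitePi (fun _ : ℕ => Q.answerLaw) n).comp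
      (measurePreserving_fst (μ := Measure.infinitePi fun _ : ℕ => Q.answerLaw)
        (ν := Measure.infinitePi fun _ : ℕ => (volume : Measure unitInterval))))

variable {Q}

theorem Problem.Assumptions.ae_reward (hQ : Q.Assumptions) :
    ∀ᵐ ω ∂Q.tapeLaw, ∀ n s a, |(ω.1 n s a).2| ≤ 1 := by
  rw [ae_all_iff]
  intro n
  rw [ae_all_iff]
  intro s
  rw [ae_all_iff]
  intro a
  exact (measurePreserving_call Q n s a).quasiMeasurePreserving.ae (hQ.simBound s a)

theorem Problem.Assumptions.integrable_reward (hQ : Q.Assumptions) (s : Fin S) (a : Fin A) :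
    Integrable (fun x : Fin S × ℝ => x.2) (Q.sim s a : Measure (Fin S × ℝ)) :=
  Integrable.of_bound measurable_snd.aestronglyMeasurable 1
    (by simpa only [Real.norm_eq_abs] using hQ.simBound s a)

theorem Problem.Assumptions.abs_reward_le (hQ : Q.Assumptions) (s : Fin S) (a : Fin A) :
    |Q.mdp.r s a| ≤ 1 := by
  rw [← hQ.simMean s a]
  have := norm_integral_le_of_norm_le_const (μ := (Q.sim s a : Measure (Fin S × ℝ)))
    (f := fun x : Fin S × ℝ => x.2) (C := 1) (by simpa only [Real.norm_eq_abs] using hQ.simBound s a)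
  simpa using this

theorem Problem.Assumptions.integral_next (hQ : Q.Assumptions) (s : Fin S) (a : Fin A)
    (f : Fin S → ℝ) :
    ∫ x, f x.1 ∂(Q.sim s a : Measure (Fin S × ℝ)) = ∑ t, Q.mdp.P s a t * f t := by
  have h1 : ∫ x, f x.1 ∂(Q.sim s a : Measure (Fin S × ℝ)) =
      ∫ t, f t ∂((Q.sim s a : Measure (Fin S × ℝ)).map Prod.fst) :=
    (integral_map measurable_fst.aemeasurable (measurable_of_finite f).aestronglyMeasurable).symm
  have : IsProbabilityMeasure ((Q.sim s a : Measure (Fin S × ℝ)).map Prod.fst) :=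
    Measure.isProbabilityMeasure_map measurable_fst.aemeasurable
  rw [h1, integral_fintype .of_finite]
  refine Finset.sum_congr rfl fun t _ => ?_
  have h2 : Prod.fst ⁻¹' {t} = {x : Fin S × ℝ | x.1 = t} := rfl
  rw [measureReal_def, Measure.map_apply measurable_fst (measurableSet_singleton t), h2,
    hQ.simNext s a t, ENNReal.toReal_ofReal (Q.mdp.P_nonneg s a t), smul_eq_mul]

theorem integrable_fst_sim (s : Fin S) (a : Fin A) (f : Fin S → ℝ) :
    Integrable (fun x : Fin S × ℝ => f x.1) (Q.sim s a : Measure (Fin S × ℝ)) := by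
  refine Integrable.of_bound ((measurable_of_finite f).comp measurable_fst).aestronglyMeasurable
    (∑ t, |f t|) (ae_of_all _ fun x => ?_)
  exact Finset.single_le_sum (f := fun t => |f t|) (fun t _ => abs_nonneg _) (Finset.mem_univ x.1)

theorem measurable_apply_finite {Ω ι Y : Type*} [MeasurableSpace Ω] [MeasurableSpace ι]
    [Countable ι] [MeasurableSingletonClass ι] [MeasurableSpace Y] {t : Ω → ι} {f : Ω → ι → Y}
    (ht : Measurable t) (hf : ∀ i, Measurable fun ω => f ω i) : Measurable fun ω => f ω (t ω) :=
  (measurable_from_prod_countable_right (f := fun p : ι × Ω => f p.2 p.1) hf).comp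
    (ht.prodMk measurable_id)

theorem measurable_call (n : ℕ) (s : Fin S) (a : Fin A) :
    Measurable fun ω : Tape S A => ω.1 n s a := by fun_prop

theorem measurable_draw (n : ℕ) : Measurable fun ω : Tape S A => (ω.2 n : ℝ) := by fun_prop

/-- The expectation of the dual gradient estimate. -/
theorem Problem.Assumptions.integral_advantage (hQ : Q.Assumptions) (n : ℕ) (s : Fin S) (a : Fin A)
    {x : Tape S A → Fin S → ℝ} {y : Tape S A → ℝ} {b c : ℝ}
    (hx : ∀ t, Measurable fun ω => x ω t) (hy : Measurable y) (hxb : ∀ ω t, |x ω t| ≤ b)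
    (hyc : ∀ ω, |y ω| ≤ c) (hxn : ∀ p, x (setCall n p) = x p.1) (hyn : ∀ p, y (setCall n p) = y p.1) :
    EqInt Q.tapeLaw (fun ω => ((ω.1 n s a).2 + (Q.mdp.γ * x ω (ω.1 n s a).1 - x ω s)) * y ω)
      (fun ω => Q.mdp.adv (x ω) s a * y ω) := by
  have hγ := Q.mdp.γ_nonneg
  have hγ1 := Q.mdp.γ_lt_one.le
  have hint : Integrable (fun ω => ((ω.1 n s a).2 + (Q.mdp.γ * x ω (ω.1 n s a).1 - x ω s)) * y ω)
      Q.tapeLaw := by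
    have hm1 : Measurable fun ω : Tape S A => (ω.1 n s a).2 := (measurable_call n s a).snd
    have hm2 : Measurable fun ω : Tape S A => x ω (ω.1 n s a).1 :=
      measurable_apply_finite (measurable_call n s a).fst hx
    refine Integrable.of_bound (C := (1 + 2 * b) * c)
      ((hm1.add ((hm2.const_mul _).sub (hx s))).mul hy).aestronglyMeasurable ?_
    filter_upwards [hQ.ae_reward] with ω hω
    rw [Real.norm_eq_abs, abs_mul]
    have h1 := abs_le.1 (hω n s a)
    have h2 := abs_le.1 (hxb ω s)
    have h3 := abs_le.1 (hxb ω (ω.1 n s a).1)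
    have hb : 0 ≤ b := (abs_nonneg _).trans (hxb ω s)
    refine mul_le_mul ?_ (hyc ω) (abs_nonneg _) (by linarith)
    rw [abs_le]
    constructor <;> nlinarith
  -- Since `x` and `y` do not read call `n`, resampling it leaves an inner integral over the
  -- simulator's law alone.
  convert integral_resample (measurePreserving_setCall Q n) hint using 1
  funext ω
  have h1 : ∀ z, (((setCall n (ω, z)).1 n s a).2 + (Q.mdp.γ * x (setCall n (ω, z))
      ((setCall n (ω, z)).1 n s a).1 - x (setCall n (ω, z)) s)) * y (setCall n (ω, z)) =
      ((z s a).2 + (Q.mdp.γ * x ω (z s a).1 - x ω s)) * y ω := fun z => by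
    rw [hxn, hyn]
    simp [setCall]
  simp only [h1]
  have h3 : ∫ z, ((z s a).2 + (Q.mdp.γ * x ω (z s a).1 - x ω s)) * y ω ∂Q.answerLaw =
      ∫ z, (z.2 + (Q.mdp.γ * x ω z.1 - x ω s)) * y ω ∂(Q.sim s a : Measure (Fin S × ℝ)) := by
    rw [← (measurePreserving_answer Q s a).map_eq]
    refine (integral_map (measurePreserving_answer Q s a).measurable.aemeasurable
      (f := fun z : Fin S × ℝ => (z.2 + (Q.mdp.γ * x ω z.1 - x ω s)) * y ω) ?_).symm
    exact ((measurable_snd.add ((((measurable_of_finite (x ω)).comp measurable_fst).const_mul _).sub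
      measurable_const)).mul measurable_const).aestronglyMeasurable
  have h4 : Integrable (fun z : Fin S × ℝ => Q.mdp.γ * x ω z.1) (Q.sim s a : Measure (Fin S × ℝ)) :=
    (integrable_fst_sim s a (x ω)).const_mul _
  have h5 : Integrable (fun z : Fin S × ℝ => Q.mdp.γ * x ω z.1 - x ω s)
      (Q.sim s a : Measure (Fin S × ℝ)) := h4.sub (integrable_const _)
  rw [h3, integral_mul_const, integral_add (hQ.integrable_reward s a) h5,
    integral_sub h4 (integrable_const _),
    integral_const_mul, hQ.simMean, hQ.integral_next]
  simp only [MDP.adv, MDP.look, integral_const, probReal_univ, one_smul]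
  ring

/-- The expectation of the primal gradient estimate. -/
theorem Problem.Assumptions.integral_pick_next (hQ : Q.Assumptions) {ι : Type} [Fintype ι]
    [LinearOrder ι] [Nonempty ι] (n h : ℕ) (s : ι → Fin S) (a : ι → Fin A)
    {w : Tape S A → ι → ℝ} {f : Tape S A → ι → Fin S → ℝ} {b : ℝ}
    (hw : ∀ i, Measurable fun ω => w ω i) (hf : ∀ i t, Measurable fun ω => f ω i t)
    (hfb : ∀ ω i t, |f ω i t| ≤ b) (hw0 : ∀ ω i, 0 ≤ w ω i) (hwp : ∀ ω, 0 < ∑ i, w ω i)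
    (hwn : ∀ p, w (setCall n p) = w p.1) (hfn : ∀ p, f (setCall n p) = f p.1)
    (hwh : ∀ p, w (setDraw h p) = w p.1) (hfh : ∀ p, f (setDraw h p) = f p.1) :
    EqInt Q.tapeLaw (fun ω => f ω (pick (w ω) (ω.2 h))
        (ω.1 n (s (pick (w ω) (ω.2 h))) (a (pick (w ω) (ω.2 h)))).1)
      (fun ω => ∑ i, w ω i / (∑ j, w ω j) * ∑ t, Q.mdp.P (s i) (a i) t * f ω i t) := by
  have hint : Integrable (fun ω => f ω (pick (w ω) (ω.2 h))
      (ω.1 n (s (pick (w ω) (ω.2 h))) (a (pick (w ω) (ω.2 h)))).1) Q.tapeLaw := by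
    refine Integrable.of_bound (C := b) (Measurable.aestronglyMeasurable ?_)
      (ae_of_all _ fun ω => hfb _ _ _)
    exact measurable_pick (f := fun ω i => f ω i (ω.1 n (s i) (a i)).1) hw (measurable_draw h)
      fun i => measurable_apply_finite (measurable_call n (s i) (a i)).fst (hf i)
  -- Two resamplings: first the simulator call with the picked index held fixed, then the uniform
  -- number that decides the index.
  have hres := integral_resample (measurePreserving_setCall Q n) hint
  have h1 : ∀ ω : Tape S A, ∫ z, f (setCall n (ω, z)) (pick (w (setCall n (ω, z)))
      ((setCall n (ω, z)).2 h)) ((setCall n (ω, z)).1 n (s (pick (w (setCall n (ω, z)))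
        ((setCall n (ω, z)).2 h))) (a (pick (w (setCall n (ω, z))) ((setCall n (ω, z)).2 h)))).1
          ∂Q.answerLaw =
      ∑ t, Q.mdp.P (s (pick (w ω) (ω.2 h))) (a (pick (w ω) (ω.2 h))) t *
        f ω (pick (w ω) (ω.2 h)) t := fun ω => by
    simp only [hwn, hfn]
    have e1 : ∀ z, (setCall n (ω, z)).1 n = z := fun z => by simp [setCall]
    have e2 : ∀ z, (setCall n (ω, z)).2 = ω.2 := fun z => rfl
    simp only [e1, e2]
    rw [← hQ.integral_next]
    rw [← (measurePreserving_answer Q (s (pick (w ω) (ω.2 h))) (a (pick (w ω) (ω.2 h)))).map_eq]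
    refine (integral_map (measurePreserving_answer Q _ _).measurable.aemeasurable
      (f := fun z : Fin S × ℝ => f ω (pick (w ω) (ω.2 h)) z.1) ?_).symm
    exact ((measurable_of_finite _).comp measurable_fst).aestronglyMeasurable
  simp only [h1] at hres
  refine hres.trans ?_
  have hint2 : Integrable (fun ω => ∑ t, Q.mdp.P (s (pick (w ω) (ω.2 h))) (a (pick (w ω) (ω.2 h))) t *
        f ω (pick (w ω) (ω.2 h)) t) Q.tapeLaw := by
    refine Integrable.of_bound (C := b) (Measurable.aestronglyMeasurable ?_)
      (ae_of_all _ fun ω => ?_)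
    · exact measurable_pick (f := fun ω i => ∑ t, Q.mdp.P (s i) (a i) t * f ω i t) hw
        (measurable_draw h) fun i => Finset.measurable_sum _ fun t _ => (hf i t).const_mul _
    · exact abs_sum_weight_le (Q.mdp.P_nonneg _ _) (Q.mdp.P_sum _ _) fun t => hfb _ _ _
  convert integral_resample (measurePreserving_setDraw Q h) hint2 using 1
  funext ω
  simp only [hwh, hfh]
  have e1 : ∀ z, (setDraw h (ω, z)).2 h = z := fun z => by simp [setDraw]
  simp only [e1]
  exact (integral_pick (hw0 ω) (hwp ω) fun i => ∑ t, Q.mdp.P (s i) (a i) t * f ω i t).symm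

end Tape

/-! ### Measurability and adaptedness of the iterates -/

section Iterates

variable {S A d m : ℕ} {φ : Fin S → Fin d → ℝ} {core : Fin m ↪ Fin S}

theorem measurable_dotProduct_const {Ω : Type*} [MeasurableSpace Ω] {θ : Ω → Fin d → ℝ}
    (hθ : Measurable θ) (v : Fin d → ℝ) : Measurable fun ω => v ⬝ᵥ θ ω := by
  unfold dotProduct
  fun_prop

theorem measurable_estTheta [NeZero A] (γ : ℝ) (s0 : Fin S) (h : ℕ)
    {lam : Tape S A → Fin (m + 1) → Fin A → ℝ} (hl : Measurable lam) :
    Measurable fun ω => estTheta γ φ core s0 ω h (lam ω) := by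
  unfold estTheta
  have hl' : ∀ i a, Measurable fun ω => lam ω i a := fun i a =>
    (measurable_pi_apply a).comp ((measurable_pi_apply i).comp hl)
  refine measurable_pick (f := fun ω (p : Fin (m + 1) ×ₗ Fin A) => φ s0 +
    (∑ i, ∑ a, |lam ω i a|) • (γ • φ (ω.1 (h * callsPerGradient A m) (plus core s0 (ofLex p).1)
      (ofLex p).2).1 - φ (plus core s0 (ofLex p).1)))
    (fun q => hl' _ _) (measurable_draw h) fun p => ?_
  refine measurable_apply_finite (f := fun ω t => φ s0 +
    (∑ i, ∑ a, |lam ω i a|) • (γ • φ t - φ (plus core s0 (ofLex p).1)))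
    (measurable_call _ _ _).fst fun t => ?_
  refine measurable_pi_iff.2 fun k => ?_
  simp only [Pi.add_apply, Pi.smul_apply, smul_eq_mul]
  exact measurable_const.add ((Finset.measurable_sum _ fun i _ => Finset.measurable_sum _ fun a _ =>
    continuous_abs.measurable.comp (hl' i a)).mul measurable_const)

theorem measurable_estLam (γ : ℝ) (s0 : Fin S) (h : ℕ) {θ : Tape S A → Fin d → ℝ}
    (hθ : Measurable θ) : Measurable fun ω => estLam γ φ core s0 ω h (θ ω) := by
  refine measurable_pi_iff.2 fun i => measurable_pi_iff.2 fun a => ?_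
  unfold estLam
  refine (measurable_call _ _ _).snd.add ?_
  exact measurable_apply_finite (f := fun ω t => (γ • φ t - φ (plus core s0 i)) ⬝ᵥ θ ω)
    (measurable_call _ _ _).fst fun t => measurable_dotProduct_const hθ _

theorem measurable_coreNorm {Ω : Type*} [MeasurableSpace Ω] {θ : Ω → Fin d → ℝ}
    (hθ : Measurable θ) : Measurable fun ω => coreNorm φ core (θ ω) := by
  unfold coreNorm
  exact (Finset.measurable_sum _ fun i _ => (measurable_dotProduct_const hθ _).pow_const 2).sqrt

theorem measurable_linTheta {Ω : Type*} [MeasurableSpace Ω] (B η : ℝ) {θ ξ : Ω → Fin d → ℝ}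
    (hθ : Measurable θ) (hξ : Measurable ξ) :
    Measurable fun ω => linTheta φ core B η (θ ω) (ξ ω) := by
  have h1 : Measurable fun ω => θ ω - (η * B ^ 2) • (ginv (corePhi φ core) *ᵥ ξ ω) := by
    refine measurable_pi_iff.2 fun k => ?_
    exact ((measurable_pi_apply k).comp hθ).sub ((measurable_dotProduct_const hξ _).const_mul _)
  unfold linTheta
  refine measurable_pi_iff.2 fun k => ?_
  exact (measurable_const.max ((measurable_coreNorm h1).div_const B)).inv.mul
    ((measurable_pi_apply k).comp h1)

theorem measurable_proxLam {Ω : Type*} [MeasurableSpace Ω] (γ η : ℝ)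
    {lam ρ : Ω → Fin (m + 1) → Fin A → ℝ} (hl : Measurable lam) (hρ : Measurable ρ) :
    Measurable fun ω => proxLam γ η (lam ω) (ρ ω) := by
  have hl' : ∀ i a, Measurable fun ω => lam ω i a := fun i a =>
    (measurable_pi_apply a).comp ((measurable_pi_apply i).comp hl)
  have hρ' : ∀ i a, Measurable fun ω => ρ ω i a := fun i a =>
    (measurable_pi_apply a).comp ((measurable_pi_apply i).comp hρ)
  refine measurable_pi_iff.2 fun i => measurable_pi_iff.2 fun a => ?_
  unfold proxLam
  by_cases hi : i = 0
  · simp only [hi, if_true]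
    fun_prop
  · simp only [hi, if_false]
    fun_prop

theorem measurable_linStep [NeZero A] (γ B η : ℝ) (s0 : Fin S) (h : ℕ)
    {z y : Tape S A → (Fin d → ℝ) × (Fin (m + 1) → Fin A → ℝ)} (hz : Measurable z)
    (hy : Measurable y) : Measurable fun ω => linStep γ φ core B η s0 ω h (z ω) (y ω) :=
  (measurable_linTheta B η hz.fst (measurable_estTheta γ s0 h hy.snd)).prodMk
    (measurable_proxLam γ η hz.snd (measurable_estLam γ s0 h hy.fst))

theorem measurable_linIter [NeZero A] (γ B η : ℝ) (s0 : Fin S) (τ : ℕ) :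
    Measurable fun ω : Tape S A => linIter γ φ core B η s0 ω τ := by
  induction τ with
  | zero => exact measurable_const
  | succ τ ih => exact measurable_linStep γ B η s0 _ ih (measurable_linStep γ B η s0 _ ih ih)

/-- The tapes agree in the part that is read by the first `k` pairs of gradient estimates. -/
def AgreeBelow (m k : ℕ) (ω ω' : Tape S A) : Prop :=
  (∀ n < k * callsPerGradient A m, ω.1 n = ω'.1 n) ∧ ∀ n < k, ω.2 n = ω'.2 n

theorem AgreeBelow.mono {k l : ℕ} (hkl : k ≤ l) {ω ω' : Tape S A} (h : AgreeBelow m l ω ω') :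
    AgreeBelow m k ω ω' :=
  ⟨fun n hn => h.1 n (hn.trans_le (Nat.mul_le_mul_right _ hkl)), fun n hn => h.2 n (hn.trans_le hkl)⟩

theorem callIndex_lt (h : ℕ) (i : Fin (m + 1)) (a : Fin A) :
    h * callsPerGradient A m + 1 + i * A + a < (h + 1) * callsPerGradient A m := by
  have h1 : (i : ℕ) * A + a < (m + 1) * A := by
    calc (i : ℕ) * A + a < i * A + A := Nat.add_lt_add_left a.2 _
      _ = (i + 1) * A := by ring
      _ ≤ _ := Nat.mul_le_mul_right _ i.2
  rw [add_mul, one_mul]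
  simp only [callsPerGradient] at *
  have : (1 + m) * A = (m + 1) * A := by ring
  omega

/-- Adaptedness of one step: apart from its two points, it reads only the draw and the block of
calls with number `h`. -/
theorem linStep_congr [NeZero A] (γ B η : ℝ) (s0 : Fin S) {h : ℕ} {ω ω' : Tape S A}
    (hω : AgreeBelow m (h + 1) ω ω') (z y : (Fin d → ℝ) × (Fin (m + 1) → Fin A → ℝ)) :
    linStep γ φ core B η s0 ω h z y = linStep γ φ core B η s0 ω' h z y := by
  have e1 : ω.2 h = ω'.2 h := hω.2 h (Nat.lt_succ_self h)
  have e2 : ω.1 (h * callsPerGradient A m) = ω'.1 (h * callsPerGradient A m) := by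
    refine hω.1 _ ?_
    rw [add_mul, one_mul, callsPerGradient]
    omega
  have e3 : ∀ (i : Fin (m + 1)) (a : Fin A), ω.1 (h * callsPerGradient A m + 1 + i * A + a) =
      ω'.1 (h * callsPerGradient A m + 1 + i * A + a) := fun i a => hω.1 _ (callIndex_lt h i a)
  have e4 : estLam γ φ core s0 ω h y.1 = estLam γ φ core s0 ω' h y.1 := by
    funext i a
    simp only [estLam, e3]
  simp only [linStep, estTheta, e1, e2, e4]

theorem linIter_congr [NeZero A] (γ B η : ℝ) (s0 : Fin S) {τ : ℕ} {ω ω' : Tape S A}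
    (hω : AgreeBelow m (2 * τ) ω ω') :
    linIter γ φ core B η s0 ω τ = linIter γ φ core B η s0 ω' τ := by
  induction τ with
  | zero => rfl
  | succ τ ih =>
    have h1 := ih (hω.mono (by omega))
    simp only [linIter, h1]
    rw [linStep_congr γ B η s0 (hω.mono (by omega)), linStep_congr γ B η s0 (hω.mono (by omega))]

theorem agreeBelow_setCall {k n : ℕ} (hn : k * callsPerGradient A m ≤ n)
    (p : Tape S A × (Fin S → Fin A → Fin S × ℝ)) : AgreeBelow m k (setCall n p) p.1 :=
  ⟨fun i hi => Function.update_of_ne (by omega) _ _, fun _ _ => rfl⟩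

theorem agreeBelow_setDraw {k n : ℕ} (hn : k ≤ n) (p : Tape S A × unitInterval) :
    AgreeBelow m k (setDraw n p) p.1 :=
  ⟨fun _ _ => rfl, fun i hi => Function.update_of_ne (by omega) _ _⟩

/-- The extrapolated points. -/
def extra [NeZero A] (γ : ℝ) (φ : Fin S → Fin d → ℝ) (core : Fin m ↪ Fin S) (B η : ℝ)
    (s0 : Fin S) (ω : Tape S A) (τ : ℕ) : (Fin d → ℝ) × (Fin (m + 1) → Fin A → ℝ) :=
  linStep γ φ core B η s0 ω (2 * τ) (linIter γ φ core B η s0 ω τ) (linIter γ φ core B η s0 ω τ)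

theorem measurable_extra [NeZero A] (γ B η : ℝ) (s0 : Fin S) (τ : ℕ) :
    Measurable fun ω : Tape S A => extra γ φ core B η s0 ω τ :=
  measurable_linStep γ B η s0 _ (measurable_linIter γ B η s0 τ) (measurable_linIter γ B η s0 τ)

/-- The extrapolated point is determined by the pairs of estimates up to number 2τ, while the
estimates evaluated at it have number 2τ + 1. This independence is the source of unbiasedness. -/
theorem extra_congr [NeZero A] (γ B η : ℝ) (s0 : Fin S) {τ : ℕ} {ω ω' : Tape S A}
    (hω : AgreeBelow m (2 * τ + 1) ω ω') :
    extra γ φ core B η s0 ω τ = extra γ φ core B η s0 ω' τ := by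
  rw [extra, extra, linIter_congr γ B η s0 (hω.mono (by omega)), linStep_congr γ B η s0 hω]

theorem inDom_linIter [NeZero A] {γ : ℝ} (hm : 0 < m) (h0 : 0 ≤ γ) (h1 : γ < 1) (B η : ℝ)
    (s0 : Fin S) (ω : Tape S A) (τ : ℕ) : InDom γ (linIter γ φ core B η s0 ω τ).2 := by
  induction τ with
  | zero => exact inDom_start d hm h0 h1
  | succ τ ih => exact ih.proxLam _ _

theorem norm_linIter_le [NeZero A] (γ : ℝ) {B : ℝ} (hB : 0 < B) (η : ℝ) (s0 : Fin S) (ω : Tape S A)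
    (τ : ℕ) : ‖coreVec φ core (linIter γ φ core B η s0 ω τ).1‖ ≤ B := by
  cases τ with
  | zero =>
    have : coreVec φ core (0 : Fin d → ℝ) = 0 := by simp [coreVec]
    change ‖coreVec φ core 0‖ ≤ B
    rw [this, norm_zero]
    exact hB.le
  | succ τ => exact norm_coreVec_linTheta_le φ core hB _ _ _

end Iterates

/-! ### The expected gap -/

section Gap

variable {S A d m : ℕ} [NeZero A]

/-- The Lagrangian of the planning problem: `x` is a value function and `lam` the dual variable. -/
def lagrange (M : MDP S A) (core : Fin m ↪ Fin S) (s0 : Fin S) (x : Fin S → ℝ)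
    (lam : Fin (m + 1) → Fin A → ℝ) : ℝ :=
  x s0 + ∑ i, ∑ a, M.adv x (plus core s0 i) a * lam i a

/-- The Lagrangian at the dual vertex given by the actions `a0` and `(j, a)`. -/
def lagrangeVertex (M : MDP S A) (core : Fin m ↪ Fin S) (s0 : Fin S) (x : Fin S → ℝ)
    (a0 : Fin A) (j : Fin m) (a : Fin A) : ℝ :=
  x s0 + M.adv x s0 a0 + M.γ / (1 - M.γ) * M.adv x (core j) a

theorem sum_lex {ι κ : Type*} [Fintype ι] [Fintype κ] (f : ι → κ → ℝ) :
    ∑ q : ι ×ₗ κ, f (ofLex q).1 (ofLex q).2 = ∑ i, ∑ k, f i k := by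
  rw [← Fintype.sum_prod_type' f]
  exact Equiv.sum_comp (ofLex : ι ×ₗ κ ≃ ι × κ) fun p => f p.1 p.2

variable {Q : Problem S A d m} {Z : Matrix (Fin S) (Fin m) ℝ}

/-- Sampling from λ/‖λ‖₁ and rescaling by ‖λ‖₁ = 1/(1-γ) gives D(s₀) + Σ λ (γ P D - D) in the mean,
where D is the difference of the two value functions. This is the difference of two Lagrangians with
the same λ, the rewards cancelling. -/
theorem eqInt_estTheta (hQ : Q.Assumptions) (hm : 0 < m)
    (hZ : ∀ s, Q.φ s = ∑ i, Z s i • Q.φ (Q.core i)) (hZ0 : ∀ s i, 0 ≤ Z s i)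
    (hZ1 : ∀ s, ∑ i, Z s i = 1) {B : ℝ} (hB : 0 < B) (η : ℝ) (s0 : Fin S) (τ : ℕ)
    (u : Fin d → ℝ) :
    EqInt Q.tapeLaw
      (fun ω => estTheta Q.mdp.γ Q.φ Q.core s0 ω (2 * τ + 1)
        (extra Q.mdp.γ Q.φ Q.core B η s0 ω τ).2 ⬝ᵥ ((extra Q.mdp.γ Q.φ Q.core B η s0 ω τ).1 - u))
      (fun ω => lagrange Q.mdp Q.core s0
          (fun s => Q.φ s ⬝ᵥ (extra Q.mdp.γ Q.φ Q.core B η s0 ω τ).1)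
          (extra Q.mdp.γ Q.φ Q.core B η s0 ω τ).2 -
        lagrange Q.mdp Q.core s0 (fun s => Q.φ s ⬝ᵥ u)
          (extra Q.mdp.γ Q.φ Q.core B η s0 ω τ).2) := by
  have hγ0 := Q.mdp.γ_nonneg
  have hγ1 := Q.mdp.γ_lt_one
  have h1' := Q.mdp.one_sub_pos
  set γ := Q.mdp.γ with hγ
  set Y := fun ω : Tape S A => extra γ Q.φ Q.core B η s0 ω τ with hY
  have hYm : Measurable Y := measurable_extra γ B η s0 τ
  have hYd : ∀ ω : Tape S A, InDom γ (Y ω).2 := fun ω => (inDom_linIter hm hγ0 hγ1 B η s0 ω τ).proxLam _ _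
  have hYn : ∀ ω, ‖coreVec Q.φ Q.core (Y ω).1‖ ≤ B := fun ω => norm_coreVec_linTheta_le _ _ hB _ _ _
  set D : Tape S A → Fin S → ℝ := fun ω s => Q.φ s ⬝ᵥ ((Y ω).1 - u) with hD
  have hDm : ∀ s, Measurable fun ω => D ω s := fun s =>
    measurable_dotProduct_const (hYm.fst.sub measurable_const) _
  have hDb : ∀ ω s, |D ω s| ≤ B + ‖coreVec Q.φ Q.core u‖ := fun ω s =>
    (abs_feature_le hZ hZ0 hZ1 s _).trans (by
      rw [coreVec_sub]; exact (norm_sub_le _ _).trans (add_le_add (hYn ω) le_rfl))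
  set b := B + ‖coreVec Q.φ Q.core u‖ with hb
  have hb0 : 0 ≤ b := by positivity
  have hsum : ∀ ω, ∑ q : Fin (m + 1) ×ₗ Fin A, (Y ω).2 (ofLex q).1 (ofLex q).2 = 1 / (1 - γ) :=
    fun ω => by rw [sum_lex (Y ω).2, (hYd ω).sum hγ1]
  have key := hQ.integral_pick_next ((2 * τ + 1) * callsPerGradient A m) (2 * τ + 1)
    (fun q : Fin (m + 1) ×ₗ Fin A => plus Q.core s0 (ofLex q).1) (fun q => (ofLex q).2)
    (w := fun ω q => (Y ω).2 (ofLex q).1 (ofLex q).2)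
    -- The deterministic term of s₀ is included, so that the whole inner product is a function of
    -- the picked pair and its successor.
    (f := fun ω q t => D ω s0 + 1 / (1 - γ) * (γ * D ω t - D ω (plus Q.core s0 (ofLex q).1)))
    (b := b + 1 / (1 - γ) * (b + b))
    (fun q => (measurable_pi_apply _).comp ((measurable_pi_apply _).comp hYm.snd))
    (fun q t => (hDm s0).add ((((hDm t).const_mul γ).sub (hDm _)).const_mul _))
    (fun ω q t => by
      refine (abs_add_le _ _).trans (add_le_add (hDb ω s0) ?_)
      rw [abs_mul, abs_of_pos (one_div_pos.2 h1')]
      refine mul_le_mul_of_nonneg_left ((abs_sub _ _).trans (add_le_add ?_ (hDb _ _)))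
        (one_div_pos.2 h1').le
      rw [abs_mul, abs_of_nonneg hγ0]
      exact (mul_le_of_le_one_left (abs_nonneg _) hγ1.le).trans (hDb _ _))
    (fun ω q => (hYd ω).nonneg _ _)
    (fun ω => by rw [hsum]; exact one_div_pos.2 h1')
    (fun p => by
      have : Y (setCall _ p) = Y p.1 := extra_congr γ B η s0 (agreeBelow_setCall le_rfl p)
      simp only [this])
    (fun p => by
      have : Y (setCall _ p) = Y p.1 := extra_congr γ B η s0 (agreeBelow_setCall le_rfl p)
      simp only [hD, this])
    (fun p => by
      have : Y (setDraw _ p) = Y p.1 := extra_congr γ B η s0 (agreeBelow_setDraw le_rfl p)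
      simp only [this])
    (fun p => by
      have : Y (setDraw _ p) = Y p.1 := extra_congr γ B η s0 (agreeBelow_setDraw le_rfl p)
      simp only [hD, this])
  convert key using 1
  · funext ω
    simp only [estTheta]
    rw [show (∑ i, ∑ a, |(extra γ Q.φ Q.core B η s0 ω τ).2 i a|) = 1 / (1 - γ) from (hYd ω).sum_abs hγ1,
      add_dotProduct, smul_dotProduct, sub_dotProduct, smul_dotProduct]
    rfl
  · funext ω
    change lagrange Q.mdp Q.core s0 (fun s => Q.φ s ⬝ᵥ (Y ω).1) (Y ω).2 -
      lagrange Q.mdp Q.core s0 (fun s => Q.φ s ⬝ᵥ u) (Y ω).2 = _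
    simp only [hsum]
    have e1 : ∀ (s : Fin S) (a : Fin A), Q.mdp.adv (fun s => Q.φ s ⬝ᵥ (Y ω).1) s a -
        Q.mdp.adv (fun s => Q.φ s ⬝ᵥ u) s a = γ * ∑ t, Q.mdp.P s a t * D ω t - D ω s := fun s a => by
      simp only [MDP.adv, MDP.look, hD, dotProduct_sub, mul_sub, Finset.sum_sub_distrib]
      ring
    have e2 : ∀ (s : Fin S) (a : Fin A), ∑ t, Q.mdp.P s a t * (D ω s0 + 1 / (1 - γ) *
        (γ * D ω t - D ω s)) = D ω s0 + 1 / (1 - γ) * (γ * ∑ t, Q.mdp.P s a t * D ω t - D ω s) :=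
      fun s a => by
        have h3 : ∀ t, Q.mdp.P s a t * (D ω s0 + 1 / (1 - γ) * (γ * D ω t - D ω s)) =
            Q.mdp.P s a t * (D ω s0 - 1 / (1 - γ) * D ω s) +
              1 / (1 - γ) * γ * (Q.mdp.P s a t * D ω t) := fun t => by ring
        simp only [h3, Finset.sum_add_distrib, ← Finset.sum_mul, ← Finset.mul_sum, Q.mdp.P_sum]
        ring
    simp only [e2, ← e1]
    have e3 := sum_lex (fun i a => (Y ω).2 i a / (1 / (1 - γ)) * (D ω s0 + 1 / (1 - γ) *
      (Q.mdp.adv (fun s => Q.φ s ⬝ᵥ (Y ω).1) (plus Q.core s0 i) a -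
        Q.mdp.adv (fun s => Q.φ s ⬝ᵥ u) (plus Q.core s0 i) a)))
    rw [e3]
    have e4 : ∀ i a, (Y ω).2 i a / (1 / (1 - γ)) * (D ω s0 + 1 / (1 - γ) *
        (Q.mdp.adv (fun s => Q.φ s ⬝ᵥ (Y ω).1) (plus Q.core s0 i) a -
          Q.mdp.adv (fun s => Q.φ s ⬝ᵥ u) (plus Q.core s0 i) a)) =
        (Y ω).2 i a * ((1 - γ) * D ω s0) +
          (Q.mdp.adv (fun s => Q.φ s ⬝ᵥ (Y ω).1) (plus Q.core s0 i) a * (Y ω).2 i a -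
            Q.mdp.adv (fun s => Q.φ s ⬝ᵥ u) (plus Q.core s0 i) a * (Y ω).2 i a) := fun i a => by
      field_simp
    simp only [e4, Finset.sum_add_distrib, Finset.sum_sub_distrib, ← Finset.sum_mul, (hYd ω).sum hγ1]
    have e5 : 1 / (1 - γ) * ((1 - γ) * D ω s0) = D ω s0 := by field_simp
    rw [e5]
    simp only [lagrange, hD, dotProduct_sub]
    ring

/-- The factor `y` may be any bounded quantity fixed before the estimate: a coordinate of the
extrapolated λ gives the terms of the algorithm, and the constant 1 gives those of the comparator.
-/
theorem eqInt_estLam (hQ : Q.Assumptions)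
    (hZ : ∀ s, Q.φ s = ∑ i, Z s i • Q.φ (Q.core i)) (hZ0 : ∀ s i, 0 ≤ Z s i)
    (hZ1 : ∀ s, ∑ i, Z s i = 1) {B : ℝ} (hB : 0 < B) (η : ℝ) (s0 : Fin S) (τ : ℕ)
    (i : Fin (m + 1)) (b : Fin A) {y : Tape S A → ℝ} {c : ℝ} (hy : Measurable y)
    (hyc : ∀ ω, |y ω| ≤ c) (hya : ∀ ω ω', AgreeBelow m (2 * τ + 1) ω ω' → y ω = y ω') :
    EqInt Q.tapeLaw
      (fun ω => estLam Q.mdp.γ Q.φ Q.core s0 ω (2 * τ + 1)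
        (extra Q.mdp.γ Q.φ Q.core B η s0 ω τ).1 i b * y ω)
      (fun ω => Q.mdp.adv (fun s => Q.φ s ⬝ᵥ (extra Q.mdp.γ Q.φ Q.core B η s0 ω τ).1)
        (plus Q.core s0 i) b * y ω) := by
  set γ := Q.mdp.γ with hγ
  set Y := fun ω : Tape S A => extra γ Q.φ Q.core B η s0 ω τ with hY
  have hYm : Measurable Y := measurable_extra γ B η s0 τ
  have hle : (2 * τ + 1) * callsPerGradient A m ≤
      (2 * τ + 1) * callsPerGradient A m + 1 + i * A + b := by omega
  have key := hQ.integral_advantage ((2 * τ + 1) * callsPerGradient A m + 1 + i * A + b)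
    (plus Q.core s0 i) b (x := fun ω s => Q.φ s ⬝ᵥ (Y ω).1) (b := B)
    (fun t => measurable_dotProduct_const hYm.fst _) hy
    (fun ω t => (abs_feature_le hZ hZ0 hZ1 t _).trans (norm_coreVec_linTheta_le _ _ hB _ _ _)) hyc
    (fun p => by
      have : Y (setCall _ p) = Y p.1 := extra_congr γ B η s0 (agreeBelow_setCall hle p)
      simp only [this])
    (fun p => hya _ _ (agreeBelow_setCall hle p))
  convert key using 1
  funext ω
  simp only [estLam, sub_dotProduct, smul_dotProduct, smul_eq_mul]
  rfl

/-- The expectation of the sampled gap is the gap between the Lagrangian at the dual comparator and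
the Lagrangian at the primal comparator. -/
theorem eqInt_sampledGap (hQ : Q.Assumptions) (hm : 0 < m)
    (hZ : ∀ s, Q.φ s = ∑ i, Z s i • Q.φ (Q.core i)) (hZ0 : ∀ s i, 0 ≤ Z s i)
    (hZ1 : ∀ s, ∑ i, Z s i = 1) {B : ℝ} (hB : 0 < B) (η : ℝ) (s0 : Fin S) (τ : ℕ)
    (u : Fin d → ℝ) (a0 : Fin A) (j : Fin m) (a : Fin A) :
    EqInt Q.tapeLaw
      (fun ω => sampledGap Q.mdp.γ Q.φ Q.core s0 ω (2 * τ + 1) u a0 j a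
        (fun i b => Q.mdp.adv (fun s => Q.φ s ⬝ᵥ u) (plus Q.core s0 i) b)
        (extra Q.mdp.γ Q.φ Q.core B η s0 ω τ) (linIter Q.mdp.γ Q.φ Q.core B η s0 ω (τ + 1)))
      (fun ω => lagrangeVertex Q.mdp Q.core s0
          (fun s => Q.φ s ⬝ᵥ (extra Q.mdp.γ Q.φ Q.core B η s0 ω τ).1) a0 j a -
        lagrange Q.mdp Q.core s0 (fun s => Q.φ s ⬝ᵥ u)
          (linIter Q.mdp.γ Q.φ Q.core B η s0 ω (τ + 1)).2) := by
  have hγ0 := Q.mdp.γ_nonneg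
  have hγ1 := Q.mdp.γ_lt_one
  have h1' := Q.mdp.one_sub_pos
  have hle : ∀ {lam : Fin (m + 1) → Fin A → ℝ}, InDom Q.mdp.γ lam → ∀ i b,
      |lam i b| ≤ 1 / (1 - Q.mdp.γ) := fun {lam} hl i b => by
    rw [abs_of_nonneg (hl.nonneg i b), ← hl.sum hγ1]
    exact (Finset.single_le_sum (fun b _ => hl.nonneg i b) (Finset.mem_univ b)).trans
      (Finset.single_le_sum (f := fun i => ∑ b, lam i b)
        (fun i _ => Finset.sum_nonneg fun b _ => hl.nonneg i b) (Finset.mem_univ i))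
  have hYm := measurable_extra (A := A) (φ := Q.φ) (core := Q.core) Q.mdp.γ B η s0 τ
  have hYd : ∀ ω : Tape S A, InDom Q.mdp.γ (extra Q.mdp.γ Q.φ Q.core B η s0 ω τ).2 := fun ω =>
    (inDom_linIter hm hγ0 hγ1 B η s0 ω τ).proxLam _ _
  have hZm := measurable_linIter (A := A) (φ := Q.φ) (core := Q.core) Q.mdp.γ B η s0 (τ + 1)
  have hZd : ∀ ω : Tape S A, InDom Q.mdp.γ (linIter Q.mdp.γ Q.φ Q.core B η s0 ω (τ + 1)).2 := fun ω =>
    inDom_linIter hm hγ0 hγ1 B η s0 ω (τ + 1)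
  have t1 := eqInt_estTheta hQ hm hZ hZ0 hZ1 hB η s0 τ u
  have t2 := eqInt_estLam hQ hZ hZ0 hZ1 hB η s0 τ 0 a0 (y := fun _ => 1) (c := 1) measurable_const
    (fun _ => by simp) (fun _ _ _ => rfl)
  have t3 := (eqInt_estLam hQ hZ hZ0 hZ1 hB η s0 τ j.succ a (y := fun _ => 1) (c := 1)
    measurable_const (fun _ => by simp) (fun _ _ _ => rfl)).const_mul (Q.mdp.γ / (1 - Q.mdp.γ))
  have t4 := EqInt.sum fun i (_ : i ∈ Finset.univ) => EqInt.sum fun b (_ : b ∈ Finset.univ) =>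
    eqInt_estLam hQ hZ hZ0 hZ1 hB η s0 τ i b
      (y := fun ω : Tape S A => (extra Q.mdp.γ Q.φ Q.core B η s0 ω τ).2 i b)
      ((measurable_pi_apply b).comp ((measurable_pi_apply i).comp hYm.snd))
      (fun ω => hle (hYd ω) i b) (fun (ω ω' : Tape S A) h => by simp only [extra_congr Q.mdp.γ B η s0 h])
  -- The new iterate depends on the very estimates of this step, so its correction carries the
  -- deterministic gradient at `u`. Nothing is resampled here.
  have t5 := EqInt.sum (μ := Q.tapeLaw) fun i (_ : i ∈ Finset.univ) =>
    EqInt.sum fun b (_ : b ∈ Finset.univ) => EqInt.const_mul (EqInt.refl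
      (F := fun ω : Tape S A => (extra Q.mdp.γ Q.φ Q.core B η s0 ω τ).2 i b -
        (linIter Q.mdp.γ Q.φ Q.core B η s0 ω (τ + 1)).2 i b) (Integrable.sub
        (Integrable.of_bound ((measurable_pi_apply b).comp
          ((measurable_pi_apply i).comp hYm.snd)).aestronglyMeasurable (1 / (1 - Q.mdp.γ))
          (ae_of_all _ fun ω => hle (hYd ω) i b))
        (Integrable.of_bound ((measurable_pi_apply b).comp
          ((measurable_pi_apply i).comp hZm.snd)).aestronglyMeasurable (1 / (1 - Q.mdp.γ))
          (ae_of_all _ fun ω => hle (hZd ω) i b))))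
        (Q.mdp.adv (fun s => Q.φ s ⬝ᵥ u) (plus Q.core s0 i) b)
  -- With (x, λ) the extrapolated point, λ' the new weights and V(x) the value at the comparator
  -- vertex, the parts are L(x, λ) - L(u, λ), V(x) - L(x, λ) and L(u, λ) - L(u, λ'). They telescope
  -- to V(x) - L(u, λ').
  convert (t1.add ((t2.add t3).sub t4)).add t5 using 1
  · funext ω
    simp only [sampledGap, mul_one]
  · funext ω
    simp only [lagrangeVertex, lagrange, mul_one, mul_sub, Finset.sum_sub_distrib]
    simp only [plus, Fin.cons_zero, Fin.cons_succ]
    ring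

end Gap

/-! ## The suboptimality of the planner -/

section Saddle

variable {S A d m : ℕ}

theorem abs_adv_le (M : MDP S A) (hr : ∀ s a, |M.r s a| ≤ 1) {x : Fin S → ℝ} {b : ℝ}
    (hx : ∀ t, |x t| ≤ b) (s : Fin S) (a : Fin A) : |M.adv x s a| ≤ 1 + 2 * b := by
  have h1 := abs_le.1 (abs_sum_weight_le (M.P_nonneg s a) (M.P_sum s a) hx)
  have h2 := abs_le.1 (hr s a)
  have h3 := abs_le.1 (hx s)
  have h4 := M.γ_nonneg
  have h5 := M.γ_lt_one
  have hb : 0 ≤ b := (abs_nonneg _).trans (hx s)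
  simp only [MDP.adv, MDP.look]
  rw [abs_le]
  constructor <;> nlinarith

variable [NeZero A] (M : MDP S A) (core : Fin m ↪ Fin S) {Z : Matrix (Fin S) (Fin m) ℝ}

/-- The dual value of a function in the span of the features dominates the optimal value. -/
theorem exists_optValue_le_lagrangeVertex (hm : 0 < m) (hZ0 : ∀ s i, 0 ≤ Z s i)
    (hZ1 : ∀ s, ∑ i, Z s i = 1) {x w : Fin S → ℝ} (hx : ∀ s, x s = ∑ i, Z s i * x (core i))
    (hw : ∀ s, w s = ∑ i, Z s i * w (core i)) {e : ℝ} (he : ∀ s, |M.optValue s - w s| ≤ e)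
    (s0 : Fin S) : ∃ a0 j a,
      M.optValue s0 ≤ lagrangeVertex M core s0 x a0 j a + 2 * M.γ * e / (1 - M.γ) := by
  have : Nonempty (Fin m) := ⟨⟨0, hm⟩⟩
  obtain ⟨a0, ha0⟩ := Finite.exists_max (M.look x s0)
  obtain ⟨⟨j, a⟩, hja⟩ := Finite.exists_max fun p : Fin m × Fin A => M.adv x (core p.1) p.2
  refine ⟨a0, j, a, ?_⟩
  obtain ⟨hV1, hV2⟩ := M.optValue_bellman
  set V := M.optValue
  set κ := M.adv x (core j) a with hκ
  -- At any state V is exchanged for w at cost e, w - x is averaged over core states, and there w is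
  -- exchanged back for V at cost e. At a core state Bellman's equation for V and the maximal
  -- advantage κ of x give V - x ≤ γb + κ. Advantages of x at other states play no role.
  have hD := le_div_of_discounted (c := κ + 2 * e) M.γ_lt_one (x := fun s => V s - x s)
    (fun b hb s => by
      have h1 : ∑ i, Z s i * (w (core i) - x (core i)) ≤ e + κ + M.γ * b := by
        refine sum_weight_le (hZ0 s) (hZ1 s) fun i => ?_
        obtain ⟨a', ha'⟩ := hV2 (core i)
        have h2 := M.look_sub_le hb (core i) a'
        have h3 : M.adv x (core i) a' ≤ κ := hja (i, a')
        have h4 := abs_le.1 (he (core i))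
        simp only [MDP.adv] at h3
        linarith
      have h5 := abs_le.1 (he s)
      simp only [mul_sub, Finset.sum_sub_distrib, ← hw, ← hx] at h1
      linarith)
  obtain ⟨a', ha'⟩ := hV2 s0
  have h2 := M.look_sub_le hD s0 a'
  have h3 := ha0 a'
  have h6 : M.γ * ((κ + 2 * e) / (1 - M.γ)) = M.γ / (1 - M.γ) * κ + 2 * M.γ * e / (1 - M.γ) := by ring
  rw [h6] at h2
  rw [lagrangeVertex, ← hκ]
  simp only [MDP.adv]
  linarith

/-- The primal value at an approximation of the optimal value function. -/
theorem lagrange_le {lam : Fin (m + 1) → Fin A → ℝ} (hl : ∀ i a, 0 ≤ lam i a)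
    (hl0 : ∑ a, lam 0 a = 1) (hl1 : ∑ i, ∑ a, lam i a = 1 / (1 - M.γ)) {w : Fin S → ℝ} {e : ℝ}
    (he : ∀ s, |M.optValue s - w s| ≤ e) (s0 : Fin S) :
    lagrange M core s0 w lam ≤ ∑ a, lam 0 a * M.look M.optValue s0 a + 3 * e / (1 - M.γ) := by
  have h1' := M.one_sub_pos
  obtain ⟨hV1, hV2⟩ := M.optValue_bellman
  set V := M.optValue
  have he0 : 0 ≤ e := (abs_nonneg _).trans (he s0)
  have h1 : ∀ s a, M.adv w s a ≤ M.adv V s a + 2 * e := fun s a => by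
    have h2 := abs_le.1 (M.abs_look_sub_le he s a)
    have h3 := abs_le.1 (he s)
    have h4 : M.γ * e ≤ e := mul_le_of_le_one_left he0 M.γ_lt_one.le
    simp only [MDP.adv]
    linarith
  have h2 : ∑ i, ∑ a, M.adv w (plus core s0 i) a * lam i a ≤
      ∑ i, ∑ a, M.adv V (plus core s0 i) a * lam i a + 2 * e * (1 / (1 - M.γ)) := by
    rw [← hl1, Finset.mul_sum, ← Finset.sum_add_distrib]
    refine Finset.sum_le_sum fun i _ => ?_
    rw [Finset.mul_sum, ← Finset.sum_add_distrib]
    refine Finset.sum_le_sum fun a _ => ?_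
    have := mul_le_mul_of_nonneg_right (h1 (plus core s0 i) a) (hl i a)
    linarith
  -- The core block contributes only nonpositive advantages of V and is dropped; what remains is the
  -- one-step lookahead at s₀.
  have h3 : ∑ i, ∑ a, M.adv V (plus core s0 i) a * lam i a ≤
      ∑ a, lam 0 a * M.look V s0 a - V s0 := by
    rw [Fin.sum_univ_succ]
    have h4 : ∑ a, M.adv V (plus core s0 0) a * lam 0 a = ∑ a, lam 0 a * M.look V s0 a - V s0 := by
      simp only [plus, Fin.cons_zero, MDP.adv, sub_mul, Finset.sum_sub_distrib, ← Finset.mul_sum, hl0,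
        mul_one, mul_comm (lam 0 _)]
    have h5 : ∑ i : Fin m, ∑ a, M.adv V (plus core s0 i.succ) a * lam i.succ a ≤ 0 :=
      Finset.sum_nonpos fun i _ => Finset.sum_nonpos fun a _ =>
        mul_nonpos_of_nonpos_of_nonneg (sub_nonpos.2 (hV1 _ _)) (hl _ _)
    linarith
  have h6 := abs_le.1 (he s0)
  have h7 : e ≤ e * (1 / (1 - M.γ)) := by
    refine le_mul_of_one_le_right he0 ?_
    rw [one_le_div h1']
    linarith [M.γ_nonneg]
  rw [lagrange]
  have h8 : 3 * e / (1 - M.γ) = e * (1 / (1 - M.γ)) + 2 * e * (1 / (1 - M.γ)) := by ring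
  linarith

end Saddle

/-! ### Averages over the iterations and the tape -/

section Average

variable {Ω : Type*} [MeasurableSpace Ω] (μ : Measure Ω)

/-- The expected average of `F 0, …, F (T - 1)`. -/
def average (T : ℕ) (F : ℕ → Ω → ℝ) : ℝ := (∑ τ ∈ Finset.range T, ∫ ω, F τ ω ∂μ) / T

variable {μ} {T : ℕ}

/-- Used to move averages inside the Lagrangian, which is affine in each of its arguments. -/
theorem average_affine [IsProbabilityMeasure μ] {ι : Type*} [Fintype ι] (hT : T ≠ 0) (c : ℝ) (k : ι → ℝ) {F : ℕ → Ω → ι → ℝ}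
    (hF : ∀ τ i, Integrable (fun ω => F τ ω i) μ) :
    average μ T (fun τ ω => c + ∑ i, k i * F τ ω i) =
      c + ∑ i, k i * average μ T fun τ ω => F τ ω i := by
  have hT' : (T : ℝ) ≠ 0 := Nat.cast_ne_zero.2 hT
  have h1 : ∀ τ, ∫ ω, (c + ∑ i, k i * F τ ω i) ∂μ = c + ∑ i, k i * ∫ ω, F τ ω i ∂μ := fun τ => by
    rw [integral_add (integrable_const _) (integrable_finsetSum _ fun i _ => (hF τ i).const_mul _),
      integral_finsetSum _ fun i _ => (hF τ i).const_mul _]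
    simp [integral_const_mul]
  simp only [average, h1, Finset.sum_add_distrib, Finset.sum_const, Finset.card_range, nsmul_eq_mul]
  rw [Finset.sum_comm, add_div, mul_div_cancel_left₀ _ hT', Finset.sum_div]
  simp only [← Finset.mul_sum, mul_div_assoc]

theorem average_linear [IsProbabilityMeasure μ] {ι : Type*} [Fintype ι] (hT : T ≠ 0) (k : ι → ℝ) {F : ℕ → Ω → ι → ℝ}
    (hF : ∀ τ i, Integrable (fun ω => F τ ω i) μ) :
    average μ T (fun τ ω => ∑ i, k i * F τ ω i) = ∑ i, k i * average μ T fun τ ω => F τ ω i := by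
  simpa using average_affine hT 0 k hF

theorem average_const [IsProbabilityMeasure μ] (hT : T ≠ 0) (c : ℝ) : average μ T (fun _ _ => c) = c := by
  have hT' : (T : ℝ) ≠ 0 := Nat.cast_ne_zero.2 hT
  simp [average, hT']

theorem average_nonneg {F : ℕ → Ω → ℝ} (h : ∀ τ ω, 0 ≤ F τ ω) : 0 ≤ average μ T F :=
  div_nonneg (Finset.sum_nonneg fun τ _ => integral_nonneg (h τ)) (Nat.cast_nonneg _)

theorem average_sub {F G : ℕ → Ω → ℝ} (hF : ∀ τ, Integrable (F τ) μ) (hG : ∀ τ, Integrable (G τ) μ) :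
    average μ T (fun τ ω => F τ ω - G τ ω) = average μ T F - average μ T G := by
  simp only [average, integral_sub (hF _) (hG _), Finset.sum_sub_distrib, sub_div]

/-- A pathwise bound for the sum bounds the average. -/
theorem average_le [IsProbabilityMeasure μ] {F : ℕ → Ω → ℝ} (hF : ∀ τ, Integrable (F τ) μ) {c : ℝ}
    (h : ∀ᵐ ω ∂μ, ∑ τ ∈ Finset.range T, F τ ω ≤ c) : average μ T F ≤ c / T := by
  rw [average, ← integral_finsetSum _ fun τ _ => hF τ]
  refine div_le_div_of_nonneg_right ?_ (Nat.cast_nonneg _)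
  calc ∫ ω, ∑ τ ∈ Finset.range T, F τ ω ∂μ ≤ ∫ _, c ∂μ :=
        integral_mono_ae (integrable_finsetSum _ fun τ _ => hF τ) (integrable_const _) h
    _ = c := by simp

end Average

section Planner

variable {S A d m : ℕ} {Q : Problem S A d m} {Z : Matrix (Fin S) (Fin m) ℝ}

theorem lagrangeVertex_affine (M : MDP S A) (core : Fin m ↪ Fin S) (s0 : Fin S) (a0 : Fin A)
    (j : Fin m) (a : Fin A) : ∃ (c : ℝ) (k : Fin S → ℝ), ∀ x,
      lagrangeVertex M core s0 x a0 j a = c + ∑ t, k t * x t := by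
  refine ⟨M.r s0 a0 + M.γ / (1 - M.γ) * M.r (core j) a, fun t => M.γ * M.P s0 a0 t +
    M.γ / (1 - M.γ) * (M.γ * M.P (core j) a t - if t = core j then 1 else 0), fun x => ?_⟩
  simp only [lagrangeVertex, MDP.adv, MDP.look, add_mul, Finset.sum_add_distrib, mul_assoc, sub_mul,
    mul_sub, Finset.sum_sub_distrib, ← Finset.mul_sum, ite_mul, one_mul, zero_mul]
  simp
  ring

/-- The sum of the sampled gaps telescopes. -/
theorem sum_sampledGap_le [NeZero A] (hQ : Q.Assumptions) (hm : 0 < m)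
    (hZ : ∀ s, Q.φ s = ∑ i, Z s i • Q.φ (Q.core i)) (hZ0 : ∀ s i, 0 ≤ Z s i)
    (hZ1 : ∀ s, ∑ i, Z s i = 1) {B η : ℝ} (hB : 0 < B) (hη : 0 < η) (hl : 0 < ell A m Q.mdp.γ)
    (s0 : Fin S) {u : Fin d → ℝ} (hu : ‖coreVec Q.φ Q.core u‖ ≤ B) (a0 : Fin A) (j : Fin m) (a : Fin A)
    {ω : Tape S A} (hω : ∀ n s a, |(ω.1 n s a).2| ≤ 1) (T : ℕ) :
    ∑ τ ∈ Finset.range T, sampledGap Q.mdp.γ Q.φ Q.core s0 ω (2 * τ + 1) u a0 j a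
        (fun i b => Q.mdp.adv (fun s => Q.φ s ⬝ᵥ u) (plus Q.core s0 i) b)
        (extra Q.mdp.γ Q.φ Q.core B η s0 ω τ) (linIter Q.mdp.γ Q.φ Q.core B η s0 ω (τ + 1)) ≤
      1 / η + T * (η * (3 / 2 * (B * (3 / (1 - Q.mdp.γ))) ^ 2 +
        32 * ell A m Q.mdp.γ * ((1 + 2 * B) / (1 - Q.mdp.γ)) ^ 2)) := by
  have hγ0 := Q.mdp.γ_nonneg
  have hγ1 := Q.mdp.γ_lt_one
  have h1' := Q.mdp.one_sub_pos
  set γ := Q.mdp.γ with hγ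
  set K := η * (3 / 2 * (B * (3 / (1 - γ))) ^ 2 + 32 * ell A m γ * ((1 + 2 * B) / (1 - γ)) ^ 2)
  set D := fun τ => ‖coreVec Q.φ Q.core ((linIter γ Q.φ Q.core B η s0 ω τ).1 - u)‖ ^ 2 with hD
  set Ψ := fun τ => dualPot γ a0 j a (linIter γ Q.φ Q.core B η s0 ω τ).2 with hΨ
  have hg : ∀ i b, |Q.mdp.adv (fun s => Q.φ s ⬝ᵥ u) (plus Q.core s0 i) b| ≤ 1 + 2 * B := fun i b =>
    abs_adv_le _ hQ.abs_reward_le (fun t => (abs_feature_le hZ hZ0 hZ1 t u).trans hu) _ _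
  have hstep : ∀ τ, sampledGap γ Q.φ Q.core s0 ω (2 * τ + 1) u a0 j a
        (fun i b => Q.mdp.adv (fun s => Q.φ s ⬝ᵥ u) (plus Q.core s0 i) b)
        (extra γ Q.φ Q.core B η s0 ω τ) (linIter γ Q.φ Q.core B η s0 ω (τ + 1)) ≤
      (D τ - D (τ + 1)) / (2 * (η * B ^ 2)) + (Ψ (τ + 1) - Ψ τ) / (2 * ell A m γ / (1 - γ) * η) + K :=
    fun τ => sampledGap_le hZ hZ0 hZ1 hγ0 hγ1 s0 hω hB hη hl (2 * τ) (2 * τ + 1) hu a0 j a hg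
      (norm_linIter_le γ hB η s0 ω τ) (inDom_linIter hm hγ0 hγ1 B η s0 ω τ)
  refine (Finset.sum_le_sum fun τ _ => hstep τ).trans ?_
  simp only [Finset.sum_add_distrib, ← Finset.sum_div, Finset.sum_const, Finset.card_range,
    nsmul_eq_mul]
  rw [Finset.sum_range_sub', Finset.sum_range_sub]
  have hD0 : D 0 ≤ B ^ 2 := by
    simp only [hD]
    refine pow_le_pow_left₀ (norm_nonneg _) ?_ 2
    change ‖coreVec Q.φ Q.core (0 - u)‖ ≤ B
    rw [coreVec_sub]
    have : coreVec Q.φ Q.core (0 : Fin d → ℝ) = 0 := by simp [coreVec]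
    rwa [this, zero_sub, norm_neg]
  have hDT : 0 ≤ D T := sq_nonneg _
  -- The start θ = 0 is within B of the comparator. The primal and the dual regularizer are both
  -- scaled to range 1/2, so each contributes 1/(2η).
  have e1 : (D 0 - D T) / (2 * (η * B ^ 2)) ≤ 1 / (2 * η) := by
    rw [div_le_div_iff₀ (by positivity) (by positivity)]
    nlinarith [mul_le_mul_of_nonneg_left (sub_le_self (D 0) hDT |>.trans hD0) hη.le]
  have e2 : (Ψ T - Ψ 0) / (2 * ell A m γ / (1 - γ) * η) ≤ 1 / (2 * η) := by
    have := dualPot_le (inDom_linIter (φ := Q.φ) (core := Q.core) hm hγ0 hγ1 B η s0 ω T) hγ0 hγ1 d a0 j a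
    calc (Ψ T - Ψ 0) / (2 * ell A m γ / (1 - γ) * η)
        ≤ (ell A m γ / (1 - γ)) / (2 * ell A m γ / (1 - γ) * η) :=
          div_le_div_of_nonneg_right this (by positivity)
      _ = 1 / (2 * η) := by field_simp
  have e3 : 1 / η = 1 / (2 * η) + 1 / (2 * η) := by field_simp; norm_num
  linarith

/-- The policy loss at the planning state for the expected average of the dual iterates. -/
theorem optValue_sub_le [NeZero A] (hQ : Q.Assumptions) (hm : 0 < m)
    (hZ : ∀ s, Q.φ s = ∑ i, Z s i • Q.φ (Q.core i)) (hZ0 : ∀ s i, 0 ≤ Z s i)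
    (hZ1 : ∀ s, ∑ i, Z s i = 1) {B η : ℝ} (hB : 0 < B) (hη : 0 < η) (hl : 0 < ell A m Q.mdp.γ)
    (s0 : Fin S) {u : Fin d → ℝ} (hu : ‖coreVec Q.φ Q.core u‖ ≤ B) {e : ℝ}
    (he : ∀ s, |Q.mdp.optValue s - Q.φ s ⬝ᵥ u| ≤ e) {T : ℕ} (hT : T ≠ 0) :
    Q.mdp.optValue s0 ≤ ∑ a, average Q.tapeLaw T
        (fun τ ω => (linIter Q.mdp.γ Q.φ Q.core B η s0 ω (τ + 1)).2 0 a) *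
          Q.mdp.look Q.mdp.optValue s0 a +
      (1 / (η * T) + η * (3 / 2 * (B * (3 / (1 - Q.mdp.γ))) ^ 2 +
        32 * ell A m Q.mdp.γ * ((1 + 2 * B) / (1 - Q.mdp.γ)) ^ 2) + 5 * e / (1 - Q.mdp.γ)) := by
  have hγ0 := Q.mdp.γ_nonneg
  have hγ1 := Q.mdp.γ_lt_one
  have h1' := Q.mdp.one_sub_pos
  have hT' : (T : ℝ) ≠ 0 := Nat.cast_ne_zero.2 hT
  have he0 : 0 ≤ e := (abs_nonneg _).trans (he s0)
  set γ := Q.mdp.γ with hγ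
  set L : ℕ → Tape S A → Fin (m + 1) × Fin A → ℝ := fun τ ω p =>
    (linIter γ Q.φ Q.core B η s0 ω (τ + 1)).2 p.1 p.2 with hLdef
  set X : ℕ → Tape S A → Fin S → ℝ := fun τ ω s =>
    Q.φ s ⬝ᵥ (extra γ Q.φ Q.core B η s0 ω τ).1 with hXdef
  have hLd : ∀ (τ : ℕ) (ω : Tape S A), InDom γ (linIter γ Q.φ Q.core B η s0 ω (τ + 1)).2 := fun τ ω =>
    inDom_linIter hm hγ0 hγ1 B η s0 ω (τ + 1)
  have hLi : ∀ τ p, Integrable (fun ω => L τ ω p) Q.tapeLaw := fun τ p => by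
    refine Integrable.of_bound ((measurable_pi_apply p.2).comp ((measurable_pi_apply p.1).comp
      (measurable_linIter (A := A) γ B η s0 (τ + 1)).snd)).aestronglyMeasurable (1 / (1 - γ))
      (ae_of_all _ fun ω => ?_)
    rw [Real.norm_eq_abs]
    change |(linIter γ Q.φ Q.core B η s0 ω (τ + 1)).2 p.1 p.2| ≤ _
    rw [abs_of_nonneg ((hLd τ ω).nonneg _ _), ← (hLd τ ω).sum hγ1, ← Fintype.sum_prod_type']
    exact Finset.single_le_sum (f := fun p : Fin (m + 1) × Fin A =>
      (linIter γ Q.φ Q.core B η s0 ω (τ + 1)).2 p.1 p.2)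
      (fun p _ => (hLd τ ω).nonneg _ _) (Finset.mem_univ p)
  have hXi : ∀ τ s, Integrable (fun ω => X τ ω s) Q.tapeLaw := fun τ s =>
    Integrable.of_bound (measurable_dotProduct_const
      (measurable_extra (A := A) γ B η s0 τ).fst _).aestronglyMeasurable B (ae_of_all _ fun ω =>
        (abs_feature_le hZ hZ0 hZ1 s _).trans (norm_coreVec_linTheta_le _ _ hB _ _ _))
  -- Averages over iterations and over the tape: `lamBar` and `xBar` are deterministic.
  set lamBar : Fin (m + 1) → Fin A → ℝ := fun i a => average Q.tapeLaw T fun τ ω => L τ ω (i, a)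
    with hlamBar
  set xBar : Fin S → ℝ := fun s => average Q.tapeLaw T fun τ ω => X τ ω s with hxBar
  have hx : ∀ s, xBar s = ∑ i, Z s i * xBar (Q.core i) := fun s => by
    have h1 := average_linear (μ := Q.tapeLaw) hT (Z s) (F := fun τ ω i => X τ ω (Q.core i))
      fun τ i => hXi τ _
    rw [← h1]
    simp only [hxBar]
    congr 1
    funext τ ω
    exact feature_dotProduct hZ s _
  have hw : ∀ s, Q.φ s ⬝ᵥ u = ∑ i, Z s i * (Q.φ (Q.core i) ⬝ᵥ u) := fun s => feature_dotProduct hZ s _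
  -- The vertex is chosen against `xBar`. Being deterministic, it is a fixed comparator, and no
  -- supremum over comparators enters the expectation.
  obtain ⟨a0, j, a, h1⟩ := exists_optValue_le_lagrangeVertex Q.mdp Q.core hm hZ0 hZ1 hx hw he s0
  have hl0 : ∑ b, lamBar 0 b = 1 := by
    have h2 := average_linear (μ := Q.tapeLaw) hT (fun _ : Fin A => 1) (F := fun τ ω b => L τ ω (0, b))
      fun τ i => hLi τ _
    simp only [one_mul] at h2
    rw [← average_const (μ := Q.tapeLaw) hT 1, ← h2]
    congr 1
    funext τ ω
    exact (hLd τ ω).1.sum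
  have hl1 : ∑ i, ∑ b, lamBar i b = 1 / (1 - γ) := by
    have h2 := average_linear (μ := Q.tapeLaw) hT (fun _ : Fin (m + 1) × Fin A => 1) (F := L) hLi
    simp only [one_mul] at h2
    rw [← average_const (μ := Q.tapeLaw) hT (1 / (1 - γ)), ← Fintype.sum_prod_type', ← h2]
    congr 1
    funext τ ω
    rw [← (hLd τ ω).sum hγ1, ← Fintype.sum_prod_type']
  have h3 := lagrange_le Q.mdp Q.core (lam := lamBar)
    (fun i b => average_nonneg fun τ ω => (hLd τ ω).nonneg i b) hl0 hl1 he s0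
  have hgap : ∀ τ, EqInt Q.tapeLaw _ _ := fun τ => eqInt_sampledGap hQ hm hZ hZ0 hZ1 hB η s0 τ u a0 j a
  have h4 := average_le (fun τ => (hgap τ).left) (T := T) (by
    filter_upwards [hQ.ae_reward] with ω hω
    exact sum_sampledGap_le hQ hm hZ hZ0 hZ1 hB hη hl s0 hu a0 j a hω T)
  obtain ⟨c, k, hck⟩ := lagrangeVertex_affine Q.mdp Q.core s0 a0 j a
  have hlag : ∀ lam : Fin (m + 1) → Fin A → ℝ, lagrange Q.mdp Q.core s0 (fun s => Q.φ s ⬝ᵥ u) lam =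
      Q.φ s0 ⬝ᵥ u + ∑ p : Fin (m + 1) × Fin A,
        Q.mdp.adv (fun s => Q.φ s ⬝ᵥ u) (plus Q.core s0 p.1) p.2 * lam p.1 p.2 := fun lam => by
    rw [lagrange, Fintype.sum_prod_type]
  have h5 : average Q.tapeLaw T (fun τ ω => sampledGap γ Q.φ Q.core s0 ω (2 * τ + 1) u a0 j a
        (fun i b => Q.mdp.adv (fun s => Q.φ s ⬝ᵥ u) (plus Q.core s0 i) b)
        (extra γ Q.φ Q.core B η s0 ω τ) (linIter γ Q.φ Q.core B η s0 ω (τ + 1))) =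
      lagrangeVertex Q.mdp Q.core s0 xBar a0 j a -
        lagrange Q.mdp Q.core s0 (fun s => Q.φ s ⬝ᵥ u) lamBar := by
    rw [hck, hlag, ← average_affine hT c k hXi, ← average_affine hT _ _ hLi, ← average_sub]
    · unfold average
      refine congrArg (· / (T : ℝ)) (Finset.sum_congr rfl fun τ _ => ?_)
      refine (hgap τ).eq.trans ?_
      simp only [hck, hlag]
      rfl
    · exact fun τ => (integrable_const _).add (integrable_finsetSum _ fun i _ => (hXi τ i).const_mul _)
    · exact fun τ => (integrable_const _).add (integrable_finsetSum _ fun i _ => (hLi τ i).const_mul _)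
  rw [h5] at h4
  have h6 : (1 / η + T * (η * (3 / 2 * (B * (3 / (1 - γ))) ^ 2 +
        32 * ell A m γ * ((1 + 2 * B) / (1 - γ)) ^ 2))) / T = 1 / (η * T) +
      η * (3 / 2 * (B * (3 / (1 - γ))) ^ 2 + 32 * ell A m γ * ((1 + 2 * B) / (1 - γ)) ^ 2) := by
    field_simp
  rw [h6] at h4
  have h7 : 2 * γ * e / (1 - γ) + 3 * e / (1 - γ) ≤ 5 * e / (1 - γ) := by
    rw [← add_div]
    refine div_le_div_of_nonneg_right ?_ h1'.le
    nlinarith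
  linarith

end Planner

/-! ### The policy of the planner -/

section Policy

variable {S A d m : ℕ} [NeZero A] {Q : Problem S A d m} {Z : Matrix (Fin S) (Fin m) ℝ}

/-- The distribution of the returned action, given the tape of the gradient estimates. -/
theorem result_isWeight (hm : 0 < m) (hZ : ∀ s, Q.φ s = ∑ i, Z s i • Q.φ (Q.core i))
    (B η : ℝ) (T : ℕ) (s0 : Fin S) (ω : Tape S A) :
    (∀ a, 0 ≤ result Q.mdp.γ Q.φ Q.core T B η s0 ω 0 a) ∧
      ∑ a, result Q.mdp.γ Q.φ Q.core T B η s0 ω 0 a = 1 := by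
  have hγ0 := Q.mdp.γ_nonneg
  have hγ1 := Q.mdp.γ_lt_one
  rw [result_eq hZ]
  split_ifs with hT
  · have := inDom_start (A := A) d hm hγ0 hγ1
    exact ⟨this.1.nonneg, this.1.sum⟩
  · have hd : ∀ τ, InDom Q.mdp.γ (linIter Q.mdp.γ Q.φ Q.core B η s0 ω (τ + 1)).2 := fun τ =>
      inDom_linIter hm hγ0 hγ1 B η s0 ω (τ + 1)
    have hT' : (T : ℝ) ≠ 0 := Nat.cast_ne_zero.2 hT
    simp only [Pi.smul_apply, Finset.sum_apply, smul_eq_mul]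
    refine ⟨fun a => mul_nonneg (by positivity) (Finset.sum_nonneg fun τ _ => (hd τ).1.nonneg a), ?_⟩
    rw [← Finset.mul_sum, Finset.sum_comm, Finset.sum_congr rfl fun τ _ => (hd τ).1.sum]
    simp [hT']

/-- The final draw has number 2T and is read by no iteration. Resampling it shows that, given the
rest of the tape, the action has the law `result`. -/
theorem plannerPolicy_eq (hm : 0 < m)
    (hZ : ∀ s, Q.φ s = ∑ i, Z s i • Q.φ (Q.core i)) (ε : ℝ) (s0 : Fin S) (a : Fin A) :
    Integrable (fun ω => result Q.mdp.γ Q.φ Q.core (iterations A m Q.mdp.γ ε) (radius m Q.mdp.γ)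
      (stepSize A m Q.mdp.γ (iterations A m Q.mdp.γ ε)) s0 ω 0 a) Q.tapeLaw ∧
    Q.plannerPolicy ε s0 a = ∫ ω, result Q.mdp.γ Q.φ Q.core (iterations A m Q.mdp.γ ε)
      (radius m Q.mdp.γ) (stepSize A m Q.mdp.γ (iterations A m Q.mdp.γ ε)) s0 ω 0 a ∂Q.tapeLaw := by
  set T := iterations A m Q.mdp.γ ε with hT
  set B := radius m Q.mdp.γ
  set η := stepSize A m Q.mdp.γ T
  set w : Tape S A → Fin A → ℝ := fun ω => result Q.mdp.γ Q.φ Q.core T B η s0 ω 0 with hw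
  have hww : ∀ ω, (∀ a, 0 ≤ w ω a) ∧ ∑ a, w ω a = 1 := fun ω => result_isWeight hm hZ B η T s0 ω
  have hwm : ∀ b, Measurable fun ω => w ω b := fun b => by
    simp only [hw, result_eq hZ]
    split_ifs
    · exact measurable_const
    · simp only [Pi.smul_apply, Finset.sum_apply]
      exact (Finset.measurable_sum _ fun τ _ => (measurable_pi_apply b).comp
        ((measurable_pi_apply 0).comp (measurable_linIter (A := A) _ B η s0 (τ + 1)).snd)).const_mul _
  have hFm : Measurable fun ω : Tape S A => if pick (w ω) (ω.2 (2 * T)) = a then (1 : ℝ) else 0 :=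
    measurable_pick (f := fun (ω : Tape S A) k => if k = a then (1 : ℝ) else 0) hwm
      (measurable_draw (2 * T)) fun k => measurable_const
  have hF : Integrable (fun ω : Tape S A => if pick (w ω) (ω.2 (2 * T)) = a then (1 : ℝ) else 0)
      Q.tapeLaw := by
    refine Integrable.of_bound hFm.aestronglyMeasurable 1 (ae_of_all _ fun ω => ?_)
    split_ifs <;> simp
  have hres := integral_resample (measurePreserving_setDraw Q (2 * T)) hF
  have hin : ∀ ω : Tape S A, ∫ z, (if pick (w (setDraw (2 * T) (ω, z)))
      ((setDraw (2 * T) (ω, z)).2 (2 * T)) = a then (1 : ℝ) else 0) = w ω a := fun ω => by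
    have e1 : ∀ z, w (setDraw (2 * T) (ω, z)) = w ω := fun z => by
      simp only [hw, result_eq hZ]
      split_ifs
      · rfl
      · refine congrFun (congrArg _ (Finset.sum_congr rfl fun τ hτ => ?_)) 0
        rw [linIter_congr _ B η s0 (agreeBelow_setDraw (m := m) (k := 2 * (τ + 1)) ?_ (ω, z))]
        have := Finset.mem_range.1 hτ
        omega
    have e2 : ∀ z, (setDraw (2 * T) (ω, z)).2 (2 * T) = z := fun z => by simp [setDraw]
    simp only [e1, e2]
    rw [integral_pick (hww ω).1 (by rw [(hww ω).2]; exact one_pos)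
      (fun k => if k = a then (1 : ℝ) else 0), (hww ω).2]
    simp
  simp only [hin] at hres
  refine ⟨hres.right, ?_⟩
  rw [← hres.eq]
  have hset : MeasurableSet {ω : Tape S A | pick (w ω) (ω.2 (2 * T)) = a} := by
    have : Measurable fun ω : Tape S A => (w ω, (ω.2 (2 * T) : ℝ)) :=
      (measurable_pi_iff.2 hwm).prodMk (measurable_draw (2 * T))
    exact this (measurableSet_pick_eq a)
  have h1 : (fun ω : Tape S A => if pick (w ω) (ω.2 (2 * T)) = a then (1 : ℝ) else 0) =
      Set.indicator {ω : Tape S A | pick (w ω) (ω.2 (2 * T)) = a} fun _ => 1 := by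
    funext ω
    simp [Set.indicator_apply]
  rw [h1, integral_indicator_const _ hset, smul_eq_mul, mul_one]
  rfl

/-- Positivity of `m` is asked for only in the presence of a state, since without states there may
be no core states. -/
theorem isPolicy_plannerPolicy (hm : Fin S → 0 < m)
    (hZ : ∀ s, Q.φ s = ∑ i, Z s i • Q.φ (Q.core i)) (ε : ℝ) : IsPolicy (Q.plannerPolicy ε) := by
  refine ⟨fun s a => ENNReal.toReal_nonneg, fun s => ?_⟩
  simp only [(plannerPolicy_eq (hm s) hZ ε s _).2]
  rw [← integral_finsetSum _ fun a _ => (plannerPolicy_eq (hm s) hZ ε s a).1]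
  simp only [(result_isWeight (hm s) hZ _ _ _ s _).2]
  simp

theorem plannerPolicy_eq_average (hm : 0 < m)
    (hZ : ∀ s, Q.φ s = ∑ i, Z s i • Q.φ (Q.core i)) {ε : ℝ} (hT : iterations A m Q.mdp.γ ε ≠ 0)
    (s0 : Fin S) (a : Fin A) :
    Q.plannerPolicy ε s0 a = average Q.tapeLaw (iterations A m Q.mdp.γ ε) fun τ ω =>
      (linIter Q.mdp.γ Q.φ Q.core (radius m Q.mdp.γ)
        (stepSize A m Q.mdp.γ (iterations A m Q.mdp.γ ε)) s0 ω (τ + 1)).2 0 a := by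
  rw [(plannerPolicy_eq hm hZ ε s0 a).2]
  simp only [result_eq hZ, if_neg hT, Pi.smul_apply, Finset.sum_apply, smul_eq_mul]
  rw [integral_const_mul, integral_finsetSum, average, div_eq_inv_mul, div_eq_inv_mul, mul_one]
  intro τ _
  have hd : ∀ ω : Tape S A, InDom Q.mdp.γ (linIter Q.mdp.γ Q.φ Q.core (radius m Q.mdp.γ)
      (stepSize A m Q.mdp.γ (iterations A m Q.mdp.γ ε)) s0 ω (τ + 1)).2 := fun ω =>
    inDom_linIter hm Q.mdp.γ_nonneg Q.mdp.γ_lt_one _ _ s0 ω (τ + 1)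
  refine Integrable.of_bound ((measurable_pi_apply a).comp ((measurable_pi_apply 0).comp
    (measurable_linIter (A := A) _ _ _ s0 (τ + 1)).snd)).aestronglyMeasurable 1
    (ae_of_all _ fun ω => ?_)
  rw [Real.norm_eq_abs]
  exact (abs_of_nonneg ((hd ω).1.nonneg a)).le.trans ((hd ω).1.le a)

end Policy

/-! ### Numerical constants of the regret bound. -/

section Numeric

/-- The accuracy that is reached by the choice of the parameters. -/
theorem gap_bound {A m : ℕ} {γ ε : ℝ} (hm : 0 < m) (hγ0 : 0 ≤ γ) (hγ1 : γ < 1) (hε : 0 < ε)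
    (hl : 0 ≤ ell A m γ) (hT : iterations A m γ ε ≠ 0) :
    0 < stepSize A m γ (iterations A m γ ε) ∧
    1 / (stepSize A m γ (iterations A m γ ε) * iterations A m γ ε) +
      stepSize A m γ (iterations A m γ ε) * (3 / 2 * (radius m γ * (3 / (1 - γ))) ^ 2 +
        32 * ell A m γ * ((1 + 2 * radius m γ) / (1 - γ)) ^ 2) ≤ 108 * ε / (1 - γ) ^ 2 := by
  have hg : 0 < 1 - γ := sub_pos.2 hγ1
  have hm1 : (1 : ℝ) ≤ m := by exact_mod_cast hm
  set l := ell A m γ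
  set T := iterations A m γ ε with hTd
  have hT1 : (1 : ℝ) ≤ T := by exact_mod_cast Nat.one_le_iff_ne_zero.2 hT
  -- A floor that is at least 1 loses at most a factor 2.
  have hTx : m * (1 + l) / ε ^ 2 ≤ 2 * T := by
    have := (Nat.lt_floor_add_one (m * (1 + l) / ε ^ 2)).le
    change _ ≤ (T : ℝ) + 1 at this
    linarith
  rw [div_le_iff₀ (by positivity)] at hTx
  set N := √(T : ℝ) with hN
  have hN2 : N ^ 2 = T := Real.sq_sqrt (by linarith)
  have hNp : 0 < N := Real.sqrt_pos.2 (by linarith)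
  set q := √(2 / 7 : ℝ) with hq
  have hq2 : q ^ 2 = 2 / 7 := Real.sq_sqrt (by norm_num)
  have hqp : 0 < q := Real.sqrt_pos.2 (by norm_num)
  have hq1 : 1 / 2 ≤ q := by nlinarith
  have hq3 : q ≤ 11 / 20 := by nlinarith
  set r := √(m * (1 + 2 * l)) with hr
  have hr2 : r ^ 2 = m * (1 + 2 * l) := Real.sq_sqrt (by positivity)
  have hrp : 0 < r := Real.sqrt_pos.2 (by positivity)
  set p := √(m : ℝ) with hp
  have hp2 : p ^ 2 = m := Real.sq_sqrt (by linarith)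
  have hpp : 0 < p := Real.sqrt_pos.2 (by linarith)
  have hp1 : 1 ≤ p := by nlinarith
  set C := bigC A m γ with hC
  have hCe : C = 9 / 4 * r / (1 - γ) ^ 2 := rfl
  have hCp : 0 < C := by rw [hCe]; positivity
  have hη : stepSize A m γ T = q / (C * N) := by
    rw [stepSize, ← hC, show (2 / (7 * (T : ℝ))) = 2 / 7 / T by field_simp,
      Real.sqrt_div (by norm_num), ← hq, ← hN]
    field_simp
  have hη0 : 0 < stepSize A m γ T := by rw [hη]; positivity
  refine ⟨hη0, ?_⟩
  -- In units of m/(1-γ)⁴ the coefficient of ℓ is 32 · 169/16 = 338 against 40 · 81/8 = 405, and the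
  -- constant term is below 18 against 40 · 81/16.
  have hQ : 3 / 2 * (radius m γ * (3 / (1 - γ))) ^ 2 +
      32 * l * ((1 + 2 * radius m γ) / (1 - γ)) ^ 2 ≤ 40 * C ^ 2 := by
    have e1 : radius m γ = 9 / 8 * p / (1 - γ) := rfl
    have e2 : (1 + 2 * radius m γ) / (1 - γ) ≤ 13 / 4 * p / (1 - γ) ^ 2 := by
      rw [div_le_div_iff₀ hg (by positivity), e1]
      have : (1 + 2 * (9 / 8 * p / (1 - γ))) * (1 - γ) ^ 2 =
          (1 - γ) * ((1 - γ) + 9 / 4 * p) := by field_simp; ring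
      rw [this, mul_comm]
      refine mul_le_mul_of_nonneg_right ?_ hg.le
      linarith
    have e3 : ((1 + 2 * radius m γ) / (1 - γ)) ^ 2 ≤ (13 / 4 * p / (1 - γ) ^ 2) ^ 2 := by
      refine pow_le_pow_left₀ ?_ e2 2
      rw [e1]; positivity
    have e4 : (13 / 4 * p / (1 - γ) ^ 2) ^ 2 = 169 / 16 * m / (1 - γ) ^ 4 := by
      rw [div_pow, mul_pow, hp2]; ring
    have e5 : (radius m γ * (3 / (1 - γ))) ^ 2 = 729 / 64 * m / (1 - γ) ^ 4 := by
      rw [e1, mul_pow, div_pow, mul_pow, hp2]; field_simp; norm_num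
    have e6 : C ^ 2 = 81 / 16 * (m * (1 + 2 * l)) / (1 - γ) ^ 4 := by
      rw [hCe, div_pow, mul_pow, hr2]; ring
    rw [e4] at e3
    rw [e5, e6]
    have e7 := mul_le_mul_of_nonneg_left e3 (by positivity : (0 : ℝ) ≤ 32 * l)
    refine (add_le_add_right e7 _).trans ?_
    have e8 : (3 / 2 * (729 / 64 * m / (1 - γ) ^ 4) + 32 * l * (169 / 16 * m / (1 - γ) ^ 4) : ℝ) =
        (3 / 2 * (729 / 64) * m + 32 * (169 / 16) * (l * m)) / (1 - γ) ^ 4 := by ring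
    have e9 : 40 * (81 / 16 * (m * (1 + 2 * l)) / (1 - γ) ^ 4) =
        40 * (81 / 16) * (m * (1 + 2 * l)) / (1 - γ) ^ 4 := by ring
    rw [e8, e9]
    refine div_le_div_of_nonneg_right ?_ (by positivity : 0 ≤ (1 - γ) ^ 4)
    have : 0 ≤ l * m := by positivity
    nlinarith
  have h1 : 1 / (stepSize A m γ T * T) ≤ 2 * (C / N) := by
    rw [hη, ← hN2, div_le_iff₀ (by positivity)]
    have : 2 * (C / N) * (q / (C * N) * N ^ 2) = 2 * q := by field_simp
    rw [this]; linarith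
  have h2 : stepSize A m γ T * (3 / 2 * (radius m γ * (3 / (1 - γ))) ^ 2 +
      32 * l * ((1 + 2 * radius m γ) / (1 - γ)) ^ 2) ≤ 22 * (C / N) := by
    refine (mul_le_mul_of_nonneg_left hQ hη0.le).trans ?_
    rw [hη]
    have : q / (C * N) * (40 * C ^ 2) = 40 * q * (C / N) := by field_simp
    rw [this]
    refine mul_le_mul_of_nonneg_right ?_ (by positivity)
    linarith
  -- With r² = m(1 + 2ℓ) ≤ 2m(1 + ℓ) ≤ 4Tε² one has r ≤ 2ε√T. The total is then (2 + 22) · 9/2 =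
  -- 108, where 2 and 22 come from 1/2 ≤ q ≤ 11/20.
  have h3 : C / N ≤ 9 / 2 * ε / (1 - γ) ^ 2 := by
    have h4 : r ≤ 2 * (ε * N) := by
      refine (sq_le_sq₀ hrp.le (by positivity)).1 ?_
      rw [hr2, mul_pow, mul_pow, hN2]
      have : 0 ≤ (m : ℝ) * l := by positivity
      nlinarith
    have e9 : 9 / 2 * ε / (1 - γ) ^ 2 * N = 9 / 2 * ε * N / (1 - γ) ^ 2 := by ring
    rw [hCe, div_le_iff₀ hNp, e9]
    refine div_le_div_of_nonneg_right ?_ (by positivity : 0 ≤ (1 - γ) ^ 2)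
    linarith
  calc _ ≤ 2 * (C / N) + 22 * (C / N) := add_le_add h1 h2
    _ = 24 * (C / N) := by ring
    _ ≤ 24 * (9 / 2 * ε / (1 - γ) ^ 2) := by linarith
    _ = _ := by ring

end Numeric

/-! ### From the gap to the loss of the policy. -/

section Suboptimality

variable {S A d m : ℕ} {Q : Problem S A d m}

theorem Problem.epsApprox_nonneg (Q : Problem S A d m) : 0 ≤ Q.epsApprox :=
  Real.iInf_nonneg fun _ => Real.iSup_nonneg fun _ => abs_nonneg _

/-- The infimum over θ is not shown to be attained, hence the strict inequality. -/
theorem Problem.exists_approx (Q : Problem S A d m) {e : ℝ} (he : Q.epsApprox < e) :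
    ∃ u, ∀ s, |Q.mdp.optValue s - Q.φ s ⬝ᵥ u| ≤ e := by
  obtain ⟨u, hu⟩ := exists_lt_of_ciInf_lt he
  exact ⟨u, fun s => (le_ciSup (f := fun s => |Q.mdp.optValue s - Q.φ s ⬝ᵥ u|)
    (Set.finite_range _).bddAbove s).trans hu.le⟩

/-- The core states span the features by convex combinations. -/
theorem Problem.Assumptions.exists_convex (hQ : Q.Assumptions) : ∃ Z : Matrix (Fin S) (Fin m) ℝ,
    (∀ s, Q.φ s = ∑ i, Z s i • Q.φ (Q.core i)) ∧ (∀ s i, 0 ≤ Z s i) ∧ ∀ s, ∑ i, Z s i = 1 := by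
  obtain ⟨v, hv⟩ := hQ.features
  obtain ⟨Z, hZ0, hZ⟩ := hQ.coreStates
  refine ⟨Z, hZ, hZ0, fun s => ?_⟩
  have := hv s
  rw [feature_dotProduct hZ] at this
  rw [← this]
  -- Pairing with `v` turns every feature into 1, so the coefficients sum to 1.
  have h1 : corePhi Q.φ Q.core *ᵥ v = fun _ => 1 := funext fun i => hv (Q.core i)
  simp [h1, dotProduct]

theorem Problem.Assumptions.core_pos (hQ : Q.Assumptions) (s : Fin S) : 0 < m := by
  obtain ⟨Z, _, _, hZ1⟩ := hQ.exists_convex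
  by_contra! hm
  obtain rfl : m = 0 := by omega
  simpa using hZ1 s

theorem Problem.Assumptions.dim_pos (hQ : Q.Assumptions) (s : Fin S) : 0 < d := by
  obtain ⟨v, hv⟩ := hQ.features
  by_contra! hd
  obtain rfl : d = 0 := by omega
  simpa using hv s

theorem ell_nonneg (A m : ℕ) {γ : ℝ} (h0 : 0 ≤ γ) : 0 ≤ ell A m γ :=
  add_nonneg (Real.log_natCast_nonneg A) (mul_nonneg h0 (Real.log_natCast_nonneg m))

theorem isPolicy_planner [NeZero A] (hQ : Q.Assumptions) (ε : ℝ) : IsPolicy (Q.plannerPolicy ε) := by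
  obtain ⟨Z, hZ, _, _⟩ := hQ.exists_convex
  exact isPolicy_plannerPolicy hQ.core_pos hZ ε

/-- The suboptimality of the planner. -/
theorem suboptimality [NeZero A] (hQ : Q.Assumptions) {ε : ℝ} (hε : 0 < ε) (s : Fin S) :
    Q.mdp.optValue s - Q.mdp.value (Q.plannerPolicy ε) s ≤
      113 * (Q.epsApprox / (1 - Q.mdp.γ) ^ 2 + ε / (1 - Q.mdp.γ) ^ 3) := by
  obtain ⟨Z, hZ, hZ0, hZ1⟩ := hQ.exists_convex
  have hm := hQ.core_pos s
  have hm1 : (1 : ℝ) ≤ m := by exact_mod_cast hm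
  have hpol := isPolicy_planner hQ ε
  have hγ0 := Q.mdp.γ_nonneg
  have hγ1 := Q.mdp.γ_lt_one
  have h1' := Q.mdp.one_sub_pos
  have hap := Q.epsApprox_nonneg
  have hl0 := ell_nonneg A m hγ0
  set γ := Q.mdp.γ with hγ
  set x := 1 - γ with hx
  have hx1 : x ≤ 1 := by linarith
  have hx2 : x ^ 2 ≤ x := by nlinarith
  have hx3 : x ^ 3 ≤ x := by nlinarith
  -- The trivial bound from rewards in [-1, 1]; it settles the cases of large ε or large
  -- approximation error.
  have hcoarse : Q.mdp.optValue s - Q.mdp.value (Q.plannerPolicy ε) s ≤ 2 / x := by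
    have a1 := (abs_le.1 (Q.mdp.abs_optValue_le hQ.abs_reward_le s)).2
    have a2 := (abs_le.1 (Q.mdp.abs_value_le hpol hQ.abs_reward_le s)).1
    rw [← hγ, ← hx] at a1 a2
    have : 2 / x = 1 / x + 1 / x := by ring
    linarith
  have hn1 : 0 ≤ Q.epsApprox / x ^ 2 := by positivity
  have hn2 : 0 ≤ ε / x ^ 3 := by positivity
  by_cases hT : iterations A m γ ε = 0
  · have hε1 : 1 ≤ ε := by
      have h1 := Nat.floor_eq_zero.1 hT
      rw [div_lt_one (by positivity)] at h1
      nlinarith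
    have : 2 / x ≤ 2 * (ε / x ^ 3) := by
      rw [← mul_div_assoc, div_le_div_iff₀ h1' (by positivity)]
      nlinarith
    linarith
  by_cases hap8 : 1 / (8 * x) ≤ Q.epsApprox
  · have : 2 / x ≤ 16 * (Q.epsApprox / x ^ 2) := by
      have a1 : 2 / x = 16 * (1 / (8 * x)) := by field_simp; norm_num
      have a2 : Q.epsApprox ≤ Q.epsApprox / x ^ 2 := by
        rw [le_div_iff₀ (by positivity)]
        exact mul_le_of_le_one_right hap (by linarith)
      linarith
    linarith
  push Not at hap8
  -- With a single action ℓ can vanish and the dual step degenerates, but then all policies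
  -- coincide.
  by_cases hA : A = 1
  · subst hA
    have h0 : ∀ s, Q.mdp.optValue s ≤ ∑ a, Q.plannerPolicy ε s a *
        Q.mdp.look Q.mdp.optValue s a + 0 := fun s => by
      obtain ⟨a, ha⟩ := Q.mdp.optValue_bellman.2 s
      have h2 := hpol.2 s
      simp only [Fin.sum_univ_one] at h2 ⊢
      rw [h2, one_mul, add_zero]
      rw [Subsingleton.elim a 0] at ha
      exact ha.le
    have := Q.mdp.sub_value_le hpol h0 s
    rw [zero_div] at this
    linarith
  have hl : 0 < ell A m γ := by
    have hA2 : (1 : ℝ) < A := by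
      have := NeZero.ne A
      exact_mod_cast (by omega : 1 < A)
    exact add_pos_of_pos_of_nonneg (Real.log_pos hA2) (mul_nonneg hγ0 (Real.log_natCast_nonneg m))
  -- The summand ε makes room above the infimum. The cap 1/(8(1-γ)) gives |φ s · u| ≤ (9/8)/(1-γ),
  -- so that `u` lies in the ball of radius B.
  obtain ⟨u, hu⟩ := Q.exists_approx (e := min (Q.epsApprox + ε) (1 / (8 * x)))
    (lt_min (by linarith) hap8)
  set e := min (Q.epsApprox + ε) (1 / (8 * x)) with he
  have hB : 0 < radius m γ := by
    have : 0 < √(m : ℝ) := Real.sqrt_pos.2 (by linarith)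
    unfold radius
    positivity
  have huB : ‖coreVec Q.φ Q.core u‖ ≤ radius m γ := by
    have hb : ∀ s, |Q.φ s ⬝ᵥ u| ≤ 9 / 8 / x := fun s => by
      have a1 := abs_le.1 (Q.mdp.abs_optValue_le hQ.abs_reward_le s)
      have a2 := abs_le.1 ((hu s).trans (min_le_right _ _))
      rw [← hγ, ← hx] at a1
      have : 9 / 8 / x = 1 / x + 1 / (8 * x) := by field_simp; norm_num
      rw [abs_le]
      constructor <;> linarith
    rw [EuclideanSpace.norm_eq, Real.sqrt_le_left hB.le]
    calc ∑ i, ‖coreVec Q.φ Q.core u i‖ ^ 2 ≤ ∑ _i : Fin m, (9 / 8 / x) ^ 2 :=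
          Finset.sum_le_sum fun i _ => pow_le_pow_left₀ (norm_nonneg _) (hb (Q.core i)) 2
      _ = (radius m γ) ^ 2 := by
          rw [Finset.sum_const, Finset.card_univ, Fintype.card_fin, nsmul_eq_mul, radius, ← hx, div_pow,
            div_pow _ x, mul_pow, Real.sq_sqrt (by linarith)]
          ring
  obtain ⟨hη, hgap⟩ := gap_bound (A := A) hm hγ0 hγ1 hε hl0 hT
  have hloc : ∀ s0, Q.mdp.optValue s0 ≤ ∑ a, Q.plannerPolicy ε s0 a *
      Q.mdp.look Q.mdp.optValue s0 a + (108 * ε / x ^ 2 + 5 * e / x) := fun s0 => by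
    have := optValue_sub_le hQ hm hZ hZ0 hZ1 hB hη hl s0 huB hu hT
    simp only [plannerPolicy_eq_average hm hZ hT s0]
    linarith
  refine (Q.mdp.sub_value_le hpol hloc s).trans ?_
  rw [← hγ, ← hx]
  have e1 : e ≤ Q.epsApprox + ε := min_le_left _ _
  -- With e at most the approximation error plus ε, the coefficient of ε/(1-γ)³ becomes 108 + 5 =
  -- 113.
  have e2 : (108 * ε / x ^ 2 + 5 * e / x) / x = 108 * (ε / x ^ 3) + 5 * (e / x ^ 2) := by
    field_simp
  have e3 : e / x ^ 2 ≤ Q.epsApprox / x ^ 2 + ε / x ^ 2 := by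
    rw [← add_div]
    exact div_le_div_of_nonneg_right e1 (by positivity)
  have e4 : ε / x ^ 2 ≤ ε / x ^ 3 :=
    div_le_div_of_nonneg_left hε.le (by positivity) (by nlinarith [sq_nonneg x])
  rw [e2]
  linarith

end Suboptimality

/-! ## A program logic for the machine -/

namespace Cmd

/-- The natural number registers a program writes to. -/
def natW : Cmd → List ℕ
  | setNat x _ => [x]
  | seq p q => p.natW ++ q.natW
  | ite _ p q => p.natW ++ q.natW
  | loop _ p => p.natW
  | _ => []

/-- The arrays a program writes to. -/
def realW : Cmd → List ℕ
  | setReal b _ _ _ => [b]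
  | getFeature b _ _ _ _ => [b]
  | simulate _ b _ _ _ _ => [b]
  | draw b _ _ => [b]
  | seq p q => p.realW ++ q.realW
  | ite _ p q => p.realW ++ q.realW
  | loop _ p => p.realW
  | _ => []

/-- The state registers a program writes to. -/
def stateW : Cmd → List ℕ
  | getCore x _ => [x]
  | simulate y _ _ _ _ _ => [y]
  | seq p q => p.stateW ++ q.stateW
  | ite _ p q => p.stateW ++ q.stateW
  | loop _ p => p.stateW
  | _ => []

/-- The program contains no simulator call. -/
def noCalls : Cmd → Bool
  | simulate _ _ _ _ _ _ => false
  | seq p q => p.noCalls && q.noCalls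
  | ite _ p q => p.noCalls && q.noCalls
  | loop _ p => p.noCalls
  | _ => true

/-- The program contains no random draw. -/
def noDraws : Cmd → Bool
  | draw _ _ _ => false
  | seq p q => p.noDraws && q.noDraws
  | ite _ p q => p.noDraws && q.noDraws
  | loop _ p => p.noDraws
  | _ => true

/-- A bound for the running time if every loop makes at most `N` iterations. -/
def cost (N : ℕ) : Cmd → ℕ
  | seq p q => p.cost N + q.cost N
  | ite _ p q => p.cost N + q.cost N + 1
  | loop _ p => N * (p.cost N + 1) + 1
  | _ => 1

/-- The nesting depth of the loops. -/
def depth : Cmd → ℕ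
  | seq p q => max p.depth q.depth
  | ite _ p q => max p.depth q.depth
  | loop _ p => p.depth + 1
  | _ => 0

/-- A measure of the size of a program. -/
def size : Cmd → ℕ
  | seq p q => p.size + q.size
  | ite _ p q => p.size + q.size + 1
  | loop _ p => p.size + 2
  | _ => 1

/-- Each level of nesting costs one factor N. The 2 in the size of a loop pays for the test in every
round and for the failing test at the end. -/
theorem cost_le {N : ℕ} (hN : 1 ≤ N) (p : Cmd) : p.cost N ≤ p.size * N ^ p.depth := by
  induction p with
  | seq p q hp hq =>
    simp only [cost, size, depth, add_mul]
    exact add_le_add (hp.trans (Nat.mul_le_mul_left _ (Nat.pow_le_pow_right hN (le_max_left _ _))))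
      (hq.trans (Nat.mul_le_mul_left _ (Nat.pow_le_pow_right hN (le_max_right _ _))))
  | ite c p q hp hq =>
    simp only [cost, size, depth, add_mul, one_mul]
    exact add_le_add (add_le_add
      (hp.trans (Nat.mul_le_mul_left _ (Nat.pow_le_pow_right hN (le_max_left _ _))))
      (hq.trans (Nat.mul_le_mul_left _ (Nat.pow_le_pow_right hN (le_max_right _ _)))))
      (Nat.one_le_pow _ _ hN)
  | loop c p hp =>
    simp only [cost, size, depth]
    have h1 := Nat.one_le_pow p.depth N hN
    have h2 : 1 ≤ N * N ^ p.depth := Nat.mul_pos hN h1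
    calc N * (p.cost N + 1) + 1 ≤ N * (p.size * N ^ p.depth + N ^ p.depth) + N * N ^ p.depth :=
          add_le_add (Nat.mul_le_mul_left _ (add_le_add hp h1)) h2
      _ = _ := by ring
  | _ => simp [cost, size, depth]

end Cmd

section Logic

variable {S A d m : ℕ}

/-- The parts of the memory that the program `p` does not write to are the same in `c` and `c'`. -/
structure Frame (p : Cmd) (c c' : Config S) : Prop where
  nat : ∀ x, x ∉ p.natW → c'.nat x = c.nat x
  real : ∀ b, b ∉ p.realW → c'.real b = c.real b
  state : ∀ x, x ∉ p.stateW → c'.state x = c.state x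
  calls : p.noCalls = true → c'.calls = c.calls
  draws : p.noDraws = true → c'.draws = c.draws

/-- The program `q` writes only to parts of the memory that `p` writes to as well. -/
structure Cmd.Sub (q p : Cmd) : Prop where
  nat : q.natW ⊆ p.natW
  real : q.realW ⊆ p.realW
  state : q.stateW ⊆ p.stateW
  calls : p.noCalls = true → q.noCalls = true
  draws : p.noDraws = true → q.noDraws = true

theorem Cmd.Sub.seq_left (p q : Cmd) : p.Sub (p.seq q) :=
  ⟨List.subset_append_left _ _, List.subset_append_left _ _, List.subset_append_left _ _,
    fun h => (Bool.and_eq_true_iff.1 h).1, fun h => (Bool.and_eq_true_iff.1 h).1⟩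

theorem Cmd.Sub.seq_right (p q : Cmd) : q.Sub (p.seq q) :=
  ⟨List.subset_append_right _ _, List.subset_append_right _ _, List.subset_append_right _ _,
    fun h => (Bool.and_eq_true_iff.1 h).2, fun h => (Bool.and_eq_true_iff.1 h).2⟩

theorem Cmd.Sub.ite_left (b : BExp) (p q : Cmd) : p.Sub (.ite b p q) :=
  ⟨List.subset_append_left _ _, List.subset_append_left _ _, List.subset_append_left _ _,
    fun h => (Bool.and_eq_true_iff.1 h).1, fun h => (Bool.and_eq_true_iff.1 h).1⟩

theorem Cmd.Sub.ite_right (b : BExp) (p q : Cmd) : q.Sub (.ite b p q) :=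
  ⟨List.subset_append_right _ _, List.subset_append_right _ _, List.subset_append_right _ _,
    fun h => (Bool.and_eq_true_iff.1 h).2, fun h => (Bool.and_eq_true_iff.1 h).2⟩

theorem Cmd.Sub.loop (b : BExp) (p : Cmd) : p.Sub (p.loop b) :=
  ⟨List.Subset.refl _, List.Subset.refl _, List.Subset.refl _, id, id⟩

theorem Cmd.Sub.trans {p q r : Cmd} (h : p.Sub q) (h' : q.Sub r) : p.Sub r :=
  ⟨List.Subset.trans h.nat h'.nat, List.Subset.trans h.real h'.real,
    List.Subset.trans h.state h'.state, h.calls ∘ h'.calls,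
    h.draws ∘ h'.draws⟩

theorem Frame.refl (p : Cmd) (c : Config S) : Frame p c c :=
  ⟨fun _ _ => rfl, fun _ _ => rfl, fun _ _ => rfl, fun _ => rfl, fun _ => rfl⟩

theorem Frame.trans {p : Cmd} {c c' c'' : Config S} (h : Frame p c c') (h' : Frame p c' c'') :
    Frame p c c'' :=
  ⟨fun x hx => (h'.nat x hx).trans (h.nat x hx), fun b hb => (h'.real b hb).trans (h.real b hb),
    fun x hx => (h'.state x hx).trans (h.state x hx), fun hp => (h'.calls hp).trans (h.calls hp),
    fun hp => (h'.draws hp).trans (h.draws hp)⟩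

theorem Frame.mono {p q : Cmd} (hqp : q.Sub p) {c c' : Config S} (h : Frame q c c') : Frame p c c' :=
  ⟨fun x hx => h.nat x fun h' => hx (hqp.nat h'), fun b hb => h.real b fun h' => hb (hqp.real h'),
    fun x hx => h.state x fun h' => hx (hqp.state h'), fun hp => h.calls (hqp.calls hp),
    fun hp => h.draws (hqp.draws hp)⟩

variable {φ : Fin S → Fin d → ℝ} {core : Fin m ↪ Fin S} {ω : Tape S A}

/-- Specifications thus need to mention only what a program writes; that the rest survives is
settled by evaluating the lists of a concrete program. -/
theorem Exec.frame {p : Cmd} {c c' : Config S} {n : ℕ} (h : Exec φ core ω p c c' n) :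
    Frame p c c' := by
  induction h with
  | skip c => exact Frame.refl _ _
  | setNat c x e =>
    refine ⟨fun y hy => ?_, fun _ _ => rfl, fun _ _ => rfl, fun _ => rfl, fun _ => rfl⟩
    exact Function.update_of_ne (by simpa [Cmd.natW] using hy) _ _
  | setReal c b i j e =>
    refine ⟨fun _ _ => rfl, fun y hy => ?_, fun _ _ => rfl, fun _ => rfl, fun _ => rfl⟩
    have : y ≠ b := by simpa [Cmd.realW] using hy
    simp [Config.writeReal, this]
  | getCore c x i hi =>
    refine ⟨fun _ _ => rfl, fun _ _ => rfl, fun y hy => ?_, fun _ => rfl, fun _ => rfl⟩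
    exact Function.update_of_ne (by simpa [Cmd.stateW] using hy) _ _
  | getFeature c b i j x k hk =>
    refine ⟨fun _ _ => rfl, fun y hy => ?_, fun _ _ => rfl, fun _ => rfl, fun _ => rfl⟩
    have : y ≠ b := by simpa [Cmd.realW] using hy
    simp [Config.writeReal, this]
  | simulate c y b i j x a ha =>
    refine ⟨fun _ _ => rfl, fun z hz => ?_, fun z hz => ?_, fun h => ?_, fun _ => rfl⟩
    · have : z ≠ b := by simpa [Cmd.realW] using hz
      simp [Config.writeReal, Config.writeState, Config.countCall, this]
    · exact Function.update_of_ne (by simpa [Cmd.stateW] using hz) _ _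
    · simp [Cmd.noCalls] at h
  | draw c b i j =>
    refine ⟨fun _ _ => rfl, fun z hz => ?_, fun _ _ => rfl, fun _ => rfl, fun h => ?_⟩
    · have : z ≠ b := by simpa [Cmd.realW] using hz
      simp [Config.writeReal, Config.countDraw, this]
    · simp [Cmd.noDraws] at h
  | seq _ _ hp hq => exact (hp.mono (Cmd.Sub.seq_left _ _)).trans (hq.mono (Cmd.Sub.seq_right _ _))
  | iteTrue _ _ hp => exact hp.mono (Cmd.Sub.ite_left _ _ _)
  | iteFalse _ _ hq => exact hq.mono (Cmd.Sub.ite_right _ _ _)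
  | loopTrue _ _ _ hp hl => exact Frame.trans (p := Cmd.loop _ _) (hp.mono (Cmd.Sub.loop _ _)) hl
  | loopFalse _ => exact Frame.refl _ _

variable (φ core ω) in
/-- The program `p`, started in `c`, halts within the time `p.cost N` in a memory with `R`. -/
def Runs (N : ℕ) (p : Cmd) (c : Config S) (R : Config S → Prop) : Prop :=
  ∃ c' n, Exec φ core ω p c c' n ∧ n ≤ p.cost N ∧ R c'

variable {N : ℕ} {p q : Cmd} {c : Config S} {R : Config S → Prop}

theorem Runs.post {R' : Config S → Prop} (h : Runs φ core ω N p c R')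
    (hR : ∀ c', R' c' → Frame p c c' → R c') : Runs φ core ω N p c R := by
  obtain ⟨c', n, h1, h2, h3⟩ := h
  exact ⟨c', n, h1, h2, hR c' h3 h1.frame⟩

/-- The second program receives the frame of the first besides its postcondition, so facts about
untouched memory need not be threaded through `R'`. -/
theorem Runs.seq {R' : Config S → Prop} (hp : Runs φ core ω N p c R')
    (hq : ∀ c', R' c' → Frame p c c' → Runs φ core ω N q c' R) : Runs φ core ω N (p.seq q) c R := by
  obtain ⟨c', n, h1, h2, h3⟩ := hp
  obtain ⟨c'', k, h4, h5, h6⟩ := hq c' h3 h1.frame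
  exact ⟨c'', n + k, h1.seq h4, add_le_add h2 h5, h6⟩

theorem Runs.skip (h : R c) : Runs φ core ω N .skip c R := ⟨_, _, .skip c, le_rfl, h⟩

theorem Runs.setNat {x : ℕ} {e : NExp} (h : R (c.writeNat x (e.eval c))) :
    Runs φ core ω N (.setNat x e) c R := ⟨_, _, .setNat c x e, le_rfl, h⟩

theorem Runs.setReal {b : ℕ} {i j : NExp} {e : RExp}
    (h : R (c.writeReal b (i.eval c) (j.eval c) (e.eval c))) :
    Runs φ core ω N (.setReal b i j e) c R := ⟨_, _, .setReal c b i j e, le_rfl, h⟩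

theorem Runs.getCore {x : ℕ} {i : NExp} {k : Fin m} (hi : i.eval c = k)
    (h : R (c.writeState x (core k))) : Runs φ core ω N (.getCore x i) c R := by
  have hlt : i.eval c < m := hi ▸ k.2
  obtain rfl : k = ⟨i.eval c, hlt⟩ := Fin.ext hi.symm
  exact ⟨_, _, .getCore c x i hlt, le_rfl, h⟩

theorem Runs.getFeature {b x : ℕ} {i j k : NExp} {l : Fin d} (hk : k.eval c = l)
    (h : R (c.writeReal b (i.eval c) (j.eval c) (φ (c.state x) l))) :
    Runs φ core ω N (.getFeature b i j x k) c R := by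
  have hlt : k.eval c < d := hk ▸ l.2
  obtain rfl : l = ⟨k.eval c, hlt⟩ := Fin.ext hk.symm
  exact ⟨_, _, .getFeature c b i j x k hlt, le_rfl, h⟩

theorem Runs.simulate {y b x : ℕ} {i j a : NExp} {l : Fin A} (ha : a.eval c = l)
    (h : R (((c.writeReal b (i.eval c) (j.eval c) (ω.1 c.calls (c.state x) l).2).writeState
      y (ω.1 c.calls (c.state x) l).1).countCall)) :
    Runs φ core ω N (.simulate y b i j x a) c R := by
  have hlt : a.eval c < A := ha ▸ l.2
  obtain rfl : l = ⟨a.eval c, hlt⟩ := Fin.ext ha.symm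
  exact ⟨_, _, .simulate c y b i j x a hlt, le_rfl, h⟩

theorem Runs.draw {b : ℕ} {i j : NExp}
    (h : R ((c.writeReal b (i.eval c) (j.eval c) (ω.2 c.draws : ℝ)).countDraw)) :
    Runs φ core ω N (.draw b i j) c R := ⟨_, _, .draw c b i j, le_rfl, h⟩

theorem Runs.ite {b : BExp} (hp : b.Holds c → Runs φ core ω N p c R)
    (hq : ¬ b.Holds c → Runs φ core ω N q c R) : Runs φ core ω N (.ite b p q) c R := by
  by_cases hb : b.Holds c
  · obtain ⟨c', n, h1, h2, h3⟩ := hp hb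
    exact ⟨c', n + 1, .iteTrue hb h1, by simp only [Cmd.cost]; omega, h3⟩
  · obtain ⟨c', n, h1, h2, h3⟩ := hq hb
    exact ⟨c', n + 1, .iteFalse hb h1, by simp only [Cmd.cost]; omega, h3⟩

/-- A loop with an invariant that counts the iterations. -/
theorem Runs.loop {b : BExp} {n : ℕ} (hn : n ≤ N) (I : ℕ → Config S → Prop) (h0 : I 0 c)
    (hstep : ∀ k < n, ∀ c', I k c' → b.Holds c' ∧ Runs φ core ω N p c' (I (k + 1)))
    (hend : ∀ c', I n c' → ¬ b.Holds c') (hR : ∀ c', I n c' → R c') :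
    Runs φ core ω N (.loop b p) c R := by
  -- Induction on the number `j` of rounds still to come, because executions of loops are assembled
  -- from the end.
  have key : ∀ j ≤ n, ∀ c', I (n - j) c' → ∃ c'' k, Exec φ core ω (.loop b p) c' c'' k ∧
      k ≤ j * (p.cost N + 1) + 1 ∧ I n c'' := by
    intro j
    induction j with
    | zero => exact fun _ c' hc' => ⟨c', 1, .loopFalse (hend c' hc'), by omega, hc'⟩
    | succ j ih =>
      intro hj c' hc'
      obtain ⟨hb, c₁, k₁, e1, hk1, hI⟩ := hstep (n - (j + 1)) (by omega) c' hc'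
      rw [show n - (j + 1) + 1 = n - j by omega] at hI
      obtain ⟨c₂, k₂, e2, hk2, hI2⟩ := ih (by omega) c₁ hI
      refine ⟨c₂, k₁ + k₂ + 1, .loopTrue hb e1 e2, ?_, hI2⟩
      rw [add_mul]
      omega
  obtain ⟨c', k, h1, h2, h3⟩ := key n le_rfl c (by rwa [Nat.sub_self])
  refine ⟨c', k, h1, h2.trans ?_, hR c' h3⟩
  exact Nat.succ_le_succ (Nat.mul_le_mul_right _ hn)

/-- `for x < y do p`, where `x` and `y` are registers. -/
def forLoop (x y : ℕ) (p : Cmd) : Cmd :=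
  .seq (.setNat x (.lit 0)) (.loop (.natLt (.reg x) (.reg y))
    (.seq p (.setNat x (.add (.reg x) (.lit 1)))))

theorem sub_forLoop (x y : ℕ) (p : Cmd) : p.Sub (forLoop x y p) :=
  (Cmd.Sub.seq_left _ _).trans ((Cmd.Sub.loop _ _).trans (Cmd.Sub.seq_right _ _))

theorem frame_writeNat (x v y : ℕ) (p : Cmd) (c : Config S) :
    Frame (forLoop x y p) c (c.writeNat x v) := by
  refine ⟨fun z hz => Function.update_of_ne ?_ _ _, fun _ _ => rfl, fun _ _ => rfl, fun _ => rfl,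
    fun _ => rfl⟩
  rintro rfl
  exact hz (by simp [forLoop, Cmd.natW])

/-- By `hI` the invariant does not see the counter, so initializing and incrementing it is harmless.
By `hx` and `hy` the body cannot alter the counter, nor the loop its bound. -/
theorem Runs.forLoop {x y n : ℕ} (hy : y ∉ (forLoop x y p).natW) (hx : x ∉ p.natW)
    (hn : c.nat y = n) (hN : n ≤ N) (I : ℕ → Config S → Prop)
    (hI : ∀ k c v, I k c → I k (c.writeNat x v)) (h0 : I 0 c)
    (hstep : ∀ k < n, ∀ c', Frame (forLoop x y p) c c' → c'.nat x = k → I k c' →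
      Runs φ core ω N p c' (I (k + 1)))
    (hR : ∀ c', Frame (forLoop x y p) c c' → I n c' → R c') :
    Runs φ core ω N (CorePlanning.forLoop x y p) c R := by
  refine Runs.seq (R' := fun c' => c' = c.writeNat x 0) (Runs.setNat rfl) ?_
  rintro _ rfl -
  refine Runs.loop hN (fun k c' => I k c' ∧ c'.nat x = k ∧ Frame (CorePlanning.forLoop x y p) c c')
    ⟨hI _ _ _ h0, by simp [Config.writeNat], frame_writeNat _ _ _ _ _⟩ ?_ ?_ ?_
  · rintro k hk c' ⟨h1, h2, h3⟩
    refine ⟨?_, ?_⟩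
    · simp only [BExp.Holds, NExp.eval, h2, h3.nat y hy, hn]
      exact hk
    · refine Runs.seq (hstep k hk c' h3 h2 h1) fun c'' h4 h5 => Runs.setNat ?_
      refine ⟨hI _ _ _ h4, ?_, ?_⟩
      · simp [Config.writeNat, NExp.eval, h5.nat x hx, h2]
      · exact (h3.trans (h5.mono (sub_forLoop x y p))).trans (frame_writeNat _ _ _ _ _)
  · rintro c' ⟨-, h2, h3⟩
    simp [BExp.Holds, NExp.eval, h2, h3.nat y hy, hn]
  · rintro c' ⟨h1, -, h3⟩
    exact hR c' h3 h1

/-- `b[x, y] := e` for all `x` and `y` below the contents of the registers `X` and `Y`. -/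
def fill (x X y Y b : ℕ) (e : RExp) : Cmd :=
  CorePlanning.forLoop x X (CorePlanning.forLoop y Y (.setReal b (.reg x) (.reg y) e))

/-- When an entry is computed it still has its old value. So `e` may read the entry it replaces, as
in running sums and in the update of the generalized inverse. -/
theorem Runs.fill {x X y Y b : ℕ} {e : RExp} {n k : ℕ}
    (hreg : x ≠ y ∧ x ≠ X ∧ x ≠ Y ∧ y ≠ X ∧ y ≠ Y) (hX : c.nat X = n) (hY : c.nat Y = k)
    (hn : n ≤ N) (hk : k ≤ N) (v : ℕ → ℕ → ℝ)
    (he : ∀ i < n, ∀ j < k, ∀ c', Frame (fill x X y Y b e) c c' → c'.nat x = i → c'.nat y = j →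
      c'.real b i j = c.real b i j → e.eval c' = v i j)
    (hR : ∀ c', Frame (fill x X y Y b e) c c' →
      (∀ i j, c'.real b i j = if i < n ∧ j < k then v i j else c.real b i j) → R c') :
    Runs φ core ω N (CorePlanning.fill x X y Y b e) c R := by
  obtain ⟨h1, h2, h3, h4, h5⟩ := hreg
  refine Runs.forLoop (n := n) (by simp [CorePlanning.forLoop, Cmd.natW, h2.symm, h4.symm])
    (by simp [CorePlanning.forLoop, Cmd.natW, h1]) hX hn
    (fun l c' => ∀ i j, c'.real b i j = if i < l ∧ j < k then v i j else c.real b i j)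
    (fun _ _ _ h => h) (fun i j => by simp) ?_ fun c' f h => hR c' f h
  intro l hl c1 f1 hx1 hI1
  refine Runs.forLoop (n := k) (by simp [CorePlanning.forLoop, Cmd.natW, h5.symm])
    (by simp [Cmd.natW]) ((f1.nat Y (by simp [CorePlanning.forLoop, Cmd.natW, h3.symm, h5.symm])).trans hY)
    hk (fun r c' => ∀ i j, c'.real b i j =
      -- Rows before `l` are complete, and row `l` is done up to column `r`.
      if (i < l ∧ j < k) ∨ (i = l ∧ j < r) then v i j else c.real b i j)
    (fun _ _ _ h => h) (fun i j => by simp [hI1]) ?_ fun c' _ h i j => ?_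
  · intro r hr c2 f2 hy2 hI2
    have hx2 : c2.nat x = l := (f2.nat x (by simp [CorePlanning.forLoop, Cmd.natW, h1])).trans hx1
    refine Runs.setReal fun i j => ?_
    have f3 : Frame (CorePlanning.fill x X y Y b e) c c2 := f1.trans (f2.mono (sub_forLoop _ _ _))
    have hev := he l hl r hr c2 f3 hx2 hy2 (by rw [hI2, if_neg (by omega)])
    simp only [Config.writeReal, NExp.eval, hx2, hy2, hev, true_and]
    by_cases hij : i = l ∧ j = r
    · obtain ⟨rfl, rfl⟩ := hij
      simp
    · rw [if_neg hij, hI2]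
      congr 1
      apply propext
      omega
  · rw [h i j]
    congr 1
    apply propext
    omega

/-- `b[x, y] := b[x, y] + e` for all `x`, `y`, `z` below the contents of `X`, `Y`, `Z`. -/
def accum (x X y Y z Z b : ℕ) (e : RExp) : Cmd :=
  CorePlanning.forLoop x X (CorePlanning.forLoop y Y (CorePlanning.forLoop z Z
    (.setReal b (.reg x) (.reg y) (.add (.cell b (.reg x) (.reg y)) e))))

theorem Runs.accum {x X y Y z Z b : ℕ} {e : RExp} {n k r : ℕ}
    (hreg : x ≠ y ∧ x ≠ z ∧ y ≠ z ∧ x ≠ X ∧ x ≠ Y ∧ x ≠ Z ∧ y ≠ X ∧ y ≠ Y ∧ y ≠ Z ∧ z ≠ X ∧ z ≠ Y ∧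
      z ≠ Z) (hX : c.nat X = n) (hY : c.nat Y = k) (hZ : c.nat Z = r)
    (hn : n ≤ N) (hk : k ≤ N) (hr : r ≤ N) (v : ℕ → ℕ → ℕ → ℝ)
    (he : ∀ i < n, ∀ j < k, ∀ l < r, ∀ c', Frame (accum x X y Y z Z b e) c c' → c'.nat x = i →
      c'.nat y = j → c'.nat z = l → e.eval c' = v i j l)
    (hR : ∀ c', Frame (accum x X y Y z Z b e) c c' → (∀ i j, c'.real b i j =
      c.real b i j + if i < n ∧ j < k then ∑ l ∈ Finset.range r, v i j l else 0) → R c') :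
    Runs φ core ω N (CorePlanning.accum x X y Y z Z b e) c R := by
  obtain ⟨xy, xz, yz, xX, xY, xZ, yX, yY, yZ, zX, zY, zZ⟩ := hreg
  refine Runs.forLoop (n := n) (by simp [CorePlanning.forLoop, Cmd.natW, xX.symm, yX.symm, zX.symm])
    (by simp [CorePlanning.forLoop, Cmd.natW, xy, xz]) hX hn
    (fun u c' => ∀ i j, c'.real b i j =
      c.real b i j + if i < u ∧ j < k then ∑ l ∈ Finset.range r, v i j l else 0)
    (fun _ _ _ h => h) (fun i j => by simp) ?_ fun c' f h => hR c' f h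
  intro u hu c1 f1 hx1 hI1
  refine Runs.forLoop (n := k) (by simp [CorePlanning.forLoop, Cmd.natW, yY.symm, zY.symm])
    (by simp [CorePlanning.forLoop, Cmd.natW, yz])
    ((f1.nat Y (by simp [CorePlanning.forLoop, Cmd.natW, xY.symm, yY.symm, zY.symm])).trans hY)
    hk (fun w c' => ∀ i j, c'.real b i j = c.real b i j +
      if (i < u ∧ j < k) ∨ (i = u ∧ j < w) then ∑ l ∈ Finset.range r, v i j l else 0)
    (fun _ _ _ h => h) (fun i j => by simp [hI1]) ?_ fun c' _ h i j => ?_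
  · intro w hw c2 f2 hy2 hI2
    have hx2 : c2.nat x = u := (f2.nat x (by simp [CorePlanning.forLoop, Cmd.natW, xy, xz])).trans hx1
    have f12 : Frame (CorePlanning.accum x X y Y z Z b e) c c2 := f1.trans (f2.mono (sub_forLoop _ _ _))
    refine Runs.forLoop (n := r) (by simp [CorePlanning.forLoop, Cmd.natW, zZ.symm])
      (by simp [Cmd.natW]) ((f12.nat Z (by
        simp [CorePlanning.accum, CorePlanning.forLoop, Cmd.natW, xZ.symm, yZ.symm, zZ.symm])).trans hZ)
      hr (fun t c' => ∀ i j, c'.real b i j = c.real b i j +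
        if (i < u ∧ j < k) ∨ (i = u ∧ j < w) then ∑ l ∈ Finset.range r, v i j l else
          if i = u ∧ j = w then ∑ l ∈ Finset.range t, v i j l else 0)
      (fun _ _ _ h => h) (fun i j => by simp [hI2]) ?_ fun c' _ h i j => ?_
    · intro t ht c3 f3 hz3 hI3
      have hx3 : c3.nat x = u := (f3.nat x (by simp [CorePlanning.forLoop, Cmd.natW, xz])).trans hx2
      have hy3 : c3.nat y = w := (f3.nat y (by simp [CorePlanning.forLoop, Cmd.natW, yz])).trans hy2
      have f4 : Frame (CorePlanning.accum x X y Y z Z b e) c c3 :=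
        f12.trans (f3.mono ((sub_forLoop _ _ _).trans (sub_forLoop _ _ _)))
      have hev := he u hu w hw t ht c3 f4 hx3 hy3 hz3
      refine Runs.setReal fun i j => ?_
      simp only [Config.writeReal, NExp.eval, RExp.eval, hx3, hy3, hev, true_and]
      by_cases hij : i = u ∧ j = w
      · obtain ⟨rfl, rfl⟩ := hij
        simp [hI3, Finset.sum_range_succ, add_assoc]
      · simp only [if_neg hij, hI3]
    · rw [h i j]
      by_cases hij : i = u ∧ j = w
      · obtain ⟨rfl, rfl⟩ := hij
        rw [if_neg (by omega), if_pos ⟨rfl, rfl⟩, if_pos (by omega)]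
      · rw [if_neg hij]
        congr 2
        apply propext
        omega
  · rw [h i j]
    congr 2
    apply propext
    omega

end Logic

/-! ## Derived commands -/

section Derived

variable {S A d m : ℕ} {φ : Fin S → Fin d → ℝ} {core : Fin m ↪ Fin S} {ω : Tape S A}
  {N : ℕ} {p : Cmd} {c : Config S} {R : Config S → Prop}

/-- That rows from `n` on are untouched allows a second fill to overwrite row 0 only, as for the
block of the planning state. -/
theorem Runs.fillFin {x X y Y b : ℕ} {e : RExp} {n k : ℕ}
    (hreg : x ≠ y ∧ x ≠ X ∧ x ≠ Y ∧ y ≠ X ∧ y ≠ Y) (hX : c.nat X = n) (hY : c.nat Y = k)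
    (hn : n ≤ N) (hk : k ≤ N) (v : Fin n → Fin k → ℝ)
    (he : ∀ (i : Fin n) (j : Fin k) c', Frame (CorePlanning.fill x X y Y b e) c c' → c'.nat x = i →
      c'.nat y = j → c'.real b i j = c.real b i j → e.eval c' = v i j) :
    Runs φ core ω N (CorePlanning.fill x X y Y b e) c fun c' =>
      (∀ (i : Fin n) (j : Fin k), c'.real b i j = v i j) ∧
        ∀ i j : ℕ, n ≤ i → c'.real b i j = c.real b i j := by
  refine Runs.fill hreg hX hY hn hk
    (fun i j => if h : i < n ∧ j < k then v ⟨i, h.1⟩ ⟨j, h.2⟩ else 0) ?_ ?_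
  · intro i hi j hj c' f h1 h2 h3
    rw [dif_pos ⟨hi, hj⟩]
    exact he ⟨i, hi⟩ ⟨j, hj⟩ c' f h1 h2 h3
  · intro c' _ h
    exact ⟨fun i j => by simp [h], fun i j hi => by rw [h, if_neg (by omega)]⟩

/-- `b[x, y] := ∑_z e` for all `x`, `y` below the contents of `X` and `Y`, where `z` is summed over
the numbers below the content of `Z`. -/
def sumInto (x X y Y z Z b : ℕ) (e : RExp) : Cmd :=
  .seq (CorePlanning.fill x X y Y b (.nat (.lit 0))) (CorePlanning.accum x X y Y z Z b e)

theorem Runs.sumInto {x X y Y z Z b : ℕ} {e : RExp} {n k r : ℕ}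
    (hreg : x ≠ y ∧ x ≠ z ∧ y ≠ z ∧ x ≠ X ∧ x ≠ Y ∧ x ≠ Z ∧ y ≠ X ∧ y ≠ Y ∧ y ≠ Z ∧ z ≠ X ∧ z ≠ Y ∧
      z ≠ Z) (hX : c.nat X = n) (hY : c.nat Y = k) (hZ : c.nat Z = r)
    (hn : n ≤ N) (hk : k ≤ N) (hr : r ≤ N) (v : Fin n → Fin k → Fin r → ℝ)
    (he : ∀ (i : Fin n) (j : Fin k) (l : Fin r) c', Frame (CorePlanning.sumInto x X y Y z Z b e) c c' →
      c'.nat x = i → c'.nat y = j → c'.nat z = l → e.eval c' = v i j l) :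
    Runs φ core ω N (CorePlanning.sumInto x X y Y z Z b e) c fun c' =>
      ∀ (i : Fin n) (j : Fin k), c'.real b i j = ∑ l, v i j l := by
  have hreg' := hreg
  obtain ⟨xy, xz, yz, xX, xY, xZ, yX, yY, yZ, zX, zY, zZ⟩ := hreg'
  refine Runs.seq (Runs.fillFin ⟨xy, xX, xY, yX, yY⟩ hX hY hn hk (fun _ _ => 0)
    fun i j c' _ _ _ _ => by simp [RExp.eval, NExp.eval]) fun c1 h1 f1 => ?_
  have hw : ∀ u, u ≠ x → u ≠ y →
      u ∉ (CorePlanning.fill x X y Y b (.nat (.lit 0))).natW := fun u h h' => by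
    simp [CorePlanning.fill, CorePlanning.forLoop, Cmd.natW, h, h']
  refine Runs.accum hreg ((f1.nat X (hw _ xX.symm yX.symm)).trans hX)
    ((f1.nat Y (hw _ xY.symm yY.symm)).trans hY) ((f1.nat Z (hw _ xZ.symm yZ.symm)).trans hZ) hn hk hr
    (fun i j l => if h : i < n ∧ j < k ∧ l < r then v ⟨i, h.1⟩ ⟨j, h.2.1⟩ ⟨l, h.2.2⟩ else 0) ?_ ?_
  · intro i hi j hj l hl c' f h2 h3 h4
    rw [dif_pos ⟨hi, hj, hl⟩]
    exact he ⟨i, hi⟩ ⟨j, hj⟩ ⟨l, hl⟩ c' ((f1.mono (Cmd.Sub.seq_left _ _)).trans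
      (f.mono (Cmd.Sub.seq_right _ _))) h2 h3 h4
  · intro c' _ h i j
    rw [h, h1.1, zero_add, if_pos ⟨i.2, j.2⟩, Finset.sum_range]
    simp

theorem Runs.set {b : ℕ} {i j : NExp} {e : RExp} {i0 j0 : ℕ} {v : ℝ} (hi : i.eval c = i0)
    (hj : j.eval c = j0) (he : e.eval c = v) :
    Runs φ core ω N (.setReal b i j e) c fun c' => c'.real b i0 j0 = v ∧
      ∀ i' j', ¬ (i' = i0 ∧ j' = j0) → c'.real b i' j' = c.real b i' j' := by
  subst hi hj he
  refine Runs.setReal ⟨by simp [Config.writeReal], fun i' j' h => ?_⟩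
  simp only [Config.writeReal, true_and]
  rw [if_neg h]

/-- The row `i` of the array `b` receives the feature vector of the state in register `x`. -/
def getRow (b : ℕ) (i : NExp) (x : ℕ) : Cmd :=
  CorePlanning.forLoop 7 0 (.getFeature b i (.reg 7) x (.reg 7))

theorem Runs.getRow {b x i0 : ℕ} {i : NExp} (hd : c.nat 0 = d) (hN : d ≤ N)
    (hi : ∀ c', Frame (getRow b i x) c c' → i.eval c' = i0) :
    Runs φ core ω N (CorePlanning.getRow b i x) c fun c' =>
      (∀ k : Fin d, c'.real b i0 k = φ (c.state x) k) ∧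
      ∀ i', i' ≠ i0 → c'.real b i' = c.real b i' := by
  refine Runs.forLoop (n := d) (by simp [CorePlanning.forLoop, Cmd.natW]) (by simp [Cmd.natW]) hd hN
    (fun l c' => (∀ k : Fin d, (k : ℕ) < l → c'.real b i0 k = φ (c.state x) k) ∧
      ∀ i', i' ≠ i0 → c'.real b i' = c.real b i') (fun _ _ _ h => h) ⟨by simp, by simp⟩ ?_ ?_
  · rintro l hl c' f h7 ⟨h1, h2⟩
    refine Runs.getFeature (l := ⟨l, hl⟩) h7 ⟨fun k hk => ?_, fun i' hi' => ?_⟩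
    · have h3 : c'.state x = c.state x := f.state x (by simp [CorePlanning.forLoop, Cmd.stateW])
      simp only [Config.writeReal, hi c' f, NExp.eval, h7, true_and, h3]
      split_ifs with h
      · congr 1
        exact Fin.ext h.symm
      · exact h1 k (by omega)
    · simp only [Config.writeReal, hi c' f, hi', false_and, and_false, if_false]
      exact h2 i' hi'
  · rintro c' - ⟨h1, h2⟩
    exact ⟨fun k => h1 k k.2, h2⟩

end Derived

/-! ## The memory layout -/

section Layout

variable {S A d m : ℕ}

/-- The sizes of the problem are stored in their registers. -/
structure Base (A d m : ℕ) (s0 : Fin S) (c : Config S) : Prop where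
  dim : c.nat 0 = d
  act : c.nat 1 = A
  num : c.nat 2 = m
  plus : c.nat 3 = m + 1
  one : c.nat 5 = 1
  st : c.state 0 = s0

/-- The program does not change the registers with the sizes of the problem. -/
def Cmd.keepsBase (p : Cmd) : Bool :=
  [0, 1, 2, 3, 5].all (fun x => !p.natW.contains x) && !p.stateW.contains 0

/-- The Boolean test is evaluated at each use on a concrete program. Register 5 always holds 1, so
vectors and scalars are handled as matrices with one row or one entry. -/
theorem Base.frame {s0 : Fin S} {c c' : Config S} {p : Cmd} (h : Base A d m s0 c) (f : Frame p c c')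
    (hp : p.keepsBase = true) : Base A d m s0 c' := by
  simp only [Cmd.keepsBase, List.all_cons, List.all_nil, Bool.and_true, Bool.and_eq_true,
    Bool.not_eq_true', List.contains_eq_mem, decide_eq_false_iff_not] at hp
  obtain ⟨⟨h0, h1, h2, h3, h5⟩, h6⟩ := hp
  exact ⟨(f.nat _ h0).trans h.dim, (f.nat _ h1).trans h.act, (f.nat _ h2).trans h.num,
    (f.nat _ h3).trans h.plus, (f.nat _ h5).trans h.one, (f.state _ h6).trans h.st⟩

/-- The memory contains the sizes, the parameters of the algorithm, the feature matrix of the core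
states and the generalized inverse. -/
structure Env (A : ℕ) (φ : Fin S → Fin d → ℝ) (core : Fin m ↪ Fin S) (s0 : Fin S) (T : ℕ) (γ η B : ℝ)
    (c : Config S) : Prop extends Base A d m s0 c where
  iter : c.nat 4 = T
  disc : c.real 0 0 0 = γ
  step : c.real 0 0 2 = η
  rad : c.real 0 0 3 = B
  stepRad : c.real 0 0 4 = η * B ^ 2
  rate : c.real 0 0 5 = 2 * ell A m γ / (1 - γ)
  mass : c.real 0 0 6 = γ / (1 - γ)
  gin : ∀ i j : Fin d, c.real 1 i j = ginv (corePhi φ core) i j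
  feat : ∀ (i : Fin m) (k : Fin d), c.real 2 i k = φ (core i) k

/-- The program does not change the part of the memory that is described by `Env`. -/
def Cmd.keepsEnv (p : Cmd) : Bool :=
  p.keepsBase && !p.natW.contains 4 && [0, 1, 2].all (fun x => !p.realW.contains x)

theorem Env.frame {φ : Fin S → Fin d → ℝ} {core : Fin m ↪ Fin S} {s0 : Fin S} {T : ℕ} {γ η B : ℝ}
    {c c' : Config S} {p : Cmd} (h : Env A φ core s0 T γ η B c) (f : Frame p c c')
    (hp : p.keepsEnv = true) : Env A φ core s0 T γ η B c' := by
  simp only [Cmd.keepsEnv, List.all_cons, List.all_nil, Bool.and_true, Bool.and_eq_true,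
    Bool.not_eq_true', List.contains_eq_mem, decide_eq_false_iff_not] at hp
  obtain ⟨⟨hb, h4⟩, h0, h1, h2⟩ := hp
  refine { h.toBase.frame f hb with
    iter := (f.nat _ h4).trans h.iter
    disc := ?_, step := ?_, rad := ?_, stepRad := ?_, rate := ?_, mass := ?_, gin := ?_, feat := ?_ }
  · rw [f.real _ h0, h.disc]
  · rw [f.real _ h0, h.step]
  · rw [f.real _ h0, h.rad]
  · rw [f.real _ h0, h.stepRad]
  · rw [f.real _ h0, h.rate]
  · rw [f.real _ h0, h.mass]
  · rw [f.real _ h1]; exact h.gin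
  · rw [f.real _ h2]; exact h.feat

/-- All loop bounds are at most `N`. -/
structure Bounds (A d m T N : ℕ) : Prop where
  one : 1 ≤ N
  dim : d ≤ N
  act : A ≤ N
  plus : m + 1 ≤ N
  iter : T ≤ N

theorem Bounds.num {A d m T N : ℕ} (h : Bounds A d m T N) : m ≤ N := (Nat.le_succ m).trans h.plus

end Layout

/-- The scalar with number `j`. -/
def scal (j : ℕ) : RExp := .cell 0 (.lit 0) (.lit j)

/-- The entry of the array `b` with the indices in the registers `x` and `y`. -/
def ent (b x y : ℕ) : RExp := .cell b (.reg x) (.reg y)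

/-- The entry of the first row of the array `b` with the index in the register `y`. -/
def vec (b y : ℕ) : RExp := .cell b (.lit 0) (.reg y)

/-- The first entry of the array `b`. -/
def sca (b : ℕ) : RExp := .cell b (.lit 0) (.lit 0)

/-! ## The proximal updates on the machine -/

section Updates

variable {S A d m : ℕ} {φ : Fin S → Fin d → ℝ} {core : Fin m ↪ Fin S} {ω : Tape S A}
  {N : ℕ} {c : Config S} {s0 : Fin S} {T : ℕ} {γ η B : ℝ}

/-- The primal update: from the point in array 3 and the gradient in array 7 to array 5. -/
def thetaCmd : Cmd :=
  .seq (sumInto 6 5 7 0 8 0 25 (.mul (ent 1 7 8) (vec 7 8))) <|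
  .seq (fill 6 5 7 0 26 (.sub (vec 3 7) (.mul (scal 4) (vec 25 7)))) <|
  .seq (sumInto 6 5 7 2 8 0 27 (.mul (ent 2 7 8) (vec 26 8))) <|
  .seq (sumInto 6 5 7 5 8 2 28 (.mul (vec 27 8) (vec 27 8))) <|
  .seq (.setReal 29 (.lit 0) (.lit 0) (.div (.sqrt (sca 28)) (scal 3))) <|
  .seq (.ite (.realLt (sca 29) (.nat (.lit 1)))
    (.setReal 29 (.lit 0) (.lit 0) (.nat (.lit 1))) .skip) <|
  fill 6 5 7 0 5 (.mul (.div (.nat (.lit 1)) (sca 29)) (vec 26 7))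

/-- The arrays 25 to 29 hold the solution of the normal equations, the unprojected point, its core
values, their squared norm, and finally the scaling factor. -/
theorem runs_thetaCmd (hE : Env A φ core s0 T γ η B c) (hN : Bounds A d m T N) {θ ξ : Fin d → ℝ}
    (hθ : ∀ j : Fin d, c.real 3 0 j = θ j) (hξ : ∀ j : Fin d, c.real 7 0 j = ξ j) :
    Runs φ core ω N thetaCmd c fun c' => ∀ j : Fin d, c'.real 5 0 j = linTheta φ core B η θ ξ j := by
  refine Runs.seq (Runs.sumInto (by decide) hE.one hE.dim hE.dim hN.one hN.dim hN.dim
    (fun _ j l => ginv (corePhi φ core) j l * ξ l) ?_) fun c1 h1 f1 => ?_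
  · intro i j l c' f hx hy hz
    have hE' := hE.frame f (by decide)
    simp [RExp.eval, NExp.eval, ent, vec, hy, hz, hE'.gin, f.real 7 (by decide), hξ]
  have hE1 := hE.frame f1 (by decide)
  have h1' : ∀ j : Fin d, c1.real 25 0 j = (ginv (corePhi φ core) *ᵥ ξ) j := fun j => h1 0 j
  rw [← f1.real 3 (by decide)] at hθ
  clear hξ h1 f1 hE
  set θt : Fin d → ℝ := θ - (η * B ^ 2) • (ginv (corePhi φ core) *ᵥ ξ) with hθt
  refine Runs.seq (Runs.fillFin (by decide) hE1.one hE1.dim hN.one hN.dim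
    (fun _ j => θt j) ?_) fun c2 h2 f2 => ?_
  · intro i j c' f hx hy _
    have hE' := hE1.frame f (by decide)
    simp [RExp.eval, NExp.eval, scal, vec, hy, hE'.stepRad, f.real 25 (by decide),
      f.real 3 (by decide), hθ, h1', hθt]
  have hE2 := hE1.frame f2 (by decide)
  have h2' : ∀ j : Fin d, c2.real 26 0 j = θt j := fun j => h2.1 0 j
  refine Runs.seq (Runs.sumInto (by decide) hE2.one hE2.num hE2.dim hN.one hN.num hN.dim
    (fun _ i l => φ (core i) l * θt l) ?_) fun c3 h3 f3 => ?_
  · intro i j l c' f hx hy hz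
    have hE' := hE2.frame f (by decide)
    simp [RExp.eval, NExp.eval, ent, vec, hy, hz, hE'.feat, f.real 26 (by decide), h2']
  have hE3 := hE2.frame f3 (by decide)
  have h3' : ∀ i : Fin m, c3.real 27 0 i = (corePhi φ core *ᵥ θt) i := fun i => h3 0 i
  rw [← f3.real 26 (by decide)] at h2'
  refine Runs.seq (Runs.sumInto (by decide) hE3.one hE3.one hE3.num hN.one hN.one hN.num
    (fun _ _ i => (corePhi φ core *ᵥ θt) i * (corePhi φ core *ᵥ θt) i) ?_) fun c4 h4 f4 => ?_
  · intro i j l c' f hx hy hz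
    simp [RExp.eval, NExp.eval, vec, hz, f.real 27 (by decide), h3']
  have hE4 := hE3.frame f4 (by decide)
  have h4' : √(c4.real 28 0 0) = coreNorm φ core θt := by
    rw [coreNorm]
    simp only [pow_two]
    exact congrArg _ (h4 0 0)
  rw [← f4.real 26 (by decide)] at h2'
  refine Runs.seq (Runs.set (i0 := 0) (j0 := 0) (v := coreNorm φ core θt / B) rfl rfl
    (by simp [RExp.eval, NExp.eval, sca, scal, h4', hE4.rad])) fun c5 h5 f5 => ?_
  have hE5 := hE4.frame f5 (by decide)
  rw [← f5.real 26 (by decide)] at h2'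
  refine Runs.seq (R' := fun c' => c'.real 29 0 0 = max 1 (coreNorm φ core θt / B)) ?_
    fun c6 h6 f6 => ?_
  · refine Runs.ite (fun h => ?_) fun h => ?_
    · simp only [BExp.Holds, RExp.eval, NExp.eval, sca, h5.1, Nat.cast_one] at h
      refine Runs.post (Runs.set (i0 := 0) (j0 := 0) (v := 1) rfl rfl
        (by simp [RExp.eval, NExp.eval])) fun c' h' _ => ?_
      rw [h'.1, max_eq_left h.le]
    · simp only [BExp.Holds, RExp.eval, NExp.eval, sca, h5.1, Nat.cast_one, not_lt] at h
      exact Runs.skip (by rw [h5.1, max_eq_right h])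
  have hE6 := hE5.frame f6 (by decide)
  rw [← f6.real 26 (by decide)] at h2'
  refine Runs.post (Runs.fillFin (by decide) hE6.one hE6.dim hN.one hN.dim
    (fun _ j => linTheta φ core B η θ ξ j) ?_) fun c' h _ j => h.1 0 j
  intro i j c' f hx hy _
  simp [RExp.eval, NExp.eval, sca, vec, hy, f.real 29 (by decide), f.real 26 (by decide), h6, h2',
    linTheta, hθt]

/-- The dual update: from the point in array 4 and the gradient in array 8 to array 6. -/
def lamCmd : Cmd :=
  .seq (fill 6 3 7 1 30 (.mul (ent 4 6 7) (.exp (.mul (scal 5) (.mul (scal 2) (ent 8 6 7)))))) <|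
  .seq (sumInto 6 5 7 3 8 1 31 (ent 30 7 8)) <|
  .seq (sumInto 6 5 7 5 8 2 32 (.cell 31 (.lit 0) (.add (.reg 8) (.lit 1)))) <|
  .seq (fill 6 3 7 1 6 (.div (.mul (scal 6) (ent 30 6 7)) (sca 32))) <|
  fill 6 5 7 1 6 (.div (vec 30 7) (sca 31))

/-- Array 30 holds the unnormalized weights, 31 their row sums and 32 the mass of the core rows. All
rows are first normalized as core rows, and row 0 is then overwritten. -/
theorem runs_lamCmd (hE : Env A φ core s0 T γ η B c) (hN : Bounds A d m T N)
    {lam ρ : Fin (m + 1) → Fin A → ℝ} (hl : ∀ (i : Fin (m + 1)) (a : Fin A), c.real 4 i a = lam i a)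
    (hρ : ∀ (i : Fin (m + 1)) (a : Fin A), c.real 8 i a = ρ i a) :
    Runs φ core ω N lamCmd c fun c' =>
      ∀ (i : Fin (m + 1)) (a : Fin A), c'.real 6 i a = proxLam γ η lam ρ i a := by
  set lt : Fin (m + 1) → Fin A → ℝ := fun i a =>
    lam i a * Real.exp (2 * ell A m γ / (1 - γ) * (η * ρ i a)) with hlt
  refine Runs.seq (Runs.fillFin (by decide) hE.plus hE.act hN.plus hN.act lt ?_) fun c1 h1 f1 => ?_
  · intro i j c' f hx hy _
    have hE' := hE.frame f (by decide)
    simp [RExp.eval, NExp.eval, scal, ent, hx, hy, f.real 4 (by decide), f.real 8 (by decide), hl, hρ,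
      hE'.rate, hE'.step, hlt]
  have hE1 := hE.frame f1 (by decide)
  replace h1 := h1.1
  refine Runs.seq (Runs.sumInto (by decide) hE1.one hE1.plus hE1.act hN.one hN.plus hN.act
    (fun _ i a => lt i a) ?_) fun c2 h2 f2 => ?_
  · intro i j l c' f hx hy hz
    simp [RExp.eval, NExp.eval, ent, hy, hz, f.real 30 (by decide), h1]
  have hE2 := hE1.frame f2 (by decide)
  have h2' : ∀ i : Fin (m + 1), c2.real 31 0 i = ∑ b, lt i b := fun i => h2 0 i
  rw [← f2.real 30 (by decide)] at h1
  refine Runs.seq (Runs.sumInto (by decide) hE2.one hE2.one hE2.num hN.one hN.one hN.num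
    (fun _ _ j => ∑ b, lt j.succ b) ?_) fun c3 h3 f3 => ?_
  · intro i j l c' f hx hy hz
    rw [← h2']
    simp [RExp.eval, NExp.eval, hz, f.real 31 (by decide)]
  have hE3 := hE2.frame f3 (by decide)
  have h3' : c3.real 32 0 0 = ∑ j : Fin m, ∑ b, lt j.succ b := h3 0 0
  rw [← f3.real 30 (by decide)] at h1
  rw [← f3.real 31 (by decide)] at h2'
  refine Runs.seq (Runs.fillFin (by decide) hE3.plus hE3.act hN.plus hN.act
    (fun i a => γ / (1 - γ) * lt i a / ∑ j : Fin m, ∑ b, lt j.succ b) ?_) fun c4 h4 f4 => ?_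
  · intro i j c' f hx hy _
    have hE' := hE3.frame f (by decide)
    simp [RExp.eval, NExp.eval, scal, ent, sca, hx, hy, f.real 30 (by decide), f.real 32 (by decide),
      h1, h3', hE'.mass]
  have hE4 := hE3.frame f4 (by decide)
  rw [← f4.real 30 (by decide)] at h1
  rw [← f4.real 31 (by decide)] at h2'
  replace h4 := h4.1
  refine Runs.post (Runs.fillFin (by decide) hE4.one hE4.act hN.one hN.act
    (fun _ a => lt 0 a / ∑ b, lt 0 b) ?_) fun c' h _ i a => ?_
  · intro i j c' f hx hy _
    have e1 := h1 0 j
    have e2 := h2' 0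
    simp only [Fin.val_zero] at e1 e2
    simp [RExp.eval, NExp.eval, vec, sca, hy, f.real 30 (by decide), f.real 31 (by decide), e1, e2]
  · simp only [proxLam]
    split_ifs with hi
    · subst hi
      exact h.1 0 a
    · rw [h.2 i a (Nat.one_le_iff_ne_zero.2 (Fin.val_ne_zero_iff.2 hi)), h4]

end Updates

/-! ## Sampling an index on the machine -/

section Scan

variable {S A d m : ℕ} {φ : Fin S → Fin d → ℝ} {core : Fin m ↪ Fin S} {ω : Tape S A}
  {N : ℕ} {c : Config S}

/-- The sum of the entries of `w` that do not come after `(i, j)` in the lexicographic order. -/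
def cumul (w : ℕ → ℕ → ℝ) (A i j : ℕ) : ℝ :=
  ∑ i' ∈ Finset.range i, ∑ a ∈ Finset.range A, w i' a + ∑ a ∈ Finset.range (j + 1), w i a

/-- One step of the search: the weight of the current index is added to the cumulative weight, and
the index is recorded if it is the first one that reaches the threshold. -/
def scanStep (b : ℕ) : Cmd :=
  .seq (.setReal 17 (.lit 0) (.lit 0) (.add (sca 17) (ent b 6 7))) <|
  .ite (.natLt (.reg 12) (.lit 1))
    (.ite (.realLt (sca 17) (.mul (sca 13) (sca 15))) .skip
      (.seq (.setNat 12 (.lit 1)) (.seq (.setNat 10 (.reg 6)) (.setNat 11 (.reg 7))))) .skip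

/-- The registers 10 and 11 receive the first index, in the lexicographic order, for which the
cumulative weight of the array `b` reaches the product of the arrays 13 and 15. -/
def scanCmd (X b : ℕ) : Cmd :=
  .seq (.setNat 12 (.lit 0)) <|
  .seq (.setReal 17 (.lit 0) (.lit 0) (.nat (.lit 0))) <|
  forLoop 6 X (forLoop 7 1 (scanStep b))

/-- The hypothesis `h` says that the threshold is reached exactly from (i₀, j₀) on in lexicographic
order, which separates the search from the definition of `pick`. -/
theorem runs_scanCmd {X b n i₀ j₀ : ℕ} (hX : X ∉ [6, 7, 10, 11, 12]) (hb : b ≠ 17)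
    (hn : c.nat X = n) (hA : c.nat 1 = A) (hnN : n ≤ N) (hAN : A ≤ N) (hi₀ : i₀ < n) (hj₀ : j₀ < A)
    (h : ∀ i < n, ∀ j < A, c.real 13 0 0 * c.real 15 0 0 ≤ cumul (c.real b) A i j ↔
      i₀ < i ∨ i₀ = i ∧ j₀ ≤ j) :
    Runs φ core ω N (scanCmd X b) c fun c' => c'.nat 10 = i₀ ∧ c'.nat 11 = j₀ := by
  simp only [List.mem_cons, List.not_mem_nil, or_false, not_or] at hX
  refine Runs.seq (R' := fun c' => c'.nat 12 = 0)
    (Runs.setNat (by simp [Config.writeNat, NExp.eval])) fun c1 h1 f1 => ?_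
  refine Runs.seq (Runs.set (i0 := 0) (j0 := 0) (v := 0) rfl rfl
    (by simp [RExp.eval, NExp.eval])) fun c2 h2 f2 => ?_
  have f12 : ∀ x, x ≠ 12 → c2.nat x = c.nat x := fun x hx => by
    rw [f2.nat x (by simp [Cmd.natW]), f1.nat x (by simpa [Cmd.natW] using hx)]
  have g12 : ∀ x, x ≠ 17 → c2.real x = c.real x := fun x hx => by
    rw [f2.real x (by simpa [Cmd.realW] using hx), f1.real x (by simp [Cmd.realW])]
  have h12 : c2.nat 12 = 0 := (f2.nat 12 (by simp [Cmd.natW])).trans h1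
  replace h2 := h2.1
  rw [← g12 13 (by decide), ← g12 15 (by decide), ← g12 b hb] at h
  replace hn := (f12 X (by tauto)).trans hn
  replace hA := (f12 1 (by decide)).trans hA
  clear f12 g12 f1 f2 h1
  set w := c2.real b with hw
  have hwr : (forLoop 6 X (forLoop 7 1 (scanStep b))).realW = [17] := rfl
  -- Before index (i, j) is examined, array 17 holds the weight of all earlier indices, and the flag
  -- in register 12 tells whether (i₀, j₀) is among them.
  set J : ℕ → ℕ → Config S → Prop := fun i j c' =>
    c'.real 17 0 0 = ∑ i' ∈ Finset.range i, ∑ a ∈ Finset.range A, w i' a + ∑ a ∈ Finset.range j, w i a ∧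
    (if i₀ < i ∨ i₀ = i ∧ j₀ < j then c'.nat 12 = 1 ∧ c'.nat 10 = i₀ ∧ c'.nat 11 = j₀
      else c'.nat 12 = 0) with hJ
  have hJw : ∀ i j c' x v, x = 6 ∨ x = 7 → J i j c' → J i j (c'.writeNat x v) := by
    rintro i j c' x v hx ⟨e1, e2⟩
    refine ⟨e1, ?_⟩
    rcases hx with rfl | rfl <;> simpa [Config.writeNat] using e2
  refine Runs.forLoop (n := n)
    (by simp [forLoop, scanStep, Cmd.natW, hX]) (by simp [forLoop, scanStep, Cmd.natW]) hn hnN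
    (fun i c' => J i 0 c') (fun k c' v hk => hJw _ _ _ _ _ (Or.inl rfl) hk)
    ⟨by simp [h2], by simp [h12]⟩ ?_ ?_
  · intro i hi c3 f3 h6 hI3
    refine Runs.forLoop (n := A) (by simp [forLoop, scanStep, Cmd.natW])
      (by simp [scanStep, Cmd.natW]) ((f3.nat 1 (by simp [forLoop, scanStep, Cmd.natW])).trans hA) hAN
      (fun j c' => J i j c') (fun k c' v hk => hJw _ _ _ _ _ (Or.inr rfl) hk) hI3 ?_ ?_
    · intro j hj c4 f4 h7 hI4
      have f5 := f3.trans (f4.mono (sub_forLoop 6 X _))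
      have h6' : c4.nat 6 = i := (f4.nat 6 (by simp [forLoop, scanStep, Cmd.natW])).trans h6
      have e13 := f5.real 13 (by simp [hwr])
      have e15 := f5.real 15 (by simp [hwr])
      have eb : c4.real b = w := f5.real b (by simp [hwr, hb])
      refine Runs.seq (Runs.set (i0 := 0) (j0 := 0) (v := cumul w A i j) rfl rfl ?_) fun c6 h6s f6 => ?_
      · simp only [RExp.eval, NExp.eval, sca, ent, eb, h6', h7, hI4.1, cumul, Finset.sum_range_succ]
        ring
      · have n12 := f6.nat 12 (by simp [Cmd.natW])
        have n10 := f6.nat 10 (by simp [Cmd.natW])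
        have n11 := f6.nat 11 (by simp [Cmd.natW])
        have n6 := (f6.nat 6 (by simp [Cmd.natW])).trans h6'
        have n7 := (f6.nat 7 (by simp [Cmd.natW])).trans h7
        have g13 := (f6.real 13 (by simp [Cmd.realW])).trans e13
        have g15 := (f6.real 15 (by simp [Cmd.realW])).trans e15
        have hs := h6s.1
        have hI := hI4.2
        rw [← n12, ← n10, ← n11] at hI
        have hh := h i hi j hj
        rw [← g13, ← g15] at hh
        have hJ1 : c6.real 17 0 0 = ∑ i' ∈ Finset.range i, ∑ a ∈ Finset.range A, w i' a +
          ∑ a ∈ Finset.range (j + 1), w i a := hs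
        refine Runs.ite (fun hc => ?_) fun hc => ?_
        · have hc : c6.nat 12 < 1 := hc
          have hlt : ¬ (i₀ < i ∨ i₀ = i ∧ j₀ < j) := fun h' => by rw [if_pos h'] at hI; omega
          refine Runs.ite (fun hd => ?_) fun hd => ?_
          · simp only [BExp.Holds, RExp.eval, NExp.eval, sca, hs] at hd
            have := (not_congr hh).1 (not_le.2 hd)
            refine Runs.skip ⟨hJ1, ?_⟩
            rw [if_neg (by omega)]
            omega
          · simp only [BExp.Holds, RExp.eval, NExp.eval, sca, hs, not_lt] at hd
            have := hh.1 hd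
            obtain ⟨rfl, rfl⟩ : i₀ = i ∧ j₀ = j := by omega
            refine Runs.seq (Runs.setNat rfl) fun c7 (h7 : _ = c7) _ => ?_
            refine Runs.seq (Runs.setNat rfl) fun c8 (h8 : _ = c8) _ => ?_
            refine Runs.setNat ⟨?_, ?_⟩
            · subst h8 h7; exact hJ1
            · subst h8 h7
              simp [Config.writeNat, NExp.eval, n6, n7]
        · have hc : ¬ c6.nat 12 < 1 := hc
          refine Runs.skip ⟨hJ1, ?_⟩
          by_cases h' : i₀ < i ∨ i₀ = i ∧ j₀ < j
          · rw [if_pos h'] at hI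
            rw [if_pos (by omega)]
            exact hI
          · rw [if_neg h'] at hI
            omega
    · rintro c' - ⟨e1, e2⟩
      refine ⟨?_, ?_⟩
      · rw [e1, Finset.sum_range_succ]; simp
      -- Since j₀ < A, the end of row i and the beginning of row i + 1 describe the same set of
      -- indices.
      · have : (i₀ < i + 1 ∨ i₀ = i + 1 ∧ j₀ < 0) ↔ (i₀ < i ∨ i₀ = i ∧ j₀ < A) := by omega
        rwa [if_congr this rfl rfl]
  · rintro c' - ⟨-, e2⟩
    rw [if_pos (Or.inl hi₀)] at e2
    exact e2.2

theorem sum_fin_lt {n k : ℕ} (hk : k ≤ n) (f : ℕ → ℝ) :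
    (∑ a : Fin n, if (a : ℕ) < k then f a else 0) = ∑ a ∈ Finset.range k, f a := by
  rw [← Finset.sum_range fun a => if a < k then f a else 0, ← Finset.sum_filter]
  congr 1
  ext a
  simp only [Finset.mem_filter, Finset.mem_range]
  omega

/-- The cumulative sums of weights on `Fin n ×ₗ Fin A`. -/
theorem sum_le_lex {n : ℕ} (w : ℕ → ℕ → ℝ) (k : Fin n ×ₗ Fin A) :
    ∑ q : Fin n ×ₗ Fin A with q ≤ k, w (ofLex q).1 (ofLex q).2 =
      cumul w A (ofLex k).1 (ofLex k).2 := by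
  obtain ⟨⟨i, j⟩, rfl⟩ := toLex.surjective k
  have h1 : ∑ q : Fin n ×ₗ Fin A with q ≤ toLex (i, j), w (ofLex q).1 (ofLex q).2 =
      ∑ i' : Fin n, ∑ a : Fin A, if i' < i ∨ i' = i ∧ a ≤ j then w i' a else 0 := by
    rw [Finset.sum_filter,
      ← sum_lex fun (i' : Fin n) (a : Fin A) => if i' < i ∨ i' = i ∧ a ≤ j then w i' a else 0]
    refine Finset.sum_congr rfl fun q _ => if_congr ?_ rfl rfl
    rw [Prod.Lex.le_iff, ofLex_toLex]
  have h2 : ∀ i' : Fin n, (∑ a : Fin A, if i' < i ∨ i' = i ∧ a ≤ j then w i' a else 0) =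
      (if (i' : ℕ) < i then ∑ a ∈ Finset.range A, w i' a else 0) +
        if i' = i then ∑ a ∈ Finset.range (j + 1), w i a else 0 := fun i' => by
    rcases lt_trichotomy i' i with hlt | rfl | hlt
    · simp [hlt, hlt.ne, Finset.sum_range]
    · rw [← sum_fin_lt (Nat.succ_le_of_lt j.2) fun a => w i' a]
      simp
    · simp [hlt.not_gt, hlt.ne']
  rw [h1, Finset.sum_congr rfl fun i' _ => h2 i', Finset.sum_add_distrib,
    sum_fin_lt i.2.le fun i' => ∑ a ∈ Finset.range A, w i' a, Finset.sum_ite_eq' Finset.univ i]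
  simp [cumul]

variable [NeZero A]

/-- The search finds the picked index of `Fin n ×ₗ Fin A`. -/
theorem runs_scanCmd_lex {X b n : ℕ} [NeZero n] (hX : X ∉ [6, 7, 10, 11, 12]) (hb : b ≠ 17)
    (hn : c.nat X = n) (hA : c.nat 1 = A) (hnN : n ≤ N) (hAN : A ≤ N) {w : Fin n → Fin A → ℝ}
    (hw : ∀ (i : Fin n) (a : Fin A), c.real b i a = w i a) (hw0 : ∀ i a, 0 ≤ w i a) (u : unitInterval)
    (hu : c.real 13 0 0 = u) (hW : c.real 15 0 0 = ∑ i, ∑ a, w i a) :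
    Runs φ core ω N (scanCmd X b) c fun c' =>
      c'.nat 10 = (ofLex (pick (fun q : Fin n ×ₗ Fin A => w (ofLex q).1 (ofLex q).2) u)).1 ∧
      c'.nat 11 = (ofLex (pick (fun q : Fin n ×ₗ Fin A => w (ofLex q).1 (ofLex q).2) u)).2 := by
  set k := pick (fun q : Fin n ×ₗ Fin A => w (ofLex q).1 (ofLex q).2) u with hk
  refine runs_scanCmd hX hb hn hA hnN hAN (ofLex k).1.2 (ofLex k).2.2 fun i hi j hj => ?_
  have h1 := pick_le_iff (w := fun q : Fin n ×ₗ Fin A => w (ofLex q).1 (ofLex q).2)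
    (fun q => hw0 _ _) u.2.2 (toLex (⟨i, hi⟩, ⟨j, hj⟩))
  have h2 := sum_le_lex (c.real b) (toLex (⟨i, hi⟩, ⟨j, hj⟩) : Fin n ×ₗ Fin A)
  simp only [hw, ofLex_toLex] at h2
  rw [← hk, sum_lex w, h2, Prod.Lex.le_iff] at h1
  rw [hu, hW, ← h1]
  simp [Fin.ext_iff, Fin.lt_def, Fin.le_def]

/-- The search in a single row finds the picked index of `Fin A`. -/
theorem runs_scanCmd_row {X b : ℕ} (hX : X ∉ [6, 7, 10, 11, 12]) (hb : b ≠ 17)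
    (hn : c.nat X = 1) (hA : c.nat 1 = A) (hnN : 1 ≤ N) (hAN : A ≤ N) {w : Fin A → ℝ}
    (hw : ∀ a : Fin A, c.real b 0 a = w a) (hw0 : ∀ a, 0 ≤ w a) (u : unitInterval)
    (hu : c.real 13 0 0 = u) (hW : c.real 15 0 0 = ∑ a, w a) :
    Runs φ core ω N (scanCmd X b) c fun c' => c'.nat 11 = pick w u := by
  refine Runs.post (runs_scanCmd hX hb hn hA hnN hAN (i₀ := 0) zero_lt_one (pick w u).2
    fun i hi j hj => ?_) fun c' h _ => h.2
  obtain rfl : i = 0 := by omega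
  have h1 := pick_le_iff hw0 u.2.2 ⟨j, hj⟩
  have h2 : ∑ a with a ≤ (⟨j, hj⟩ : Fin A), w a = cumul (c.real b) A 0 j := by
    rw [Finset.sum_filter, cumul, ← sum_fin_lt (Nat.succ_le_of_lt hj) fun a => c.real b 0 a]
    simp [hw, Fin.le_def]
  rw [h2] at h1
  rw [hu, hW, ← h1]
  simp [Fin.le_def]

end Scan

/-! ## The gradient estimates on the machine -/

section Gradients

variable {S A d m : ℕ} {φ : Fin S → Fin d → ℝ} {core : Fin m ↪ Fin S} {ω : Tape S A}
  {N : ℕ} {c : Config S} {s0 : Fin S} {T : ℕ} {γ η B : ℝ}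

theorem notMem_of_contains {l : List ℕ} {x : ℕ} (h : l.contains x = false) : x ∉ l := by
  simpa using h

theorem Frame.nat' {p : Cmd} {c c' : Config S} (f : Frame p c c') {x : ℕ}
    (h : p.natW.contains x = false) : c'.nat x = c.nat x :=
  f.nat x (notMem_of_contains h)

theorem Frame.real' {p : Cmd} {c c' : Config S} (f : Frame p c c') {b : ℕ}
    (h : p.realW.contains b = false) : c'.real b = c.real b :=
  f.real b (notMem_of_contains h)

theorem Frame.state' {p : Cmd} {c c' : Config S} (f : Frame p c c') {x : ℕ}
    (h : p.stateW.contains x = false) : c'.state x = c.state x :=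
  f.state x (notMem_of_contains h)

theorem Runs.call {y b x i0 j0 : ℕ} {i j a : NExp} {s : Fin S} {l : Fin A} {k : ℕ}
    (hi : i.eval c = i0) (hj : j.eval c = j0) (hs : c.state x = s) (ha : a.eval c = l)
    (hk : c.calls = k) :
    Runs φ core ω N (.simulate y b i j x a) c fun c' => c'.real b i0 j0 = (ω.1 k s l).2 ∧
      (∀ i' j', ¬ (i' = i0 ∧ j' = j0) → c'.real b i' j' = c.real b i' j') ∧
      c'.state y = (ω.1 k s l).1 ∧ c'.calls = k + 1 := by
  subst hi hj hs hk
  refine Runs.simulate ha ⟨by simp [Config.writeReal, Config.writeState, Config.countCall],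
    fun i' j' h => ?_, by simp [Config.writeState, Config.countCall],
    by simp [Config.writeReal, Config.writeState, Config.countCall]⟩
  simp only [Config.writeReal, Config.writeState, Config.countCall, true_and]
  rw [if_neg h]

/-- A simulator call at the state in register `x` and the action in register 11; the features of
the state and of the next state are stored in the arrays 21 and 22. -/
def visitCmd (x : ℕ) : Cmd :=
  .seq (.simulate 2 18 (.lit 0) (.lit 0) x (.reg 11)) <|
  .seq (getRow 21 (.lit 0) x) (getRow 22 (.lit 0) 2)

/-- The successor goes to state register 2, and the features of the source are read after the call;
hence `x ≠ 2`. -/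
theorem runs_visitCmd {x : ℕ} (hx : x ≠ 2) (hd : c.nat 0 = d) (hN : d ≤ N) {s : Fin S}
    (hs : c.state x = s) {a : Fin A} (ha : c.nat 11 = a) {k : ℕ} (hk : c.calls = k) :
    Runs φ core ω N (visitCmd x) c fun c' => (∀ l : Fin d, c'.real 21 0 l = φ s l) ∧
      (∀ l : Fin d, c'.real 22 0 l = φ (ω.1 k s a).1 l) ∧ c'.calls = k + 1 := by
  refine Runs.seq (Runs.call (i0 := 0) (j0 := 0) (l := a) rfl rfl hs ha hk) fun c1 h1 f1 => ?_
  obtain ⟨-, -, h2, h3⟩ := h1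
  have hs1 : c1.state x = s := (f1.state x (by simpa [Cmd.stateW] using hx)).trans hs
  have hd1 := (f1.nat' (x := 0) rfl).trans hd
  refine Runs.seq (Runs.getRow (i0 := 0) hd1 hN fun _ _ => rfl) fun c2 h4 f2 => ?_
  have hd2 := (f2.nat' (x := 0) rfl).trans hd1
  refine Runs.post (Runs.getRow (i0 := 0) hd2 hN fun _ _ => rfl) fun c3 h5 f3 => ?_
  refine ⟨fun l => ?_, fun l => ?_, ?_⟩
  · rw [f3.real' rfl, h4.1, hs1]
  · rw [h5.1, f2.state' rfl, h2]
  · rw [f3.calls rfl, f2.calls rfl, h3]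

/-- The predecessor of the number in register 10 is computed in register 13. -/
def predCmd : Cmd :=
  .seq (.setNat 13 (.lit 0)) <|
  .loop (.natLt (.add (.reg 13) (.lit 1)) (.reg 10)) (.setNat 13 (.add (.reg 13) (.lit 1)))

/-- The machine cannot subtract natural numbers, so the predecessor is found by counting up. It is
needed because row j + 1 belongs to core state j. -/
theorem runs_predCmd {i : ℕ} (hi : c.nat 10 = i + 1) (hN : i ≤ N) :
    Runs φ core ω N predCmd c fun c' => c'.nat 13 = i := by
  refine Runs.seq (R' := fun c' => c'.nat 13 = 0) (Runs.setNat (by simp [Config.writeNat, NExp.eval]))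
    fun c1 h1 f1 => ?_
  have hi1 := (f1.nat' (x := 10) rfl).trans hi
  refine Runs.loop hN (fun k c' => c'.nat 13 = k ∧ c'.nat 10 = i + 1) ⟨h1, hi1⟩ ?_ ?_
    fun c' h => h.1
  · rintro k hk c' ⟨h2, h3⟩
    refine ⟨?_, Runs.setNat ⟨by simp [Config.writeNat, NExp.eval, h2], by simp [Config.writeNat, h3]⟩⟩
    simp only [BExp.Holds, NExp.eval, h2, h3]
    omega
  · rintro c' ⟨h2, h3⟩
    simp [BExp.Holds, NExp.eval, h2, h3]

/-- A simulator call at the state with the number in register 10 and the action in register 11. -/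
def sampleCmd : Cmd :=
  .ite (.natLt (.reg 10) (.lit 1)) (visitCmd 0)
    (.seq predCmd (.seq (.getCore 1 (.reg 13)) (visitCmd 1)))

theorem runs_sampleCmd (hE : Env A φ core s0 T γ η B c) (hN : Bounds A d m T N) {i : Fin (m + 1)}
    (hi : c.nat 10 = i) {a : Fin A} (ha : c.nat 11 = a) {k : ℕ} (hk : c.calls = k) :
    Runs φ core ω N sampleCmd c fun c' => (∀ l : Fin d, c'.real 21 0 l = φ (plus core s0 i) l) ∧
      (∀ l : Fin d, c'.real 22 0 l = φ (ω.1 k (plus core s0 i) a).1 l) ∧ c'.calls = k + 1 := by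
  refine Runs.ite (fun h => ?_) fun h => ?_
  · have h : c.nat 10 < 1 := h
    obtain rfl : i = 0 := Fin.ext (by rw [Fin.val_zero]; omega)
    exact runs_visitCmd (by decide) hE.dim hN.dim hE.st ha hk
  · have h : ¬ c.nat 10 < 1 := h
    obtain ⟨j, rfl⟩ : ∃ j : Fin m, i = j.succ := Fin.exists_succ_eq.2 (by rintro rfl; simp [hi] at h)|>.imp
      fun _ h => h.symm
    rw [Fin.val_succ] at hi
    refine Runs.seq (runs_predCmd hi (j.2.le.trans hN.num)) fun c1 h1 f1 => ?_
    refine Runs.seq (R' := fun c' => c'.state 1 = core j)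
      (Runs.getCore (k := j) h1 (by simp [Config.writeState])) fun c2 h2 f2 => ?_
    exact runs_visitCmd (by decide) (((hE.frame f1 rfl).frame f2 rfl).dim) hN.dim h2
      (((f2.nat' rfl).trans (f1.nat' rfl)).trans ha) (((f2.calls rfl).trans (f1.calls rfl)).trans hk)

/-- The estimate of the primal gradient at the point in the arrays 5 and 6. -/
def xiCmd : Cmd :=
  .seq (.draw 13 (.lit 0) (.lit 0)) <|
  .seq (sumInto 6 5 7 3 8 1 14 (ent 6 7 8)) <|
  .seq (sumInto 6 5 7 5 8 3 15 (vec 14 8)) <|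
  .seq (scanCmd 3 6) <|
  .seq sampleCmd <|
  .seq (getRow 23 (.lit 0) 0) <|
  fill 6 5 7 0 7 (.add (vec 23 7) (.mul (sca 15) (.sub (.mul (scal 0) (vec 22 7)) (vec 21 7))))

/-- The counters of calls and draws are tracked exactly, because they are the tape indices at which
`estTheta` reads. Nonnegative weights allow ‖λ‖₁ to be computed as a plain sum. -/
theorem runs_xiCmd [NeZero A] (hE : Env A φ core s0 T γ η B c) (hN : Bounds A d m T N)
    {lam : Fin (m + 1) → Fin A → ℝ} (hl : ∀ (i : Fin (m + 1)) (a : Fin A), c.real 6 i a = lam i a)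
    (hl0 : ∀ i a, 0 ≤ lam i a) {h : ℕ} (hc : c.calls = h * callsPerGradient A m) (hd : c.draws = h) :
    Runs φ core ω N xiCmd c fun c' =>
      (∀ j : Fin d, c'.real 7 0 j = estTheta γ φ core s0 ω h lam j) ∧
      c'.calls = h * callsPerGradient A m + 1 ∧ c'.draws = h + 1 := by
  refine Runs.seq (R' := fun c' => c'.real 13 0 0 = ω.2 h ∧ c'.draws = h + 1)
    (Runs.draw ⟨by simp [Config.writeReal, Config.countDraw, NExp.eval, hd],
      by simp [Config.writeReal, Config.countDraw, hd]⟩) fun c1 h1 f1 => ?_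
  obtain ⟨hu, hd1⟩ := h1
  have hE1 := hE.frame f1 rfl
  have hc1 := (f1.calls rfl).trans hc
  rw [← f1.real' (b := 6) rfl] at hl
  refine Runs.seq (Runs.sumInto (by decide) hE1.one hE1.plus hE1.act hN.one hN.plus hN.act
    (fun _ i a => lam i a) ?_) fun c2 h2 f2 => ?_
  · intro i j l c' f hx hy hz
    simp [RExp.eval, NExp.eval, ent, hy, hz, f.real' (b := 6) rfl, hl]
  have hE2 := hE1.frame f2 rfl
  have h2' : ∀ i : Fin (m + 1), c2.real 14 0 i = ∑ a, lam i a := fun i => h2 0 i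
  refine Runs.seq (Runs.sumInto (by decide) hE2.one hE2.one hE2.plus hN.one hN.one hN.plus
    (fun _ _ i => ∑ a, lam i a) ?_) fun c3 h3 f3 => ?_
  · intro i j l c' f hx hy hz
    simp [RExp.eval, NExp.eval, vec, hz, f.real' (b := 14) rfl, h2']
  have hE3 := hE2.frame f3 rfl
  have h3' : c3.real 15 0 0 = ∑ i, ∑ a, lam i a := h3 0 0
  rw [← f2.real' (b := 6) rfl, ← f3.real' (b := 6) rfl] at hl
  rw [← f2.real' (b := 13) rfl, ← f3.real' (b := 13) rfl] at hu
  refine Runs.seq (runs_scanCmd_lex (by decide) (by decide) hE3.plus hE3.act hN.plus hN.act hl hl0 _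
    hu h3') fun c4 h4 f4 => ?_
  have hE4 := hE3.frame f4 rfl
  have hc4 : c4.calls = h * callsPerGradient A m := by
    rw [f4.calls rfl, f3.calls rfl, f2.calls rfl, hc1]
  refine Runs.seq (runs_sampleCmd hE4 hN h4.1 h4.2 hc4) fun c5 h5 f5 => ?_
  have hE5 := hE4.frame f5 rfl
  obtain ⟨h51, h52, h53⟩ := h5
  refine Runs.seq (Runs.getRow (i0 := 0) hE5.dim hN.dim fun _ _ => rfl) fun c6 h6 f6 => ?_
  have hE6 := hE5.frame f6 rfl
  replace h6 := h6.1
  rw [hE5.st] at h6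
  rw [← f6.real' (b := 21) rfl] at h51
  rw [← f6.real' (b := 22) rfl] at h52
  rw [← f4.real' (b := 15) rfl, ← f5.real' (b := 15) rfl, ← f6.real' (b := 15) rfl] at h3'
  refine Runs.post (Runs.fillFin (by decide) hE6.one hE6.dim hN.one hN.dim
    (fun _ j => estTheta γ φ core s0 ω h lam j) ?_) fun c7 h7 f7 => ?_
  · intro i j c' f hx hy _
    have hE' := hE6.frame f rfl
    simp only [RExp.eval, NExp.eval, vec, sca, scal, hy, f.real' (b := 23) rfl,
      f.real' (b := 22) rfl, f.real' (b := 21) rfl, f.real' (b := 15) rfl, h6, h51, h52, h3', hE'.disc,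
      estTheta, Pi.add_apply, Pi.smul_apply, Pi.sub_apply, smul_eq_mul, abs_of_nonneg (hl0 _ _)]
  · refine ⟨fun j => h7.1 0 j, ?_, ?_⟩
    · rw [f7.calls rfl, f6.calls rfl, h53]
    · rw [f7.draws rfl, f6.draws rfl, f5.draws rfl, f4.draws rfl, f3.draws rfl, f2.draws rfl, hd1]

/-- The component of the dual gradient estimate at the state in register `x`, in row `i`, and the
action in register 15. -/
def advCmd (x : ℕ) (i : NExp) : Cmd :=
  .seq (.simulate 2 8 i (.reg 15) x (.reg 15)) <|
  .seq (getRow 22 (.lit 0) 2) <|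
  .seq (sumInto 6 5 7 5 8 0 24 (.mul (.sub (.mul (scal 0) (vec 22 8)) (vec 21 8)) (vec 5 8))) <|
  .setReal 8 i (.reg 15) (.add (.cell 8 i (.reg 15)) (sca 24))

/-- The row `i` of the dual gradient estimate, for the state in register `x`. -/
def advRowCmd (x : ℕ) (i : NExp) : Cmd :=
  .seq (getRow 21 (.lit 0) x) (forLoop 15 1 (advCmd x i))

/-- One component of the dual gradient estimate. -/
def advEst (γ : ℝ) (φ : Fin S → Fin d → ℝ) (ω : Tape S A) (k : ℕ) (s : Fin S) (a : Fin A)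
    (θ : Fin d → ℝ) : ℝ :=
  (ω.1 k s a).2 + (γ • φ (ω.1 k s a).1 - φ s) ⬝ᵥ θ

theorem runs_advCmd (hE : Env A φ core s0 T γ η B c) (hN : Bounds A d m T N) {x i0 : ℕ} {i : NExp}
    (hi : ∀ c' : Config S, c'.nat 14 = c.nat 14 → i.eval c' = i0) {s : Fin S}
    (hs : c.state x = s) {θ : Fin d → ℝ} (hθ : ∀ j : Fin d, c.real 5 0 j = θ j)
    (hφ : ∀ j : Fin d, c.real 21 0 j = φ s j) {a : Fin A} (ha : c.nat 15 = a) {k : ℕ}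
    (hk : c.calls = k) :
    Runs φ core ω N (advCmd x i) c fun c' => c'.real 8 i0 a = advEst γ φ ω k s a θ ∧
      (∀ i' j', ¬ (i' = i0 ∧ j' = (a : ℕ)) → c'.real 8 i' j' = c.real 8 i' j') ∧
      c'.calls = k + 1 := by
  refine Runs.seq (Runs.call (hi c rfl) ha hs ha hk) fun c1 h1 f1 => ?_
  obtain ⟨h11, h12, h13, h14⟩ := h1
  have hE1 := hE.frame f1 rfl
  refine Runs.seq (Runs.getRow (i0 := 0) hE1.dim hN.dim fun _ _ => rfl) fun c2 h2 f2 => ?_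
  have hE2 := hE1.frame f2 rfl
  replace h2 := h2.1
  rw [h13] at h2
  rw [← f1.real' (b := 5) rfl, ← f2.real' (b := 5) rfl] at hθ
  rw [← f1.real' (b := 21) rfl, ← f2.real' (b := 21) rfl] at hφ
  refine Runs.seq (Runs.sumInto (by decide) hE2.one hE2.one hE2.dim hN.one hN.one hN.dim
    (fun _ _ l => (γ * φ (ω.1 k s a).1 l - φ s l) * θ l) ?_) fun c3 h3 f3 => ?_
  · intro _ j l c' f hx hy hz
    have hE' := hE2.frame f rfl
    simp [RExp.eval, NExp.eval, vec, scal, hz, f.real' (b := 22) rfl, f.real' (b := 21) rfl,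
      f.real' (b := 5) rfl, h2, hφ, hθ, hE'.disc]
  have h3' : c3.real 24 0 0 = (γ • φ (ω.1 k s a).1 - φ s) ⬝ᵥ θ := h3 0 0
  have h8 : c3.real 8 = c1.real 8 := (f3.real' rfl).trans (f2.real' rfl)
  have hi3 : i.eval c3 = i0 := hi c3 (((f3.nat' rfl).trans (f2.nat' rfl)).trans (f1.nat' rfl))
  have ha3 : c3.nat 15 = a := (((f3.nat' rfl).trans (f2.nat' rfl)).trans (f1.nat' rfl)).trans ha
  refine Runs.post (Runs.set (v := advEst γ φ ω k s a θ) hi3 ha3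
    (by simp [RExp.eval, NExp.eval, sca, hi3, ha3, h8, h11, h3', advEst])) fun c4 h4 f4 => ?_
  refine ⟨h4.1, fun i' j' h => ?_, ?_⟩
  · rw [h4.2 i' j' h, h8, h12 i' j' h]
  · rw [f4.calls rfl, f3.calls rfl, f2.calls rfl, h14]

/-- The action `a` of the row uses call `k + a`; rows processed in order therefore reproduce the
call numbering of `estLam`. The row index may depend on register 14 only, which the command leaves
alone. -/
theorem runs_advRowCmd (hE : Env A φ core s0 T γ η B c) (hN : Bounds A d m T N) {x i0 : ℕ} {i : NExp}
    (hx : x ≠ 2) (hi : ∀ c' : Config S, c'.nat 14 = c.nat 14 → i.eval c' = i0) {s : Fin S}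
    (hs : c.state x = s) {θ : Fin d → ℝ} (hθ : ∀ j : Fin d, c.real 5 0 j = θ j) {k : ℕ}
    (hk : c.calls = k) :
    Runs φ core ω N (advRowCmd x i) c fun c' =>
      (∀ a : Fin A, c'.real 8 i0 a = advEst γ φ ω (k + a) s a θ) ∧
      (∀ i', i' ≠ i0 → ∀ j', c'.real 8 i' j' = c.real 8 i' j') ∧ c'.calls = k + A := by
  refine Runs.seq (Runs.getRow (i0 := 0) hE.dim hN.dim fun _ _ => rfl) fun c1 h1 f1 => ?_
  have hE1 := hE.frame f1 rfl
  replace h1 := h1.1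
  rw [hs] at h1
  have hs1 := (f1.state' (x := x) rfl).trans hs
  rw [← f1.real' (b := 5) rfl] at hθ
  have hi1 : ∀ c' : Config S, c'.nat 14 = c1.nat 14 → i.eval c' = i0 := fun c' h =>
    hi c' (h.trans (f1.nat' rfl))
  have hk1 := (f1.calls rfl).trans hk
  have h8 : c.real 8 = c1.real 8 := (f1.real' rfl).symm
  rw [h8]
  refine Runs.forLoop (n := A) (notMem_of_contains rfl) (notMem_of_contains rfl) hE1.act hN.act
    (fun j c' => (∀ a : Fin A, (a : ℕ) < j → c'.real 8 i0 a = advEst γ φ ω (k + a) s a θ) ∧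
      (∀ i', i' ≠ i0 → ∀ j', c'.real 8 i' j' = c1.real 8 i' j') ∧ c'.calls = k + j)
    (fun _ _ _ h => h) ⟨by simp, by simp, by simp [hk1]⟩ ?_ ?_
  · rintro j hj c2 f2 h15 ⟨h2, h3, h4⟩
    have hx2 : x ∉ (forLoop 15 1 (advCmd x i)).stateW := by
      have : (forLoop 15 1 (advCmd x i)).stateW = [2] := rfl
      simpa [this] using hx
    refine Runs.post (runs_advCmd (a := ⟨j, hj⟩) (hE1.frame f2 rfl) hN
      (fun c' h => hi1 c' (h.trans (f2.nat' rfl))) ((f2.state x hx2).trans hs1)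
      (by rwa [f2.real' rfl]) (by rwa [f2.real' rfl]) h15 h4) fun c3 h5 f3 => ?_
    obtain ⟨h51, h52, h53⟩ := h5
    refine ⟨fun a ha => ?_, fun i' hi' j' => ?_, h53⟩
    · rcases Nat.lt_succ_iff_lt_or_eq.1 ha with ha | ha
      · rw [h52 _ _ (by simp; omega), h2 a ha]
      · obtain rfl : a = ⟨j, hj⟩ := Fin.ext ha
        exact h51
    · rw [h52 _ _ (fun h => hi' h.1), h3 i' hi']
  · rintro c' - ⟨h2, h3, h4⟩
    exact ⟨fun a => h2 a a.2, h3, h4⟩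

/-- The estimate of the dual gradient at the point in array 5. -/
def rhoCmd : Cmd :=
  .seq (advRowCmd 0 (.lit 0)) <|
  forLoop 14 2 (.seq (.getCore 1 (.reg 14)) (advRowCmd 1 (.add (.reg 14) (.lit 1))))

theorem runs_rhoCmd (hE : Env A φ core s0 T γ η B c) (hN : Bounds A d m T N)
    {θ : Fin d → ℝ} (hθ : ∀ j : Fin d, c.real 5 0 j = θ j) {h : ℕ}
    (hc : c.calls = h * callsPerGradient A m + 1) :
    Runs φ core ω N rhoCmd c fun c' =>
      (∀ (i : Fin (m + 1)) (a : Fin A), c'.real 8 i a = estLam γ φ core s0 ω h θ i a) ∧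
      c'.calls = (h + 1) * callsPerGradient A m := by
  have hest : ∀ (i : Fin (m + 1)) (a : Fin A), estLam γ φ core s0 ω h θ i a =
      advEst γ φ ω (h * callsPerGradient A m + 1 + i * A + a) (plus core s0 i) a θ := fun _ _ => rfl
  refine Runs.seq (runs_advRowCmd hE hN (i0 := 0) (by decide) (fun _ _ => rfl) hE.st hθ hc)
    fun c1 h1 f1 => ?_
  obtain ⟨h11, -, h12⟩ := h1
  have hE1 := hE.frame f1 rfl
  rw [← f1.real' (b := 5) rfl] at hθ
  refine Runs.forLoop (n := m) (by decide) (by decide) hE1.num hN.num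
    (fun l c' => (∀ (i : Fin (m + 1)) (a : Fin A), (i : ℕ) < l + 1 →
        c'.real 8 i a = estLam γ φ core s0 ω h θ i a) ∧
      c'.calls = h * callsPerGradient A m + 1 + (l + 1) * A) (fun _ _ _ h => h) ⟨?_, ?_⟩ ?_ ?_
  · intro i a hi
    obtain rfl : i = 0 := Fin.ext (by rw [Fin.val_zero]; omega)
    rw [hest]
    simpa [plus] using h11 a
  · rw [h12]; ring
  · rintro l hl c2 f2 h14 ⟨h2, h3⟩
    refine Runs.seq (R' := fun c' => c'.state 1 = core ⟨l, hl⟩)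
      (Runs.getCore (k := ⟨l, hl⟩) h14 (by simp [Config.writeState])) fun c3 h4 f3 => ?_
    have h14' : c3.nat 14 = l := (f3.nat' rfl).trans h14
    refine Runs.post (runs_advRowCmd ((hE1.frame f2 rfl).frame f3 rfl) hN (i0 := l + 1) (by decide)
      (fun c' h' => by simp [NExp.eval, h', h14']) h4
      (by rwa [f3.real' rfl, f2.real' rfl]) ((f3.calls rfl).trans h3)) fun c4 h5 f4 => ?_
    obtain ⟨h51, h52, h53⟩ := h5
    refine ⟨fun i a hi => ?_, ?_⟩
    · rcases Nat.lt_succ_iff_lt_or_eq.1 hi with hi | hi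
      · rw [h52 _ hi.ne, f3.real' rfl, h2 i a hi]
      · obtain rfl : i = Fin.succ ⟨l, hl⟩ := Fin.ext hi
        rw [hest]
        exact h51 a
    · rw [h53]; ring
  · rintro c' - ⟨h2, h3⟩
    refine ⟨fun i a => h2 i a i.2, ?_⟩
    rw [h3, callsPerGradient]
    ring

end Gradients

/-! ## The iterations on the machine -/

section Iterations

variable {S A d m : ℕ} {φ : Fin S → Fin d → ℝ} {core : Fin m ↪ Fin S} {ω : Tape S A}
  {N : ℕ} {c : Config S} {s0 : Fin S} {T : ℕ} {γ η B : ℝ}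

/-- The point `z` is stored in the arrays `b` and `b + 1`. -/
structure Stored (b : ℕ) (z : (Fin d → ℝ) × (Fin (m + 1) → Fin A → ℝ)) (c : Config S) : Prop where
  theta : ∀ j : Fin d, c.real b 0 j = z.1 j
  lam : ∀ (i : Fin (m + 1)) (a : Fin A), c.real (b + 1) i a = z.2 i a

theorem Stored.frame {b : ℕ} {z : (Fin d → ℝ) × (Fin (m + 1) → Fin A → ℝ)} {c c' : Config S} {p : Cmd}
    (h : Stored b z c) (f : Frame p c c') (hb : p.realW.contains b = false)
    (hb' : p.realW.contains (b + 1) = false) : Stored b z c' :=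
  ⟨by rw [f.real' hb]; exact h.theta, by rw [f.real' hb']; exact h.lam⟩

/-- One proximal update of the point in the arrays 3 and 4, with gradient estimates at the point in
the arrays 5 and 6; the result replaces the latter. -/
def stepCmd : Cmd := .seq xiCmd (.seq rhoCmd (.seq thetaCmd lamCmd))

/-- Both gradients are formed in the separate arrays 7 and 8 before the point in arrays 5 and 6 is
overwritten, and the base point in arrays 3 and 4 is never touched. -/
theorem runs_stepCmd [NeZero A] (hE : Env A φ core s0 T γ η B c) (hN : Bounds A d m T N)
    {z y : (Fin d → ℝ) × (Fin (m + 1) → Fin A → ℝ)} (hz : Stored 3 z c) (hy : Stored 5 y c)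
    (hy0 : ∀ i a, 0 ≤ y.2 i a) {h : ℕ} (hc : c.calls = h * callsPerGradient A m) (hd : c.draws = h) :
    Runs φ core ω N stepCmd c fun c' => Stored 5 (linStep γ φ core B η s0 ω h z y) c' ∧
      c'.calls = (h + 1) * callsPerGradient A m ∧ c'.draws = h + 1 := by
  refine Runs.seq (runs_xiCmd hE hN hy.lam hy0 hc hd) fun c1 h1 f1 => ?_
  obtain ⟨h11, h12, h13⟩ := h1
  have hE1 := hE.frame f1 rfl
  replace hz := hz.frame f1 rfl rfl
  replace hy := hy.frame f1 rfl rfl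
  refine Runs.seq (runs_rhoCmd hE1 hN hy.theta h12) fun c2 h2 f2 => ?_
  obtain ⟨h21, h22⟩ := h2
  have hE2 := hE1.frame f2 rfl
  replace hz := hz.frame f2 rfl rfl
  rw [← f2.real' (b := 7) rfl] at h11
  refine Runs.seq (runs_thetaCmd hE2 hN hz.theta h11) fun c3 h3 f3 => ?_
  have hE3 := hE2.frame f3 rfl
  replace hz := hz.frame f3 rfl rfl
  rw [← f3.real' (b := 8) rfl] at h21
  refine Runs.post (runs_lamCmd hE3 hN hz.lam h21) fun c4 h4 f4 => ⟨⟨?_, h4⟩, ?_, ?_⟩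
  · rw [f4.real' rfl]; exact h3
  · rw [f4.calls rfl, f3.calls rfl, h22]
  · rw [f4.draws rfl, f3.draws rfl, f2.draws rfl, h13]

/-- The point in the arrays `b` and `b + 1` is copied to the arrays `b'` and `b' + 1`. -/
def copyCmd (b b' : ℕ) : Cmd :=
  .seq (fill 6 5 7 0 b' (vec b 7)) (fill 6 3 7 1 (b' + 1) (ent (b + 1) 6 7))

theorem runs_copyCmd (hE : Env A φ core s0 T γ η B c) (hN : Bounds A d m T N) {b b' : ℕ}
    (hb : b ≠ b') (hb2 : b + 1 ≠ b')
    {z : (Fin d → ℝ) × (Fin (m + 1) → Fin A → ℝ)} (hz : Stored b z c) :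
    Runs φ core ω N (copyCmd b b') c (Stored b' z) := by
  refine Runs.seq (Runs.fillFin (by decide) hE.one hE.dim hN.one hN.dim (fun _ j => z.1 j) ?_)
    fun c1 h1 f1 => ?_
  · intro _ j c' f _ hy _
    rw [← hz.theta j, ← f.real b (by simpa [fill, forLoop, Cmd.realW] using hb)]
    simp [vec, RExp.eval, NExp.eval, hy]
  have hp1 := f1.nat' (x := 3) rfl
  have hp2 := f1.nat' (x := 1) rfl
  refine Runs.post (Runs.fillFin (by decide) (hp1.trans hE.plus) (hp2.trans hE.act) hN.plus hN.act
    (fun i a => z.2 i a) ?_) fun c2 h2 f2 => ⟨fun j => ?_, h2.1⟩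
  · intro i j c' f hx hy _
    rw [← hz.lam i j, ← f1.real (b + 1) (by simpa [fill, forLoop, Cmd.realW] using hb2),
      ← f.real (b + 1) (by simp [fill, forLoop, Cmd.realW, hb])]
    simp [ent, RExp.eval, NExp.eval, hx, hy]
  · rw [f2.real b' (by simp [fill, forLoop, Cmd.realW])]
    exact h1.1 0 j

/-- One iteration; the sum of the dual iterates is collected in the array 9. -/
def iterCmd : Cmd :=
  .seq (copyCmd 3 5) <| .seq stepCmd <| .seq stepCmd <| .seq (copyCmd 5 3) <|
  fill 6 3 7 1 9 (.add (ent 9 6 7) (ent 4 6 7))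

/-- The first copy makes the base point also the evaluation point, so the same command performs the
extrapolation and then the actual step. -/
theorem runs_iterCmd [NeZero A] (hE : Env A φ core s0 T γ η B c) (hN : Bounds A d m T N)
    {z : (Fin d → ℝ) × (Fin (m + 1) → Fin A → ℝ)} (hz : Stored 3 z c) (hz0 : InDom γ z.2)
    {σ : Fin (m + 1) → Fin A → ℝ} (hσ : ∀ (i : Fin (m + 1)) (a : Fin A), c.real 9 i a = σ i a)
    {τ : ℕ} (hc : c.calls = 2 * τ * callsPerGradient A m) (hd : c.draws = 2 * τ)
    {z' : (Fin d → ℝ) × (Fin (m + 1) → Fin A → ℝ)}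
    (hz' : z' = linStep γ φ core B η s0 ω (2 * τ + 1) z (linStep γ φ core B η s0 ω (2 * τ) z z)) :
    Runs φ core ω N iterCmd c fun c' => Stored 3 z' c' ∧
      (∀ (i : Fin (m + 1)) (a : Fin A), c'.real 9 i a = σ i a + z'.2 i a) ∧
      c'.calls = 2 * (τ + 1) * callsPerGradient A m ∧ c'.draws = 2 * (τ + 1) := by
  refine Runs.seq (runs_copyCmd hE hN (by decide) (by decide) hz)
    fun c1 h1 f1 => ?_
  have hE1 := hE.frame f1 rfl
  replace hz := hz.frame f1 rfl rfl
  refine Runs.seq (runs_stepCmd hE1 hN hz h1 hz0.nonneg ((f1.calls rfl).trans hc)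
    ((f1.draws rfl).trans hd)) fun c2 h2 f2 => ?_
  have hE2 := hE1.frame f2 rfl
  replace hz := hz.frame f2 rfl rfl
  refine Runs.seq (runs_stepCmd hE2 hN hz h2.1 (hz0.proxLam _ _).nonneg h2.2.1 h2.2.2)
    fun c3 h3 f3 => ?_
  have hE3 := hE2.frame f3 rfl
  rw [← hz'] at h3
  refine Runs.seq (runs_copyCmd hE3 hN (by decide) (by decide) h3.1)
    fun c4 h4 f4 => ?_
  have hE4 := hE3.frame f4 rfl
  rw [← f1.real' (b := 9) rfl, ← f2.real' (b := 9) rfl, ← f3.real' (b := 9) rfl,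
    ← f4.real' (b := 9) rfl] at hσ
  refine Runs.post (Runs.fillFin (by decide) hE4.plus hE4.act hN.plus hN.act
    (fun i a => σ i a + z'.2 i a) ?_) fun c5 h5 f5 => ⟨h4.frame f5 rfl rfl, h5.1, ?_, ?_⟩
  · intro i j c' f hx hy h9
    have := h4.lam i j
    simp [ent, RExp.eval, NExp.eval, hx, hy, h9, hσ, f.real' (b := 4) rfl, this]
  · rw [f5.calls rfl, f4.calls rfl, h3.2.1]; ring
  · rw [f5.draws rfl, f4.draws rfl, h3.2.2]; ring

/-- All the iterations. -/
def mainCmd : Cmd := forLoop 16 4 iterCmd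

theorem runs_mainCmd [NeZero A] (hm : 0 < m) (h0 : 0 ≤ γ) (h1 : γ < 1)
    (hE : Env A φ core s0 T γ η B c) (hN : Bounds A d m T N) (hz : Stored 3 (start A d m γ) c)
    (h9 : ∀ (i : Fin (m + 1)) (a : Fin A), c.real 9 i a = 0) (hc : c.calls = 0) (hd : c.draws = 0) :
    Runs φ core ω N mainCmd c fun c' => Stored 3 (linIter γ φ core B η s0 ω T) c' ∧
      (∀ (i : Fin (m + 1)) (a : Fin A), c'.real 9 i a =
        ∑ τ ∈ Finset.range T, (linIter γ φ core B η s0 ω (τ + 1)).2 i a) ∧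
      c'.calls = 2 * T * callsPerGradient A m ∧ c'.draws = 2 * T := by
  refine Runs.forLoop (n := T) (by decide) (by decide) hE.iter hN.iter
    (fun k c' => Stored 3 (linIter γ φ core B η s0 ω k) c' ∧
      (∀ (i : Fin (m + 1)) (a : Fin A), c'.real 9 i a =
        ∑ τ ∈ Finset.range k, (linIter γ φ core B η s0 ω (τ + 1)).2 i a) ∧
      c'.calls = 2 * k * callsPerGradient A m ∧ c'.draws = 2 * k)
    (fun _ _ _ h => ⟨⟨h.1.theta, h.1.lam⟩, h.2⟩) ⟨hz, by simpa using h9, by simp [hc], by simp [hd]⟩ ?_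
    fun c' _ h => h
  rintro k hk c1 f - ⟨h2, h3, h4, h5⟩
  simp only [Finset.sum_range_succ]
  exact runs_iterCmd (hE.frame f rfl) hN h2 (inDom_linIter hm h0 h1 B η s0 ω k) h3 h4 h5 rfl

/-- The distribution of the action is stored in the array 16, and the action is drawn. -/
def finalCmd : Cmd :=
  .seq (.ite (.natLt (.reg 4) (.lit 1)) (fill 6 5 7 1 16 (vec 4 7))
    (fill 6 5 7 1 16 (.mul (.div (.nat (.lit 1)) (.nat (.reg 4))) (vec 9 7)))) <|
  .seq (.draw 13 (.lit 0) (.lit 0)) <|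
  .seq (sumInto 6 5 7 5 8 1 15 (vec 16 8)) <|
  .seq (scanCmd 5 16) (.setNat 0 (.reg 11))

theorem runs_finalCmd [NeZero A] (hE : Env A φ core s0 T γ η B c) (hN : Bounds A d m T N)
    (hz : T = 0 → Stored 3 (start A d m γ) c) {σ : Fin (m + 1) → Fin A → ℝ}
    (hσ : ∀ (i : Fin (m + 1)) (a : Fin A), c.real 9 i a = σ i a) {w : Fin A → ℝ}
    (hw : w = (if T = 0 then (start A d m γ).2 else (1 / T : ℝ) • σ) 0) (hw0 : ∀ a, 0 ≤ w a)
    (hd : c.draws = 2 * T) :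
    Runs φ core ω N finalCmd c fun c' => c'.nat 0 = pick w (ω.2 (2 * T)) ∧ c'.calls = c.calls := by
  refine Runs.seq (R' := fun c' => ∀ a : Fin A, c'.real 16 0 a = w a) ?_ fun c1 h1 f1 => ?_
  · refine Runs.ite (fun h => ?_) fun h => ?_
    · have h : c.nat 4 < 1 := h
      have hT : T = 0 := by rw [hE.iter] at h; omega
      rw [if_pos hT] at hw
      refine Runs.post (Runs.fillFin (by decide) hE.one hE.act hN.one hN.act (fun _ a => w a) ?_)
        fun c' h' _ a => h'.1 0 a
      intro _ j c' f _ hy _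
      have := (hz hT).lam 0 j
      rw [Fin.val_zero] at this
      simp [vec, RExp.eval, NExp.eval, hy, f.real' (b := 4) rfl, hw, this]
    · have h : ¬ c.nat 4 < 1 := h
      have hT : T ≠ 0 := by rw [hE.iter] at h; omega
      rw [if_neg hT] at hw
      refine Runs.post (Runs.fillFin (by decide) hE.one hE.act hN.one hN.act (fun _ a => w a) ?_)
        fun c' h' _ a => h'.1 0 a
      intro _ j c' f _ hy _
      have := hσ 0 j
      rw [Fin.val_zero] at this
      simp [vec, RExp.eval, NExp.eval, hy, f.real' (b := 9) rfl, hw, this, (hE.frame f rfl).iter]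
  have hE1 := hE.frame f1 rfl
  have hd1 := (f1.draws rfl).trans hd
  refine Runs.seq (R' := fun c' => c'.real 13 0 0 = ω.2 (2 * T))
    (Runs.draw (by simp [Config.writeReal, Config.countDraw, NExp.eval, hd1])) fun c2 h2 f2 => ?_
  have hE2 := hE1.frame f2 rfl
  rw [← f2.real' (b := 16) rfl] at h1
  refine Runs.seq (Runs.sumInto (by decide) hE2.one hE2.one hE2.act hN.one hN.one hN.act
    (fun _ _ a => w a) ?_) fun c3 h3 f3 => ?_
  · intro _ _ l c' f _ _ hz
    simp [vec, RExp.eval, NExp.eval, hz, f.real' (b := 16) rfl, h1]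
  have hE3 := hE2.frame f3 rfl
  rw [← f3.real' (b := 16) rfl] at h1
  rw [← f3.real' (b := 13) rfl] at h2
  refine Runs.seq (runs_scanCmd_row (by decide) (by decide) hE3.one hE3.act hN.one hN.act h1 hw0 _ h2
    (h3 0 0)) fun c4 h4 f4 => ?_
  refine Runs.setNat ⟨by simp [Config.writeNat, NExp.eval, h4], ?_⟩
  show c4.calls = c.calls
  rw [f4.calls rfl, f3.calls rfl, f2.calls rfl, f1.calls rfl]

end Iterations

/-! ## The preparations on the machine -/

section Setup

variable {S A d m : ℕ} {φ : Fin S → Fin d → ℝ} {core : Fin m ↪ Fin S} {ω : Tape S A}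
  {N : ℕ} {c : Config S} {s0 : Fin S} {T : ℕ} {γ η B ε : ℝ}

/-- The registers 3 and 5 receive the numbers `m + 1` and `1`. -/
def sizesCmd : Cmd := .seq (.setNat 3 (.add (.reg 2) (.lit 1))) (.setNat 5 (.lit 1))

theorem runs_sizesCmd :
    Runs φ core ω N sizesCmd (inputConfig d A m γ ε s0) fun c' => Base A d m s0 c' ∧ c'.nat 4 = 0 := by
  refine Runs.seq (Runs.setNat rfl) fun c1 (h1 : _ = c1) _ => Runs.setNat ?_
  subst h1
  refine ⟨⟨?_, ?_, ?_, ?_, ?_, ?_⟩, ?_⟩ <;> simp [Config.writeNat, NExp.eval, inputConfig]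

/-- The number of iterations is computed in register 4, after `ℓ` in the scalar 8. -/
def countCmd : Cmd :=
  .seq (.setReal 0 (.lit 0) (.lit 8)
    (.add (.log (.nat (.reg 1))) (.mul (scal 0) (.log (.nat (.reg 2)))))) <|
  .seq (.setReal 0 (.lit 0) (.lit 7) (.div (.mul (.nat (.reg 2)) (.add (.nat (.lit 1)) (scal 8)))
    (.mul (scal 1) (scal 1)))) <|
  .loop (.not (.realLt (scal 7) (.nat (.add (.reg 4) (.lit 1))))) (.setNat 4 (.add (.reg 4) (.lit 1)))

/-- The machine has no rounding: the floor is found by counting up while the next integer does not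
exceed the real number. The T rounds are within the loop bound. -/
theorem runs_countCmd (hB : Base A d m s0 c) (h4 : c.nat 4 = 0) (hγ : c.real 0 0 0 = γ)
    (hε : c.real 0 0 1 = ε) (hγ0 : 0 ≤ γ) (hN : iterations A m γ ε ≤ N) :
    Runs φ core ω N countCmd c fun c' => c'.nat 4 = iterations A m γ ε ∧ c'.real 0 0 0 = γ ∧
      c'.real 0 0 8 = ell A m γ := by
  refine Runs.seq (Runs.set (i0 := 0) (j0 := 8) (v := ell A m γ) rfl rfl
    (by simp [RExp.eval, NExp.eval, scal, hB.act, hB.num, hγ, ell])) fun c1 h1 f1 => ?_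
  have hB1 := hB.frame f1 rfl
  have hγ1 := (h1.2 0 0 (by decide)).trans hγ
  have hε1 := (h1.2 0 1 (by decide)).trans hε
  set x : ℝ := m * (1 + ell A m γ) / ε ^ 2 with hx
  refine Runs.seq (Runs.set (i0 := 0) (j0 := 7) (v := x) rfl rfl
    (by simp [RExp.eval, NExp.eval, scal, hB1.num, hε1, h1.1, hx, pow_two])) fun c2 h2 f2 => ?_
  have hγ2 := (h2.2 0 0 (by decide)).trans hγ1
  have hl2 := (h2.2 0 8 (by decide)).trans h1.1
  have h42 := ((f2.nat' (x := 4) rfl).trans (f1.nat' rfl)).trans h4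
  have hx0 : 0 ≤ x := by
    have := ell_nonneg A m hγ0
    positivity
  have hT : iterations A m γ ε = ⌊x⌋₊ := rfl
  rw [hT] at hN ⊢
  refine Runs.loop hN (fun k c' => c'.nat 4 = k ∧ c'.real 0 = c2.real 0) ⟨h42, rfl⟩ ?_ ?_ ?_
  · rintro k hk c' ⟨e1, e2⟩
    refine ⟨?_, Runs.setNat ⟨by simp [Config.writeNat, NExp.eval, e1], e2⟩⟩
    simp only [BExp.Holds, RExp.eval, NExp.eval, scal, e1, e2, h2.1, not_lt]
    exact (Nat.le_floor_iff hx0).1 hk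
  · rintro c' ⟨e1, e2⟩
    simp only [BExp.Holds, RExp.eval, NExp.eval, scal, e1, e2, h2.1, not_not]
    exact_mod_cast Nat.lt_floor_add_one x
  · rintro c' ⟨e1, e2⟩
    exact ⟨e1, by rw [e2, hγ2], by rw [e2, hl2]⟩

/-- The numerical parameters of the algorithm. -/
def scalarsCmd : Cmd :=
  .seq (.setReal 0 (.lit 0) (.lit 3) (.div (.mul (.div (.nat (.lit 9)) (.nat (.lit 8)))
    (.sqrt (.nat (.reg 2)))) (.sub (.nat (.lit 1)) (scal 0)))) <|
  .seq (.setReal 0 (.lit 0) (.lit 9) (.div (.mul (.div (.nat (.lit 9)) (.nat (.lit 4)))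
    (.sqrt (.mul (.nat (.reg 2)) (.add (.nat (.lit 1)) (.mul (.nat (.lit 2)) (scal 8))))))
    (.mul (.sub (.nat (.lit 1)) (scal 0)) (.sub (.nat (.lit 1)) (scal 0))))) <|
  .seq (.setReal 0 (.lit 0) (.lit 2) (.mul (.div (.nat (.lit 1)) (scal 9))
    (.sqrt (.div (.nat (.lit 2)) (.mul (.nat (.lit 7)) (.nat (.reg 4))))))) <|
  .seq (.setReal 0 (.lit 0) (.lit 4) (.mul (scal 2) (.mul (scal 3) (scal 3)))) <|
  .seq (.setReal 0 (.lit 0) (.lit 5)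
    (.div (.mul (.nat (.lit 2)) (scal 8)) (.sub (.nat (.lit 1)) (scal 0)))) <|
  .setReal 0 (.lit 0) (.lit 6) (.div (scal 0) (.sub (.nat (.lit 1)) (scal 0)))

theorem runs_scalarsCmd (hB : Base A d m s0 c) (hT : c.nat 4 = T) (hγ : c.real 0 0 0 = γ)
    (hl : c.real 0 0 8 = ell A m γ) :
    Runs φ core ω N scalarsCmd c fun c' => c'.real 0 0 0 = γ ∧ c'.real 0 0 2 = stepSize A m γ T ∧
      c'.real 0 0 3 = radius m γ ∧ c'.real 0 0 4 = stepSize A m γ T * radius m γ ^ 2 ∧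
      c'.real 0 0 5 = 2 * ell A m γ / (1 - γ) ∧ c'.real 0 0 6 = γ / (1 - γ) := by
  refine Runs.seq (Runs.set (i0 := 0) (j0 := 3) (v := radius m γ) rfl rfl
    (by simp [RExp.eval, NExp.eval, scal, hB.num, hγ, radius])) fun c1 h1 f1 => ?_
  have hB1 := hB.frame f1 rfl
  have hT1 := (f1.nat' (x := 4) rfl).trans hT
  have g1 := (h1.2 0 0 (by decide)).trans hγ
  have l1 := (h1.2 0 8 (by decide)).trans hl
  refine Runs.seq (Runs.set (i0 := 0) (j0 := 9) (v := bigC A m γ) rfl rfl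
    (by simp [RExp.eval, NExp.eval, scal, hB1.num, g1, l1, bigC, pow_two])) fun c2 h2 f2 => ?_
  have hT2 := (f2.nat' (x := 4) rfl).trans hT1
  have g2 := (h2.2 0 0 (by decide)).trans g1
  have l2 := (h2.2 0 8 (by decide)).trans l1
  have b2 := (h2.2 0 3 (by decide)).trans h1.1
  refine Runs.seq (Runs.set (i0 := 0) (j0 := 2) (v := stepSize A m γ T) rfl rfl
    (by simp [RExp.eval, NExp.eval, scal, hT2, h2.1, stepSize])) fun c3 h3 f3 => ?_
  have g3 := (h3.2 0 0 (by decide)).trans g2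
  have l3 := (h3.2 0 8 (by decide)).trans l2
  have b3 := (h3.2 0 3 (by decide)).trans b2
  refine Runs.seq (Runs.set (i0 := 0) (j0 := 4) (v := stepSize A m γ T * radius m γ ^ 2) rfl rfl
    (by simp [RExp.eval, NExp.eval, scal, h3.1, b3, pow_two])) fun c4 h4 f4 => ?_
  have g4 := (h4.2 0 0 (by decide)).trans g3
  have l4 := (h4.2 0 8 (by decide)).trans l3
  refine Runs.seq (Runs.set (i0 := 0) (j0 := 5) (v := 2 * ell A m γ / (1 - γ)) rfl rfl
    (by simp [RExp.eval, NExp.eval, scal, g4, l4])) fun c5 h5 f5 => ?_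
  have g5 := (h5.2 0 0 (by decide)).trans g4
  refine Runs.post (Runs.set (i0 := 0) (j0 := 6) (v := γ / (1 - γ)) rfl rfl
    (by simp [RExp.eval, NExp.eval, scal, g5])) fun c6 h6 f6 => ?_
  refine ⟨?_, ?_, ?_, ?_, ?_, h6.1⟩
  · rw [h6.2 0 0 (by decide), g5]
  · rw [h6.2 0 2 (by decide), h5.2 0 2 (by decide), h4.2 0 2 (by decide), h3.1]
  · rw [h6.2 0 3 (by decide), h5.2 0 3 (by decide), h4.2 0 3 (by decide), b3]
  · rw [h6.2 0 4 (by decide), h5.2 0 4 (by decide), h4.1]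
  · rw [h6.2 0 5 (by decide), h5.1]

/-- The feature vectors of the core states are read into the array 2. -/
def featCmd : Cmd := forLoop 6 2 (.seq (.getCore 1 (.reg 6)) (getRow 2 (.reg 6) 1))

theorem runs_featCmd (hB : Base A d m s0 c) (hN : Bounds A d m T N) :
    Runs φ core ω N featCmd c fun c' => ∀ (i : Fin m) (k : Fin d), c'.real 2 i k = φ (core i) k := by
  refine Runs.forLoop (n := m) (by decide) (by decide) hB.num hN.num
    (fun l c' => ∀ (i : Fin m) (k : Fin d), (i : ℕ) < l → c'.real 2 i k = φ (core i) k)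
    (fun _ _ _ h => h) (by simp) ?_ fun c' _ h i k => h i k i.2
  rintro l hl c1 f1 h6 h1
  refine Runs.seq (R' := fun c' => c'.state 1 = core ⟨l, hl⟩)
    (Runs.getCore (k := ⟨l, hl⟩) h6 (by simp [Config.writeState])) fun c2 h2 f2 => ?_
  have h6' : c2.nat 6 = l := (f2.nat' rfl).trans h6
  refine Runs.post (Runs.getRow (i0 := l) ((hB.frame f1 rfl).frame f2 rfl).dim hN.dim
    fun c' f => (f.nat' (x := 6) rfl).trans h6') fun c3 h3 f3 i k hi => ?_
  rcases Nat.lt_succ_iff_lt_or_eq.1 hi with hi | hi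
  · rw [h3.2 _ hi.ne, f2.real' rfl, h1 i k hi]
  · obtain rfl : i = ⟨l, hl⟩ := Fin.ext hi
    rw [h3.1, h2]

/-- One step of the conjugate direction method for the matrix in the array 20, with the collected
matrix in the array 1. -/
def conjCmd : Cmd :=
  .seq (sumInto 6 5 7 0 8 0 11 (.mul (ent 1 7 8) (ent 20 8 9))) <|
  .seq (fill 6 5 7 0 10 (.sub (.nat (.lit 0)) (vec 11 7))) <|
  .seq (.setReal 10 (.lit 0) (.reg 9) (.sub (.nat (.lit 1)) (vec 11 9))) <|
  .seq (sumInto 6 5 7 5 8 0 12 (.mul (vec 10 8) (ent 20 8 9))) <|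
  fill 6 0 7 0 1 (.add (ent 1 6 7) (.div (.mul (vec 10 6) (vec 10 7)) (sca 12)))

/-- The direction is first filled as if the unit vector were 0, and then its entry `k` is corrected,
which avoids a test inside the loop. -/
theorem runs_conjCmd (hB : Base A d m s0 c) (hN : Bounds A d m T N) {G H : Matrix (Fin d) (Fin d) ℝ}
    (hG : ∀ i j : Fin d, c.real 20 i j = G i j) (hH : ∀ i j : Fin d, c.real 1 i j = H i j) {k : Fin d}
    (hk : c.nat 9 = k) :
    Runs φ core ω N conjCmd c fun c' => ∀ i j : Fin d, c'.real 1 i j = ginvStep G H k i j := by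
  refine Runs.seq (Runs.sumInto (by decide) hB.one hB.dim hB.dim hN.one hN.dim hN.dim
    (fun _ j l => H j l * G l k) ?_) fun c1 h1 f1 => ?_
  · intro _ j l c' f _ hy hz
    simp [RExp.eval, NExp.eval, ent, hy, hz, f.real' (b := 1) rfl, f.real' (b := 20) rfl, hG, hH,
      f.nat' (x := 9) rfl, hk]
  have hB1 := hB.frame f1 rfl
  have h1' : ∀ j : Fin d, c1.real 11 0 j = ∑ l, H j l * G l k := fun j => h1 0 j
  have hk1 := (f1.nat' (x := 9) rfl).trans hk
  refine Runs.seq (Runs.fillFin (by decide) hB1.one hB1.dim hN.one hN.dim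
    (fun _ j => 0 - ∑ l, H j l * G l k) ?_) fun c2 h2 f2 => ?_
  · intro _ j c' f _ hy _
    simp [RExp.eval, NExp.eval, vec, hy, f.real' (b := 11) rfl, h1']
  have hB2 := hB1.frame f2 rfl
  have hk2 := (f2.nat' (x := 9) rfl).trans hk1
  have h2' : ∀ j : Fin d, c2.real 10 0 j = 0 - ∑ l, H j l * G l k := fun j => h2.1 0 j
  refine Runs.seq (Runs.set (i0 := 0) (j0 := k) (v := 1 - ∑ l, H k l * G l k) rfl hk2
    (by simp [RExp.eval, NExp.eval, vec, hk2, f2.real' (b := 11) rfl, h1'])) fun c3 h3 f3 => ?_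
  have hB3 := hB2.frame f3 rfl
  have hk3 := (f3.nat' (x := 9) rfl).trans hk2
  have h3' : ∀ j : Fin d, c3.real 10 0 j = conjDir G H k j := fun j => by
    rw [conjDir]
    split_ifs with hj
    · rw [hj, h3.1]
    · rw [h3.2 0 j (fun h => hj (Fin.ext h.2)), h2']
  rw [← f1.real' (b := 20) rfl, ← f2.real' (b := 20) rfl, ← f3.real' (b := 20) rfl] at hG
  refine Runs.seq (Runs.sumInto (by decide) hB3.one hB3.one hB3.dim hN.one hN.one hN.dim
    (fun _ _ l => conjDir G H k l * G l k) ?_) fun c4 h4 f4 => ?_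
  · intro _ _ l c' f _ _ hz
    simp [RExp.eval, NExp.eval, vec, ent, hz, f.real' (b := 10) rfl, f.real' (b := 20) rfl, h3', hG,
      f.nat' (x := 9) rfl, hk3]
  have hB4 := hB3.frame f4 rfl
  have h4' : c4.real 12 0 0 = ∑ l, conjDir G H k l * G l k := h4 0 0
  rw [← f4.real' (b := 10) rfl] at h3'
  rw [← f1.real' (b := 1) rfl, ← f2.real' (b := 1) rfl, ← f3.real' (b := 1) rfl,
    ← f4.real' (b := 1) rfl] at hH
  refine Runs.post (Runs.fillFin (by decide) hB4.dim hB4.dim hN.dim hN.dim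
    (fun i j => ginvStep G H k i j) ?_) fun c' h _ => h.1
  intro i j c' f hx hy h
  simp [RExp.eval, NExp.eval, vec, ent, sca, hx, hy, f.real' (b := 10) rfl, f.real' (b := 12) rfl, h,
    h3', h4', hH, ginvStep]

/-- The generalized inverse is computed in the array 1. -/
def ginvCmd : Cmd :=
  .seq (sumInto 6 0 7 0 8 2 20 (.mul (ent 2 8 6) (ent 2 8 7))) <|
  .seq (fill 6 0 7 0 1 (.nat (.lit 0))) <| forLoop 9 0 conjCmd

theorem runs_ginvCmd (hB : Base A d m s0 c) (hN : Bounds A d m T N)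
    (hF : ∀ (i : Fin m) (k : Fin d), c.real 2 i k = φ (core i) k) :
    Runs φ core ω N ginvCmd c fun c' =>
      ∀ i j : Fin d, c'.real 1 i j = ginv (corePhi φ core) i j := by
  set G := (corePhi φ core)ᵀ * corePhi φ core with hG
  refine Runs.seq (Runs.sumInto (by decide) hB.dim hB.dim hB.num hN.dim hN.dim hN.num
    (fun i j l => φ (core l) i * φ (core l) j) ?_) fun c1 h1 f1 => ?_
  · intro i j l c' f hx hy hz
    simp [RExp.eval, NExp.eval, ent, hx, hy, hz, f.real' (b := 2) rfl, hF]
  have h1' : ∀ i j : Fin d, c1.real 20 i j = G i j := h1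
  have hB1 := hB.frame f1 rfl
  refine Runs.seq (Runs.fillFin (by decide) hB1.dim hB1.dim hN.dim hN.dim (fun _ _ => 0)
    fun i j c' f _ _ _ => by simp [RExp.eval, NExp.eval]) fun c2 h2 f2 => ?_
  have hB2 := hB1.frame f2 rfl
  rw [← f2.real' (b := 20) rfl] at h1'
  refine Runs.forLoop (n := d) (by decide) (by decide) hB2.dim hN.dim
    (fun k c' => ∀ i j : Fin d, c'.real 1 i j = ginvAux G k i j) (fun _ _ _ h => h) h2.1 ?_
    fun c' _ h => h
  intro k hk c3 f3 h9 h3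
  rw [ginvAux, dif_pos hk]
  exact runs_conjCmd (hB2.frame f3 rfl) hN (by rwa [f3.real' rfl]) h3 h9

/-- The starting point is stored in the arrays 3 and 4. -/
def startCmd : Cmd :=
  .seq (fill 6 5 7 0 3 (.nat (.lit 0))) <|
  .seq (fill 6 3 7 1 4 (.div (scal 0) (.mul (.mul (.sub (.nat (.lit 1)) (scal 0)) (.nat (.reg 2)))
    (.nat (.reg 1))))) <|
  .seq (fill 6 5 7 1 4 (.div (.nat (.lit 1)) (.nat (.reg 1)))) <|
  fill 6 3 7 1 9 (.nat (.lit 0))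

theorem runs_startCmd (hE : Env A φ core s0 T γ η B c) (hN : Bounds A d m T N) :
    Runs φ core ω N startCmd c fun c' => Stored 3 (start A d m γ) c' ∧
      ∀ (i : Fin (m + 1)) (a : Fin A), c'.real 9 i a = 0 := by
  refine Runs.seq (Runs.fillFin (by decide) hE.one hE.dim hN.one hN.dim (fun _ _ => 0)
    fun i j c' f _ _ _ => by simp [RExp.eval, NExp.eval]) fun c1 h1 f1 => ?_
  have hE1 := hE.frame f1 rfl
  refine Runs.seq (Runs.fillFin (by decide) hE1.plus hE1.act hN.plus hN.act
    (fun _ _ => γ / ((1 - γ) * m * A)) fun i j c' f _ _ _ => ?_) fun c2 h2 f2 => ?_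
  · have hE' := hE1.frame f rfl
    simp [RExp.eval, NExp.eval, scal, hE'.disc, hE'.num, hE'.act]
  have hE2 := hE1.frame f2 rfl
  refine Runs.seq (Runs.fillFin (by decide) hE2.one hE2.act hN.one hN.act
    (fun _ _ => 1 / (A : ℝ)) fun i j c' f _ _ _ => ?_) fun c3 h3 f3 => ?_
  · simp [RExp.eval, NExp.eval, (hE2.frame f rfl).act]
  have hE3 := hE2.frame f3 rfl
  refine Runs.post (Runs.fillFin (by decide) hE3.plus hE3.act hN.plus hN.act (fun _ _ => 0)
    fun i j c' f _ _ _ => by simp [RExp.eval, NExp.eval]) fun c4 h4 f4 => ⟨⟨fun j => ?_, fun i a => ?_⟩, h4.1⟩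
  · rw [f4.real' rfl, f3.real' rfl, f2.real' rfl]
    exact h1.1 0 j
  · rw [f4.real' rfl]
    simp only [start]
    split_ifs with hi
    · subst hi
      exact h3.1 0 a
    · rw [h3.2 i a (Nat.one_le_iff_ne_zero.2 (Fin.val_ne_zero_iff.2 hi)), h2.1]

/-- The planner. -/
def planner : Cmd :=
  .seq sizesCmd <| .seq countCmd <| .seq scalarsCmd <| .seq featCmd <| .seq ginvCmd <|
  .seq startCmd <| .seq mainCmd finalCmd

/-- The planner returns the action of the algorithm. -/
theorem runs_planner [NeZero A] {Q : Problem S A d m} {Z : Matrix (Fin S) (Fin m) ℝ}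
    (hm : 0 < m) (hZ : ∀ s, Q.φ s = ∑ i, Z s i • Q.φ (Q.core i)) (ε : ℝ) (s0 : Fin S) (ω : Tape S A)
    (hN : Bounds A d m (iterations A m Q.mdp.γ ε) N) :
    Runs Q.φ Q.core ω N planner (inputConfig d A m Q.mdp.γ ε s0) fun c' =>
      c'.nat 0 = action Q.mdp.γ Q.φ Q.core ε s0 ω ∧
      c'.calls = 2 * iterations A m Q.mdp.γ ε * callsPerGradient A m := by
  set γ := Q.mdp.γ with hγ
  set T := iterations A m γ ε with hT
  have hγ0 : 0 ≤ γ := Q.mdp.γ_nonneg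
  have hγ1 : γ < 1 := Q.mdp.γ_lt_one
  refine Runs.seq runs_sizesCmd fun c1 h1 f1 => ?_
  obtain ⟨hB1, h14⟩ := h1
  refine Runs.seq (runs_countCmd hB1 h14 (γ := γ) (ε := ε) (by rw [f1.real' rfl]; simp [inputConfig])
    (by rw [f1.real' rfl]; simp [inputConfig]) hγ0 hN.iter) fun c2 h2 f2 => ?_
  have hB2 := hB1.frame f2 rfl
  refine Runs.seq (runs_scalarsCmd hB2 h2.1 h2.2.1 h2.2.2) fun c3 h3 f3 => ?_
  have hB3 := hB2.frame f3 rfl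
  refine Runs.seq (runs_featCmd hB3 hN) fun c4 h4 f4 => ?_
  have hB4 := hB3.frame f4 rfl
  refine Runs.seq (runs_ginvCmd hB4 hN h4) fun c5 h5 f5 => ?_
  have hB5 := hB4.frame f5 rfl
  -- Reading the features and building the inverse leave the scalar parameters in array 0 intact.
  have e0 : c5.real 0 = c3.real 0 := (f5.real' rfl).trans (f4.real' rfl)
  obtain ⟨a0, a2, a3, a4, a5, a6⟩ := h3
  rw [← e0] at a0 a2 a3 a4 a5 a6
  have hE5 : Env A Q.φ Q.core s0 T γ (stepSize A m γ T) (radius m γ) c5 :=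
    { hB5 with
      iter := by rw [f5.nat' rfl, f4.nat' rfl, f3.nat' rfl, h2.1]
      disc := a0, step := a2, rad := a3, stepRad := a4, rate := a5, mass := a6, gin := h5
      feat := by rw [f5.real' rfl]; exact h4 }
  refine Runs.seq (runs_startCmd hE5 hN) fun c6 h6 f6 => ?_
  have hE6 := hE5.frame f6 rfl
  have hc6 : c6.calls = 0 := by
    rw [f6.calls rfl, f5.calls rfl, f4.calls rfl, f3.calls rfl, f2.calls rfl, f1.calls rfl]; rfl
  have hd6 : c6.draws = 0 := by
    rw [f6.draws rfl, f5.draws rfl, f4.draws rfl, f3.draws rfl, f2.draws rfl, f1.draws rfl]; rfl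
  refine Runs.seq (runs_mainCmd hm hγ0 hγ1 hE6 hN h6.1 h6.2 hc6 hd6) fun c7 h7 f7 => ?_
  have hE7 := hE6.frame f7 rfl
  obtain ⟨h71, h72, h73, h74⟩ := h7
  have hw : result γ Q.φ Q.core T (radius m γ) (stepSize A m γ T) s0 ω 0 =
      (if T = 0 then (start A d m γ).2 else (1 / T : ℝ) • fun i a => ∑ τ ∈ Finset.range T,
        (linIter γ Q.φ Q.core (radius m γ) (stepSize A m γ T) s0 ω (τ + 1)).2 i a) 0 := by
    rw [result_eq hZ]
    split_ifs
    · rfl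
    · ext a
      simp
  refine Runs.post (runs_finalCmd hE7 hN (fun h => by rw [h] at h71; exact h71) h72 hw
    (result_isWeight hm hZ _ _ _ _ _).1 h74) fun c8 h8 f8 => ⟨h8.1, ?_⟩
  rw [h8.2, h73]

end Setup

/-! ## The complexity of the planner -/

section Complexity

variable {A m d : ℕ} {γ ε : ℝ}

theorem iterations_le (h0 : 0 ≤ γ) (ε : ℝ) :
    (iterations A m γ ε : ℝ) ≤ m * (1 + ell A m γ) / ε ^ 2 := by
  have := ell_nonneg A m h0
  exact Nat.floor_le (by positivity)

/-- Two pairs of estimates per iteration, each with 1 + (1 + m)A ≤ 3mA calls; this gives the factor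
6. -/
theorem calls_le (hA : 1 ≤ A) (hm : 1 ≤ m) (h0 : 0 ≤ γ) (ε : ℝ) :
    ((2 * iterations A m γ ε * callsPerGradient A m : ℕ) : ℝ) ≤
      6 * (m ^ 2 * A * (1 + Real.log A + γ * Real.log m) / ε ^ 2) := by
  have hT := iterations_le (A := A) (m := m) h0 ε
  have hA' : (1 : ℝ) ≤ A := by exact_mod_cast hA
  have hm' : (1 : ℝ) ≤ m := by exact_mod_cast hm
  have hc : (callsPerGradient A m : ℝ) ≤ 3 * (m * A) := by
    have h1 : (A : ℝ) ≤ m * A := le_mul_of_one_le_left (by positivity) hm'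
    rw [callsPerGradient]
    push_cast
    linarith
  push_cast
  calc 2 * (iterations A m γ ε : ℝ) * callsPerGradient A m
      ≤ 2 * (m * (1 + ell A m γ) / ε ^ 2) * (3 * (m * A)) := by
        have := ell_nonneg A m h0
        gcongr
    _ = 6 * (m ^ 2 * A * (1 + Real.log A + γ * Real.log m) / ε ^ 2) := by
        rw [ell]; ring

/-- Put X = d + A + m + 1/ε. As log n ≤ n and d ≥ 1, the factors m, 1 + ℓ and 1/ε are all at most X,
so T ≤ X⁴. The sizes d + A + m and the summand 1 are each at most X⁴ too. -/
theorem loopBound_le (hd : 1 ≤ d) (hA : 1 ≤ A) (hm : 1 ≤ m) (h0 : 0 ≤ γ) (h1 : γ < 1) (hε : 0 < ε) :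
    ((d + A + m + 1 + iterations A m γ ε : ℕ) : ℝ) ≤ 3 * (d + A + m + 1 / ε) ^ 4 := by
  have hT := iterations_le (A := A) (m := m) h0 ε
  have hd' : (1 : ℝ) ≤ d := by exact_mod_cast hd
  have hA' : (1 : ℝ) ≤ A := by exact_mod_cast hA
  have hm' : (1 : ℝ) ≤ m := by exact_mod_cast hm
  have he : 0 < 1 / ε := by positivity
  set X : ℝ := d + A + m + 1 / ε with hX
  have hX1 : 1 ≤ X := by linarith
  have hl0 := ell_nonneg A m h0
  have hl : 1 + ell A m γ ≤ X := by
    have e1 := Real.log_le_self (Nat.cast_nonneg A)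
    have e2 := Real.log_le_self (Nat.cast_nonneg m)
    have e3 : γ * Real.log m ≤ Real.log m :=
      mul_le_of_le_one_left (Real.log_natCast_nonneg m) h1.le
    rw [ell]
    linarith
  have hT' : (iterations A m γ ε : ℝ) ≤ X ^ 4 := by
    calc (iterations A m γ ε : ℝ) ≤ m * (1 + ell A m γ) / ε ^ 2 := hT
      _ = m * (1 + ell A m γ) * (1 / ε) ^ 2 := by ring
      _ ≤ X * X * X ^ 2 := by
        gcongr <;> linarith
      _ = X ^ 4 := by ring
  have h4 : X ≤ X ^ 4 := le_self_pow₀ hX1 (by decide)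
  push_cast
  linarith

end Complexity

/-- The constant factor of the bounds for the planner. -/
def plannerConst : ℝ := max 113 (planner.size * 3 ^ planner.depth)

theorem planner_complexity {S A d m : ℕ} [NeZero A] {Q : Problem S A d m} (hQ : Q.Assumptions) {ε : ℝ}
    (hε : 0 < ε) (s0 : Fin S) (ω : Tape S A) : ∃ (c : Config S) (n : ℕ),
      Exec Q.φ Q.core ω planner (inputConfig d A m Q.mdp.γ ε s0) c n ∧
      c.nat 0 = (action Q.mdp.γ Q.φ Q.core ε s0 ω : ℕ) ∧
      (c.calls : ℝ) ≤
        plannerConst * (m ^ 2 * A * (1 + Real.log A + Q.mdp.γ * Real.log m) / ε ^ 2) ∧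
      (n : ℝ) ≤ plannerConst * (d + A + m + 1 / ε) ^ (4 * planner.depth) := by
  obtain ⟨Z, hZ, -, -⟩ := hQ.exists_convex
  have hm := hQ.core_pos s0
  have hd := hQ.dim_pos s0
  have hA : 1 ≤ A := NeZero.one_le
  have h0 := Q.mdp.γ_nonneg
  -- One number that dominates the length of every loop. Being at most 3X⁴, it makes the degree of
  -- the time bound four times the nesting depth.
  set N := d + A + m + 1 + iterations A m Q.mdp.γ ε with hN
  have hb : Bounds A d m (iterations A m Q.mdp.γ ε) N := by constructor <;> omega
  obtain ⟨c, n, h1, h2, h3, h4⟩ := runs_planner hm hZ ε s0 ω hb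
  refine ⟨c, n, h1, h3, ?_, ?_⟩
  · rw [h4]
    refine (calls_le hA hm h0 ε).trans (mul_le_mul_of_nonneg_right
      (le_max_of_le_left (by norm_num)) ?_)
    have e1 := Real.log_natCast_nonneg A
    have e2 := mul_nonneg h0 (Real.log_natCast_nonneg m)
    have : 0 ≤ 1 + Real.log A + Q.mdp.γ * Real.log m := by linarith
    positivity
  · have h5 : (n : ℝ) ≤ planner.size * (N : ℝ) ^ planner.depth := by
      exact_mod_cast h2.trans (planner.cost_le hb.one)
    have h6 := loopBound_le (d := d) hd hA hm h0 Q.mdp.γ_lt_one hε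
    refine h5.trans ?_
    calc (planner.size : ℝ) * (N : ℝ) ^ planner.depth
        ≤ planner.size * (3 * (d + A + m + 1 / ε) ^ 4) ^ planner.depth := by gcongr
      _ = planner.size * 3 ^ planner.depth * (d + A + m + 1 / ε) ^ (4 * planner.depth) := by
        rw [mul_pow, ← pow_mul, mul_assoc]
      _ ≤ plannerConst * (d + A + m + 1 / ε) ^ (4 * planner.depth) :=
        mul_le_mul_of_nonneg_right (le_max_right _ _) (by positivity)

end

end CorePlanning

theorem mainTheorem4 :
    ∃ (prog : Cmd) (K : ℝ) (k : ℕ),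
      ∀ (S A d m : ℕ) [NeZero A] (Q : Problem S A d m), Q.Assumptions → ∀ ε : ℝ, 0 < ε →
        (∀ (s0 : Fin S) (ω : Tape S A), ∃ (c : Config S) (n : ℕ),
          Exec Q.φ Q.core ω prog (inputConfig d A m Q.mdp.γ ε s0) c n ∧
          c.nat 0 = (action Q.mdp.γ Q.φ Q.core ε s0 ω : ℕ) ∧
          (c.calls : ℝ) ≤
            K * (m ^ 2 * A * (1 + Real.log A + Q.mdp.γ * Real.log m) / ε ^ 2) ∧
          (n : ℝ) ≤ K * (d + A + m + 1 / ε) ^ k) ∧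
        IsPolicy (Q.plannerPolicy ε) ∧
        ∀ s : Fin S, Q.mdp.optValue s - Q.mdp.value (Q.plannerPolicy ε) s ≤
          K * (Q.epsApprox / (1 - Q.mdp.γ) ^ 2 + ε / (1 - Q.mdp.γ) ^ 3) := by
  refine ⟨planner, plannerConst, 4 * planner.depth, fun S A d m _ Q hQ ε hε =>
    ⟨planner_complexity hQ hε, isPolicy_planner hQ ε, fun s => ?_⟩⟩
  refine (suboptimality hQ hε s).trans (mul_le_mul_of_nonneg_right (le_max_left _ _) ?_)
  have h1 := Q.mdp.one_sub_pos
  have h2 := Q.epsApprox_nonneg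
  positivity
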